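/- **Setting.** A concept class $\mathcal C=\{\mathcal C_d\}_{d\in\mathbb N}$ consists of domains $X_d$ of binary strings of length at most $d$, sets $\mathcal C_d$ of concepts $c:X_d\to\{0,1\}$, and a scheme that represents concepts by binary strings; $\mathrm{size}(c)$ is the length of the shortest representation of $c$. For a distribution $\mathcal X$ on $X_d$ and a target $c$, $\mathrm{err}(h)=\Pr_{x\sim\mathcal X}[h(x)\ne c(x)]$. "Polynomially bounded" means bounded by a polynomial in $d,1/\epsilon,1/\alpha,\log(1/\beta)$. *Private learning.* $\mathcal C$ is privately PAC learnable if there is a randomized algorithm $\mathcal A$ that takes $\epsilon>0$, $\alpha,\beta\in(0,1/2)$ and a database $z\in(X_d\times\{0,1\})^n$ with $n$ polynomial in $d,1/\epsilon,1/\alpha,\log(1/\beta)$, and outputs a hypothesis $h:X_d\to\{0,1\}$, such that (a) $\mathcal A(\epsilon,\alpha,\beta,\cdot)$ is $\epsilon$-differentially private: $\Pr[\mathcal A(z)\in S]\le e^{\epsilon}\Pr[\mathcal A(z')\in S]$ for every set $S$ of outputs and all $z,z'$ that differ in exactly one entry; (b) for all $d$, all $c\in\mathcal C_d$ and all distributions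 $\mathcal X$ on $X_d$, if $z_i=(x_i,c(x_i))$ with $x_i$ drawn i.i.d. from $\mathcal X$, then $\Pr[\mathrm{err}(h)\le\alpha]\ge1-\beta$. *Local learning.* An $\epsilon$-local randomizer is a randomized map $R$ into a discrete set with $\Pr[R(u)=w]\le e^{\epsilon}\Pr[R(u')=w]$ for all $u,u',w$. A randomized, possibly interactive algorithm is $\epsilon$-local if it accesses $z$ only by obtaining values $R(z_i)$, where $i$ and $R$ may depend on earlier answers, and if in every execution, for each $i$, the randomizers applied to $z_i$ are $\epsilon_1$-, $\dots$, $\epsilon_k$-local with $\epsilon_1+\dots+\epsilon_k\le\epsilon$. $\mathcal C$ is locally learnable if (b) holds for some algorithm, with $n$ as above, that is $\epsilon$-local for every $\epsilon>0$ and obtains at most $\mathrm{poly}(d,\mathrm{size}(c),1/\epsilon,1/\alpha,\log(1/\beta))$ such values. *Efficiency.* $\mathcal C$ is efficiently privately PAC learnable if moreover $\mathcal A$ is a program that tosses fair coins, runs in polynomially bounded time, and outputs strings that represent hypotheses and can be evaluated on $x\in X_d$ in polynomial time. $\mathcal C$ is efficiently locally learnable if it has a local learner of this kind for which also the time to evaluate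 each randomizer that it uses is polynomially bounded. Programs receive $d,\lceil1/\epsilon\rceil,\lceil1/\alpha\rceil,\lceil\log_2(1/\beta)\rceil$ in unary. $\mathsf{PARITY}$ is the class of functions $c_r(x)=\sum_i r_ix_i \bmod 2$ on $X_d=\{0,1\}^d$, represented by $r\in\{0,1\}^d$. **Statement.** 1. The locally learnable concept classes form a strict subset of the privately PAC learnable concept classes. 2. The efficiently locally learnable concept classes form a strict subset of the efficiently privately PAC learnable concept classes. 3. $\mathsf{PARITY}$ witnesses both separations: it is efficiently privately PAC learnable (in particular privately PAC learnable), but it is not locally learnable, even without computational restrictions (in particular not efficiently locally learnable). -/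

import Mathlib

/-! Private PAC learning, local learning, and their polynomial-time versions. -/

namespace PrivateLearning

/-! ### Concept classes -/

/-- A concept class, as an ensemble indexed by `d`. The examples in `X_d` are binary strings of
length at most `d`, labels are bits, and the class comes with a representation scheme: `rep d s` is
the concept represented by the string `s` (`none` if `s` represents no concept). -/
structure ConceptClass where
  /-- the domain `X_d` -/
  domain : ℕ → Set (List Bool)
  domain_length : ∀ d, ∀ x ∈ domain d, x.length ≤ d
  /-- the representation scheme of the concepts `X_d → {0,1}` -/
  rep : (d : ℕ) → List Bool → Option (domain d → Bool)

namespace ConceptClass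

/-- The class `C_d`: all the concepts that have a representation. -/
def concepts (C : ConceptClass) (d : ℕ) : Set (C.domain d → Bool) :=
  {c | ∃ s, C.rep d s = some c}

/-- `size(c)`: the length of the shortest representation of `c`. -/
noncomputable def size (C : ConceptClass) (d : ℕ) (c : C.domain d → Bool) : ℕ :=
  sInf {k | ∃ s, C.rep d s = some c ∧ s.length = k}

/-- Labeled examples, i.e. the possible entries of a database. -/
abbrev Example (C : ConceptClass) (d : ℕ) : Type := C.domain d × Bool

end ConceptClass

/-- The inner product modulo 2 of two bit strings. -/
def parityBit (r x : List Bool) : Bool := (List.zipWith and r x).foldr xor false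

/-- `PARITY`: the concepts `c_r(x) = r ⊙ x` on `{0,1}^d`, represented by `r ∈ {0,1}^d`. -/
def PARITY : ConceptClass where
  domain d := {x | x.length = d}
  domain_length _ _ hx := le_of_eq hx
  rep d r := if r.length = d then some (fun x => parityBit r x.1) else none

/-! ### Parameters and polynomial bounds -/

/-- The parameters `d, 1/ε, 1/α, log₂(1/β)`, the last three rounded up to natural numbers. -/
abbrev Params : Type := ℕ × ℕ × ℕ × ℕ

/-- The rounded parameters that belong to `d, ε, α, β`. -/
noncomputable def params (d : ℕ) (ε α β : ℝ) : Params :=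
  (d, ⌈1 / ε⌉₊, ⌈1 / α⌉₊, ⌈Real.logb 2 (1 / β)⌉₊)

/-- The value of a polynomial at given parameters. -/
noncomputable def bound (p : MvPolynomial (Fin 4) ℕ) (k : Params) : ℕ :=
  MvPolynomial.eval ![k.1, k.2.1, k.2.2.1, k.2.2.2] p

/-- The value of a polynomial at given parameters and a given concept size. -/
noncomputable def sizeBound (p : MvPolynomial (Fin 5) ℕ) (k : Params) (s : ℕ) : ℕ :=
  MvPolynomial.eval ![k.1, k.2.1, k.2.2.1, k.2.2.2, s] p

/-! ### Differential privacy -/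

/-- Databases that differ in exactly one entry. -/
def Neighbors {D : Type} {n : ℕ} (z z' : Fin n → D) : Prop := ∃! i, z i ≠ z' i

/-- `ε`-differential privacy of a randomized algorithm on databases with `n` entries. -/
def DifferentiallyPrivate {D O : Type} {n : ℕ} (ε : ℝ) (A : (Fin n → D) → PMF O) : Prop :=
  ∀ z z', Neighbors z z' → ∀ S : Set O,
    (A z).toOuterMeasure S ≤ ENNReal.ofReal (Real.exp ε) * (A z').toOuterMeasure S

/-! ### PAC learning -/

/-- `n` independent draws from `μ`. -/
noncomputable def iid {D : Type} (μ : PMF D) : (n : ℕ) → PMF (Fin n → D)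
  | 0 => PMF.pure Fin.elim0
  | n + 1 => μ.bind fun x => (iid μ n).map fun v => Fin.cons x v

/-- The misclassification error of `h` with respect to the target `c` and the distribution `μ`. -/
noncomputable def err {X : Type} (μ : PMF X) (c h : X → Bool) : ENNReal :=
  μ.toOuterMeasure {x | h x ≠ c x}

/-- On `n` examples drawn independently from `μ` and labeled by `c`, the algorithm `A` outputs with
probability at least `1 - β` a hypothesis of error at most `α`. -/
def PACSucceeds {X : Type} {n : ℕ} (A : (Fin n → X × Bool) → PMF (X → Bool))
    (c : X → Bool) (μ : PMF X) (α β : ℝ) : Prop :=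
  1 - ENNReal.ofReal β ≤
    ((iid (μ.map fun x => (x, c x)) n).bind A).toOuterMeasure {h | err μ c h ≤ ENNReal.ofReal α}

/-- `C` is (inefficiently) privately PAC learnable: some algorithm `A`, which takes a database of
`n = poly(d, 1/ε, 1/α, log(1/β))` labeled examples, is `ε`-differentially private and PAC learns
`C`. The hypothesis class consists of all functions `X_d → {0,1}`. -/
def PrivatelyPACLearnable (C : ConceptClass) : Prop :=
  ∃ (p : MvPolynomial (Fin 4) ℕ)
    (A : (d : ℕ) → (ε α β : ℝ) →
      (Fin (bound p (params d ε α β)) → C.Example d) → PMF (C.domain d → Bool)),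
    ∀ d : ℕ, ∀ ε > 0, ∀ α ∈ Set.Ioo (0 : ℝ) (1 / 2), ∀ β ∈ Set.Ioo (0 : ℝ) (1 / 2),
      DifferentiallyPrivate ε (A d ε α β) ∧
      ∀ c ∈ C.concepts d, ∀ μ : PMF (C.domain d), PACSucceeds (A d ε α β) c μ α β

/-! ### Local algorithms -/

/-- An `ε`-local randomizer `D → W`. -/
def LocalRandomizer {D W : Type} (ε : ℝ) (R : D → PMF W) : Prop :=
  ∀ u u' w, R u w ≤ ENNReal.ofReal (Real.exp ε) * R u' w

/-- A randomized (interactive) algorithm that accesses a database in `D^n` only by applying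
randomizers to single entries: it stops with an output, makes a random choice of its own, or asks
for the value of a randomizer `R` at entry `i` and continues depending on the answer. -/
inductive LocalProtocol (D : Type) (n : ℕ) (O : Type) : Type 1
  | output (o : O) : LocalProtocol D n O
  | toss {ι : Type} (ν : PMF ι) (next : ι → LocalProtocol D n O) : LocalProtocol D n O
  | query (i : Fin n) {W : Type} (R : D → PMF W) (next : W → LocalProtocol D n O) :
      LocalProtocol D n O

namespace LocalProtocol

variable {D O : Type} {n : ℕ}

/-- The output distribution on the database `z`. -/
noncomputable def run (z : Fin n → D) : LocalProtocol D n O → PMF O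
  | output o => PMF.pure o
  | toss ν next => ν.bind fun a => (next a).run z
  | query i R next => (R (z i)).bind fun w => (next w).run z

/-- In every execution, the randomizers applied to entry `i` are `ε₁`-, ..., `ε_k`-local randomizers
with `ε₁ + ... + ε_k ≤ b i`, for each `i`. -/
def WithinBudget : LocalProtocol D n O → (Fin n → ℝ) → Prop
  | output _, _ => True
  | toss ν next, b => ∀ a ∈ ν.support, (next a).WithinBudget b
  | query i R next, b => ∃ ε₁ : ℝ, 0 ≤ ε₁ ∧ ε₁ ≤ b i ∧ LocalRandomizer ε₁ R ∧
      ∀ w, (∃ u, w ∈ (R u).support) → (next w).WithinBudget (Function.update b i (b i - ε₁))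

/-- An `ε`-local algorithm. -/
def IsLocal (ε : ℝ) (P : LocalProtocol D n O) : Prop := P.WithinBudget fun _ => ε

/-- At most `k` randomizers are invoked in every execution. -/
def QueriesAtMost : LocalProtocol D n O → ℕ → Prop
  | output _, _ => True
  | toss ν next, k => ∀ a ∈ ν.support, (next a).QueriesAtMost k
  | query _ _ _, 0 => False
  | query _ R next, k + 1 => ∀ w, (∃ u, w ∈ (R u).support) → (next w).QueriesAtMost k

end LocalProtocol

/-- `C` is (inefficiently) locally learnable: it is PAC learnable from
`n = poly(d, 1/ε, 1/α, log(1/β))` examples by an `ε`-local algorithm that invokes at most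
`poly(d, size(c), 1/ε, 1/α, log(1/β))` randomizers. Differential privacy is not demanded separately:
it has to be derived from `ε`-locality by composition. -/
def LocallyLearnable (C : ConceptClass) : Prop :=
  ∃ (p : MvPolynomial (Fin 4) ℕ) (q : MvPolynomial (Fin 5) ℕ)
    (A : (d : ℕ) → (ε α β : ℝ) →
      LocalProtocol (C.Example d) (bound p (params d ε α β)) (C.domain d → Bool)),
    ∀ d : ℕ, ∀ ε > 0, ∀ α ∈ Set.Ioo (0 : ℝ) (1 / 2), ∀ β ∈ Set.Ioo (0 : ℝ) (1 / 2),
      (A d ε α β).IsLocal ε ∧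
      ∀ c ∈ C.concepts d,
        (A d ε α β).QueriesAtMost (sizeBound q (params d ε α β) (C.size d c)) ∧
        ∀ μ : PMF (C.domain d), PACSucceeds (fun z => (A d ε α β).run z) c μ α β

/-! ### A machine model with a step count

Programs manipulate binary trees (cons cells), as in pure LISP or in the WHILE language of N. Jones.
Every elementary operation handles a constant number of pointers and costs one step; a computation
of `t` steps allocates at most `t` new cells. Up to polynomials, time is the same as on Turing
machines. -/

/-- Binary trees: the data of the machine. -/
inductive Cell
  | nil : Cell
  | cons (a b : Cell) : Cell

namespace Cell

/-- The first component (`nil` for `nil`). -/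
def hd : Cell → Cell
  | nil => nil
  | cons a _ => a

/-- The second component (`nil` for `nil`). -/
def tl : Cell → Cell
  | nil => nil
  | cons _ b => b

/-- The number of nodes. -/
def size : Cell → ℕ
  | nil => 1
  | cons a b => a.size + b.size + 1

end Cell

/-- Programs. -/
inductive Code
  | id : Code
  | nil : Code
  | hd : Code
  | tl : Code
  | pair (f g : Code) : Code
  | comp (f g : Code) : Code
  | ite (c f g : Code) : Code
  | while (c f : Code) : Code

/-- `Runs M x y t`: on input `x`, program `M` halts with result `y` after exactly `t` steps. -/
inductive Runs : Code → Cell → Cell → ℕ → Prop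
  | id (x : Cell) : Runs Code.id x x 1
  | nil (x : Cell) : Runs Code.nil x Cell.nil 1
  | hd (x : Cell) : Runs Code.hd x x.hd 1
  | tl (x : Cell) : Runs Code.tl x x.tl 1
  | pair {f g : Code} {x y y' : Cell} {s t : ℕ} :
      Runs f x y s → Runs g x y' t → Runs (Code.pair f g) x (Cell.cons y y') (s + t + 1)
  | comp {f g : Code} {x y z : Cell} {s t : ℕ} :
      Runs g x y s → Runs f y z t → Runs (Code.comp f g) x z (s + t + 1)
  | ite_true {c f g : Code} {x v z : Cell} {s t : ℕ} :
      Runs c x v s → v ≠ Cell.nil → Runs f x z t → Runs (Code.ite c f g) x z (s + t + 1)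
  | ite_false {c f g : Code} {x z : Cell} {s t : ℕ} :
      Runs c x Cell.nil s → Runs g x z t → Runs (Code.ite c f g) x z (s + t + 1)
  | while_done {c f : Code} {x : Cell} {s : ℕ} :
      Runs c x Cell.nil s → Runs (Code.while c f) x x (s + 1)
  | while_step {c f : Code} {x v y z : Cell} {s t u : ℕ} :
      Runs c x v s → v ≠ Cell.nil → Runs f x y t → Runs (Code.while c f) y z u →
      Runs (Code.while c f) x z (s + t + u + 1)

/-- Types whose elements are written as data of the machine. -/
class Encoded (T : Type) where
  /-- the encoding -/
  enc : T → Cell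

/-- Bits. -/
instance instEncodedBool : Encoded Bool where
  enc b := if b then Cell.cons Cell.nil Cell.nil else Cell.nil

/-- The unary encoding of a natural number. -/
def encNat : ℕ → Cell
  | 0 => Cell.nil
  | k + 1 => Cell.cons Cell.nil (encNat k)

/-- Natural numbers, in unary. -/
instance instEncodedNat : Encoded ℕ where
  enc := encNat

/-- Pairs. -/
instance instEncodedProd {S T : Type} [Encoded S] [Encoded T] : Encoded (S × T) where
  enc a := Cell.cons (Encoded.enc a.1) (Encoded.enc a.2)

/-- Tagged unions. -/
instance instEncodedSum {S T : Type} [Encoded S] [Encoded T] : Encoded (S ⊕ T) where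
  enc
    | Sum.inl a => Cell.cons Cell.nil (Encoded.enc a)
    | Sum.inr b => Cell.cons (Cell.cons Cell.nil Cell.nil) (Encoded.enc b)

/-- Lists. -/
instance instEncodedList {T : Type} [Encoded T] : Encoded (List T) where
  enc l := l.foldr (fun a c => Cell.cons (Encoded.enc a) c) Cell.nil

/-- `f` is computed by a program in time polynomial in the size of the input. -/
def PolyTime {S T : Type} [Encoded S] [Encoded T] (f : S → T) : Prop :=
  ∃ (M : Code) (p : Polynomial ℕ), ∀ a : S,
    ∃ t ≤ p.eval (Encoded.enc a).size, Runs M (Encoded.enc a) (Encoded.enc (f a)) t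

/-! ### Efficient learning -/

/-- A string of `r` independent fair coin tosses. -/
noncomputable def coins (r : ℕ) : PMF (List Bool) :=
  (PMF.uniformOfFintype (Fin r → Bool)).map List.ofFn

/-- A labeled example as it is given to a program. -/
def exampleString {C : ConceptClass} {d : ℕ} (u : C.Example d) : List Bool × Bool := (u.1.1, u.2)

/-- The hypothesis on `X_d` represented by the string `s`, for an evaluation procedure `E`. -/
def hypothesis (C : ConceptClass) (d : ℕ) (E : List Bool × List Bool → Bool) (s : List Bool) :
    C.domain d → Bool :=
  fun x => E (s, x.1)

/-- The randomized algorithm given by a function `F` of the parameters, the database, and `r` coin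
tosses. -/
noncomputable def randomizedAlg {C : ConceptClass} {d n : ℕ}
    (F : Params × List (List Bool × Bool) × List Bool → List Bool) (k : Params) (r : ℕ)
    (z : Fin n → C.Example d) : PMF (List Bool) :=
  (coins r).map fun ω => F (k, List.ofFn fun i => exampleString (z i), ω)

/-- `C` is efficiently privately PAC learnable: a private PAC learner, which outputs representations
of hypotheses, runs in time polynomial in `d, 1/ε, 1/α, log(1/β)`, and hypotheses can be evaluated
in polynomial time. The parameters are given to the program in unary, rounded as in `params`. -/
def EfficientlyPrivatelyPACLearnable (C : ConceptClass) : Prop :=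
  ∃ (p r : MvPolynomial (Fin 4) ℕ)
    (F : Params × List (List Bool × Bool) × List Bool → List Bool)
    (E : List Bool × List Bool → Bool),
    PolyTime F ∧ PolyTime E ∧
    ∀ d : ℕ, ∀ ε > 0, ∀ α ∈ Set.Ioo (0 : ℝ) (1 / 2), ∀ β ∈ Set.Ioo (0 : ℝ) (1 / 2),
      let k := params d ε α β
      let A : (Fin (bound p k) → C.Example d) → PMF (List Bool) := randomizedAlg F k (bound r k)
      DifferentiallyPrivate ε A ∧
      ∀ c ∈ C.concepts d, ∀ μ : PMF (C.domain d),
        PACSucceeds (fun z => (A z).map (hypothesis C d E)) c μ α β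

/-- The local algorithm given by a next-action function `L` and an evaluation procedure `Q` for
randomizers. From the parameters, its own coin tosses `ω` and the answers so far, `L` computes
either the final output or the next query, consisting of an index and a description of a randomizer.
The described randomizer maps `u` to the first `l` bits of what `Q` computes from the parameters,
the description, `u` and `s` fresh coin tosses. The algorithm makes at most `T` queries; it stops
with the empty string when it attempts another one or when an index is out of range. -/
noncomputable def localAlgFrom {C : ConceptClass} {d n : ℕ}
    (L : Params × List Bool × List (List Bool) → (ℕ × List Bool) ⊕ List Bool)
    (Q : Params × List Bool × (List Bool × Bool) × List Bool → List Bool)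
    (k : Params) (s l : ℕ) (ω : List Bool) :
    (T : ℕ) → (answers : List (List Bool)) → LocalProtocol (C.Example d) n (List Bool)
  | 0, answers =>
    match L (k, ω, answers) with
    | Sum.inr h => LocalProtocol.output h
    | Sum.inl _ => LocalProtocol.output []
  | T + 1, answers =>
    match L (k, ω, answers) with
    | Sum.inr h => LocalProtocol.output h
    | Sum.inl (i, desc) =>
      if hi : i < n then
        LocalProtocol.query ⟨i, hi⟩
          (fun u => (coins s).map fun η => (Q (k, desc, exampleString u, η)).take l)
          (fun w => localAlgFrom L Q k s l ω T (answers ++ [w]))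
      else LocalProtocol.output []

/-- The same, with the `r` coin tosses of the algorithm. -/
noncomputable def localAlg {C : ConceptClass} {d n : ℕ}
    (L : Params × List Bool × List (List Bool) → (ℕ × List Bool) ⊕ List Bool)
    (Q : Params × List Bool × (List Bool × Bool) × List Bool → List Bool)
    (k : Params) (r s l T : ℕ) : LocalProtocol (C.Example d) n (List Bool) :=
  LocalProtocol.toss (coins r) fun ω => localAlgFrom L Q k s l ω T []

/-- `C` is efficiently locally learnable: a local learner, which outputs representations of
hypotheses, runs in time polynomial in `d, 1/ε, 1/α, log(1/β)`, so does the evaluation of the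
randomizers that it invokes, and hypotheses can be evaluated in polynomial time. The number of
queries, the numbers of coin tosses and the length of the answers are polynomially bounded. -/
def EfficientlyLocallyLearnable (C : ConceptClass) : Prop :=
  ∃ (p r s l T : MvPolynomial (Fin 4) ℕ)
    (L : Params × List Bool × List (List Bool) → (ℕ × List Bool) ⊕ List Bool)
    (Q : Params × List Bool × (List Bool × Bool) × List Bool → List Bool)
    (E : List Bool × List Bool → Bool),
    PolyTime L ∧ PolyTime Q ∧ PolyTime E ∧
    ∀ d : ℕ, ∀ ε > 0, ∀ α ∈ Set.Ioo (0 : ℝ) (1 / 2), ∀ β ∈ Set.Ioo (0 : ℝ) (1 / 2),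
      let k := params d ε α β
      let A : LocalProtocol (C.Example d) (bound p k) (List Bool) :=
        localAlg L Q k (bound r k) (bound s k) (bound l k) (bound T k)
      A.IsLocal ε ∧
      ∀ c ∈ C.concepts d, ∀ μ : PMF (C.domain d),
        PACSucceeds (fun z => (A.run z).map (hypothesis C d E)) c μ α β

end PrivateLearning

namespace PrivateLearning

/-! ### Time and output size of programs -/

/-! Inclusions. In a local algorithm, changing entry `i` changes the likelihood of an answer only
when entry `i` is queried. The factors `exp ε₁, ..., exp ε_k` multiply along the execution to at
most `exp ε`, which gives differential privacy (`LocalProtocol.run_apply_le`). In the efficient case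
the interaction must moreover be turned into one program that tosses all its coins in advance
(`localAlgFrom_run`, `PolyTime.simulation`). This needs a calculus of polynomial time for the cell
machine. Its only delicate point is composition: by sharing, a short computation can produce an
exponentially large tree. Depth, however, grows by at most one per step, and for the data types in
use (`Tame`) the size of an encoding is polynomial in its depth.

Parity is not locally learnable. Fix an execution of a 1-local algorithm. As a function of the
database, its likelihood is a product of weights `g i (z i)`, and each weight varies by a factor of
at most `e`. Replacing uniformly random labels by those of `c_r` changes the mean of such a weight
by a Fourier coefficient at `r`. By Parseval and Cauchy-Schwarz, for `d = 2j` these changes add up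
over all `2^(2j)` targets to at most `2^(j+1)` times the mean (`sum_expect_sub_le`). Replacing the
`n` entries costs `n * 2^(j+1)` in total, relative to the likelihood under random labels, and
summing over executions keeps this bound (`LocalProtocol.lower_bound`). Distinct parities disagree
on half of the domain, so a hypothesis is accurate for at most one `r`. Hence `2^(2j) - 1` is at
most `2^(2j) / 4 + n * 2^(j+1)`, and `n` is exponential in `d` (`parity_local_sample_bound`).
Neither interaction nor the number of queries enters.

Parity is efficiently privately learnable. On a chunk of examples the learner gives up with
probability 1/2. Otherwise it keeps each example with a probability `p` of order `ε` and outputs a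
uniformly random solution of the kept linear equations, failing if there is none. One more equation
leaves the solution set unchanged, halves it, or empties it. Each outcome therefore becomes at most
twice as likely; for failure this holds because it already has probability at least 1/2
(`solveLaw_insert_le`). Since an example is kept only with probability `p`, it changes the law of
the outcome by a factor between `1 - p` and `1 + p` (`keptLaw_insert`), and `(1 + p) / (1 - p) ≤ exp
ε`. Chunks are disjoint, so repeating until the first success costs no further privacy
(`resultLaw_apply_le`). For accuracy, a union bound over the `2^d` parities shows that it is
unlikely that any inaccurate one satisfies the kept equations, and consistent chunks fail with
probability exactly 1/2 (`expect_resultLaw_bad_le`). Uniform solutions come from Gaussian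
elimination started at a uniformly random vector, because all solutions are reached from equally
many starting vectors (`SolveInvariant.concat_of_mem`). -/

/-- The depth of a tree. -/
def Cell.depth : Cell → ℕ
  | Cell.nil => 0
  | Cell.cons a b => max a.depth b.depth + 1

theorem Cell.depth_lt_size (x : Cell) : x.depth < x.size := by
  induction x with
  | nil => simp [Cell.depth, Cell.size]
  | cons a b iha ihb => simp only [Cell.depth, Cell.size]; omega

theorem Cell.depth_hd_le (x : Cell) : x.hd.depth ≤ x.depth := by
  cases x <;> simp only [Cell.hd, Cell.depth] <;> omega

theorem Cell.depth_tl_le (x : Cell) : x.tl.depth ≤ x.depth := by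
  cases x <;> simp only [Cell.tl, Cell.depth] <;> omega

/-- Only `pair` creates a cell, and it adds one level at the cost of one step. Size has no such
bound: pairing a value with itself doubles it. -/
theorem Runs.depth_le {M : Code} {x y : Cell} {t : ℕ} (h : Runs M x y t) :
    y.depth ≤ x.depth + t := by
  induction h with
  | id x => omega
  | nil x => simp [Cell.depth]
  | hd x => have := x.depth_hd_le; omega
  | tl x => have := x.depth_tl_le; omega
  | pair _ _ ih₁ ih₂ => simp only [Cell.depth]; omega
  | comp _ _ ih₁ ih₂ => omega
  | ite_true _ _ _ _ ih => omega
  | ite_false _ _ _ ih => omega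
  | while_done _ _ => omega
  | while_step _ _ _ _ _ ih₁ ih₂ => omega

theorem eval_mono (p : Polynomial ℕ) {x y : ℕ} (h : x ≤ y) : p.eval x ≤ p.eval y := by
  induction p using Polynomial.induction_on' with
  | add p q hp hq => simpa using add_le_add hp hq
  | monomial n a => simpa using Nat.mul_le_mul_left a (Nat.pow_le_pow_left h n)

/-- The size of the encoding of `a`. -/
def encSize {T : Type} [Encoded T] (a : T) : ℕ := (Encoded.enc a).size

/-- Data types in which the size of an encoding is polynomially bounded by its depth. -/
class Tame (T : Type) [Encoded T] : Prop where
  exists_bound : ∃ q : Polynomial ℕ, ∀ a : T, encSize a ≤ q.eval (Encoded.enc a).depth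

instance instEncodedUnit : Encoded Unit where
  enc _ := Cell.nil

/-! ### Sizes of encoded data -/

section Sizes

variable {S T : Type} [Encoded S] [Encoded T]

theorem enc_prod (a : S × T) : Encoded.enc a = Cell.cons (Encoded.enc a.1) (Encoded.enc a.2) := rfl

theorem enc_list_cons (a : T) (l : List T) :
    Encoded.enc (a :: l) = Cell.cons (Encoded.enc a) (Encoded.enc l) := rfl

theorem enc_inl (a : S) :
    Encoded.enc (Sum.inl a : S ⊕ T) = Cell.cons Cell.nil (Encoded.enc a) := rfl

theorem enc_inr (b : T) :
    Encoded.enc (Sum.inr b : S ⊕ T) = Cell.cons (Cell.cons Cell.nil Cell.nil) (Encoded.enc b) := rfl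

theorem enc_true : Encoded.enc true = Cell.cons Cell.nil Cell.nil := rfl

@[simp] theorem encSize_prod (a : S × T) : encSize a = encSize a.1 + encSize a.2 + 1 := rfl

@[simp] theorem encSize_nil : encSize ([] : List T) = 1 := rfl

@[simp] theorem encSize_cons (a : T) (l : List T) :
    encSize (a :: l) = encSize a + encSize l + 1 := rfl

@[simp] theorem encSize_unit (a : Unit) : encSize a = 1 := rfl

@[simp] theorem encSize_inl (a : S) : encSize (Sum.inl a : S ⊕ T) = encSize a + 2 := by
  change 1 + (Encoded.enc a).size + 1 = (Encoded.enc a).size + 2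
  omega

@[simp] theorem encSize_inr (b : T) : encSize (Sum.inr b : S ⊕ T) = encSize b + 4 := by
  change (1 + 1 + 1) + (Encoded.enc b).size + 1 = (Encoded.enc b).size + 4
  omega

theorem encSize_bool_le (b : Bool) : encSize b ≤ 3 := by cases b <;> decide

/-- Unary numbers and lists of units are the same cells, so that programs for lists also do
arithmetic. -/
theorem enc_nat (n : ℕ) : Encoded.enc n = Encoded.enc (List.replicate n ()) := by
  induction n with
  | zero => rfl
  | succ n ih => exact congrArg (Cell.cons Cell.nil) ih

@[simp] theorem encSize_nat (n : ℕ) : encSize n = 2 * n + 1 := by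
  induction n with
  | zero => rfl
  | succ n ih =>
    change 1 + encSize n + 1 = _
    omega

theorem encSize_append (l l' : List T) : encSize (l ++ l') + 1 = encSize l + encSize l' := by
  induction l with
  | nil => simp; omega
  | cons a l ih => simp only [List.cons_append, encSize_cons]; omega

theorem length_lt_encSize (l : List T) : l.length < encSize l := by
  induction l with
  | nil => simp
  | cons a l ih => simp only [List.length_cons, encSize_cons]; omega

theorem encSize_le_of_sublist {l l' : List T} (h : l.Sublist l') : encSize l ≤ encSize l' := by
  induction h with
  | slnil => rfl
  | cons a _ ih => simp only [encSize_cons]; omega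
  | cons_cons a _ ih => simp only [encSize_cons]; omega

theorem encSize_bits_le (l : List Bool) : encSize l ≤ 4 * l.length + 1 := by
  induction l with
  | nil => simp
  | cons a l ih =>
    have := encSize_bool_le a
    simp only [encSize_cons, List.length_cons]; omega

end Sizes

/-! ### Depth controls the size of encoded data -/

section Tame

variable {S T : Type} [Encoded S] [Encoded T]

instance : Tame Bool := ⟨⟨3, fun b => by simpa using encSize_bool_le b⟩⟩

instance : Tame Unit := ⟨⟨1, fun _ => by simp⟩⟩

theorem depth_nat (n : ℕ) : (Encoded.enc n).depth = n := by
  induction n with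
  | zero => rfl
  | succ n ih =>
    change max 0 (Encoded.enc n).depth + 1 = _
    omega

instance : Tame ℕ := ⟨⟨2 * Polynomial.X + 1, fun n => by simp [depth_nat]⟩⟩

instance [Tame S] [Tame T] : Tame (S × T) := by
  obtain ⟨q, hq⟩ := Tame.exists_bound (T := S)
  obtain ⟨q', hq'⟩ := Tame.exists_bound (T := T)
  refine ⟨⟨q + q' + 1, fun a => ?_⟩⟩
  have h₁ := (hq a.1).trans (eval_mono q (show _ ≤ (Encoded.enc a).depth by
    simp only [enc_prod, Cell.depth]; omega))
  have h₂ := (hq' a.2).trans (eval_mono q' (show _ ≤ (Encoded.enc a).depth by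
    simp only [enc_prod, Cell.depth]; omega))
  simp only [encSize_prod, Polynomial.eval_add, Polynomial.eval_one] at *
  omega

instance [Tame S] [Tame T] : Tame (S ⊕ T) := by
  obtain ⟨q, hq⟩ := Tame.exists_bound (T := S)
  obtain ⟨q', hq'⟩ := Tame.exists_bound (T := T)
  refine ⟨⟨q + q' + 4, ?_⟩⟩
  rintro (a | b)
  · have h₁ := (hq a).trans (eval_mono q
      (show _ ≤ (Encoded.enc (Sum.inl a : S ⊕ T)).depth by
        simp only [enc_inl, Cell.depth]; omega))
    simp only [encSize_inl, Polynomial.eval_add, Polynomial.eval_ofNat] at *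
    omega
  · have h₁ := (hq' b).trans (eval_mono q'
      (show _ ≤ (Encoded.enc (Sum.inr b : S ⊕ T)).depth by
        simp only [enc_inr, Cell.depth]; omega))
    simp only [encSize_inr, Polynomial.eval_add, Polynomial.eval_ofNat] at *
    omega

/-- A list whose encoding has depth `D` has at most `D` entries, each of size at most `q(D)`. -/
instance [Tame T] : Tame (List T) := by
  obtain ⟨q, hq⟩ := Tame.exists_bound (T := T)
  refine ⟨⟨Polynomial.X * (q + 1) + 1, fun l => ?_⟩⟩
  induction l with
  | nil => simp
  | cons a l ih =>
    have hd : (Encoded.enc (a :: l)).depth =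
      max (Encoded.enc a).depth (Encoded.enc l).depth + 1 := rfl
    have h₁ := (hq a).trans (eval_mono q (show _ ≤ (Encoded.enc (a :: l)).depth by omega))
    have h₂ : q.eval (Encoded.enc l).depth ≤ _ :=
      eval_mono q (show _ ≤ (Encoded.enc (a :: l)).depth by omega)
    have h₃ : (Encoded.enc l).depth + 1 ≤ (Encoded.enc (a :: l)).depth := by omega
    simp only [encSize_cons, Polynomial.eval_add, Polynomial.eval_mul, Polynomial.eval_X,
      Polynomial.eval_one] at *
    generalize (Encoded.enc (a :: l)).depth = D at *
    generalize (Encoded.enc l).depth = D' at *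
    nlinarith

end Tame

/-! ### Closure properties of polynomial time -/

/-- `g` is polynomially bounded in the size of the argument. -/
def PolyBounded {S : Type} [Encoded S] (g : S → ℕ) : Prop :=
  ∃ p : Polynomial ℕ, ∀ a, g a ≤ p.eval (encSize a)

namespace PolyBounded

variable {S : Type} [Encoded S] {f g : S → ℕ}

theorem mono (hg : PolyBounded g) (h : ∀ a, f a ≤ g a) : PolyBounded f :=
  let ⟨p, hp⟩ := hg
  ⟨p, fun a => (h a).trans (hp a)⟩

theorem const (n : ℕ) : PolyBounded fun _ : S => n := ⟨Polynomial.C n, fun _ => by simp⟩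

theorem size : PolyBounded fun a : S => encSize a := ⟨Polynomial.X, fun _ => by simp⟩

theorem add (hf : PolyBounded f) (hg : PolyBounded g) : PolyBounded fun a => f a + g a :=
  let ⟨p, hp⟩ := hf
  let ⟨q, hq⟩ := hg
  ⟨p + q, fun a => by simpa using add_le_add (hp a) (hq a)⟩

theorem mul (hf : PolyBounded f) (hg : PolyBounded g) : PolyBounded fun a => f a * g a :=
  let ⟨p, hp⟩ := hf
  let ⟨q, hq⟩ := hg
  ⟨p * q, fun a => by simpa using Nat.mul_le_mul (hp a) (hq a)⟩

theorem eval (p : Polynomial ℕ) (hf : PolyBounded f) : PolyBounded fun a => p.eval (f a) :=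
  let ⟨q, hq⟩ := hf
  ⟨p.comp q, fun a => by simpa using eval_mono p (hq a)⟩

theorem comp {T : Type} [Encoded T] {k : T → ℕ} {e : S → T} (hk : PolyBounded k)
    (he : PolyBounded fun a => encSize (e a)) : PolyBounded fun a => k (e a) :=
  let ⟨q, hq⟩ := hk
  (he.eval q).mono fun a => hq (e a)

end PolyBounded

namespace PolyTime

variable {S T U V : Type} [Encoded S] [Encoded T] [Encoded U] [Encoded V]

/-- This lets time bounds be assembled from those of subprograms and from sizes of intermediate
values, without exhibiting a polynomial each time. -/
theorem iff_runs {f : S → T} : PolyTime f ↔ ∃ (M : Code) (τ : S → ℕ), PolyBounded τ ∧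
    ∀ a, ∃ t ≤ τ a, Runs M (Encoded.enc a) (Encoded.enc (f a)) t := by
  constructor
  · rintro ⟨M, p, h⟩
    exact ⟨M, fun a => p.eval (encSize a), ⟨p, fun _ => le_rfl⟩, h⟩
  · rintro ⟨M, τ, ⟨p, hp⟩, h⟩
    refine ⟨M, p, fun a => ?_⟩
    obtain ⟨t, ht, hr⟩ := h a
    exact ⟨t, ht.trans (hp a), hr⟩

theorem congr_enc {f : S → T} {g : S → U} (hf : PolyTime f)
    (h : ∀ a, Encoded.enc (g a) = Encoded.enc (f a)) : PolyTime g := by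
  obtain ⟨M, p, hM⟩ := hf
  exact ⟨M, p, fun a => by rw [h]; exact hM a⟩

theorem congr {f g : S → T} (hf : PolyTime f) (h : ∀ a, g a = f a) : PolyTime g :=
  hf.congr_enc fun a => by rw [h]

/-- Time bounds the depth of the output, and tameness converts depth into size. -/
theorem output_bounded [Tame T] {f : S → T} (hf : PolyTime f) :
    PolyBounded fun a => encSize (f a) := by
  obtain ⟨M, p, hM⟩ := hf
  obtain ⟨q, hq⟩ := Tame.exists_bound (T := T)
  refine ((PolyBounded.size.add (PolyBounded.size.eval p)).eval q).mono fun a => ?_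
  obtain ⟨t, ht, hr⟩ := hM a
  refine (hq (f a)).trans (eval_mono q ?_)
  have h₁ := hr.depth_le
  have h₂ := (Encoded.enc a).depth_lt_size
  change t ≤ p.eval (encSize a) at ht
  change _ < encSize a at h₂
  omega

/-- The time of `g` is polynomial in the size of the intermediate value; tameness of the middle type
keeps that size polynomial. -/
theorem comp [Tame T] {g : T → U} {f : S → T} (hg : PolyTime g) (hf : PolyTime f) :
    PolyTime fun a => g (f a) := by
  have hb := hf.output_bounded
  obtain ⟨M, σ, hσ, hM⟩ := iff_runs.1 hg
  obtain ⟨N, τ, hτ, hN⟩ := iff_runs.1 hf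
  refine iff_runs.2 ⟨Code.comp M N, fun a => τ a + σ (f a) + 1,
    (hτ.add (hσ.comp hb)).add (.const 1), fun a => ?_⟩
  obtain ⟨s, hs, hr⟩ := hN a
  obtain ⟨t, ht, hr'⟩ := hM (f a)
  exact ⟨s + t + 1, by dsimp only; omega, .comp hr hr'⟩

theorem id : PolyTime fun a : S => a :=
  iff_runs.2 ⟨Code.id, fun _ => 1, .const 1, fun _ => ⟨1, le_rfl, .id _⟩⟩

/-- A program with constant result `c`. -/
def constCode : Cell → Code
  | Cell.nil => Code.nil
  | Cell.cons a b => Code.pair (constCode a) (constCode b)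

theorem runs_constCode (c x : Cell) : Runs (constCode c) x c c.size := by
  induction c with
  | nil => exact .nil x
  | cons a b iha ihb => exact .pair iha ihb

theorem const (b : T) : PolyTime fun _ : S => b :=
  iff_runs.2 ⟨constCode (Encoded.enc b), fun _ => _, .const _,
    fun _ => ⟨_, le_rfl, runs_constCode _ _⟩⟩

theorem pair {f : S → T} {g : S → U} (hf : PolyTime f) (hg : PolyTime g) :
    PolyTime fun a => (f a, g a) := by
  obtain ⟨M, σ, hσ, hM⟩ := iff_runs.1 hf
  obtain ⟨N, τ, hτ, hN⟩ := iff_runs.1 hg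
  refine iff_runs.2 ⟨Code.pair M N, fun a => σ a + τ a + 1, (hσ.add hτ).add (.const 1),
    fun a => ?_⟩
  obtain ⟨s, hs, hr⟩ := hM a
  obtain ⟨t, ht, hr'⟩ := hN a
  exact ⟨s + t + 1, by dsimp only; omega, .pair hr hr'⟩

theorem fst {f : S → T × U} (hf : PolyTime f) : PolyTime fun a => (f a).1 := by
  obtain ⟨M, σ, hσ, hM⟩ := iff_runs.1 hf
  refine iff_runs.2 ⟨Code.comp Code.hd M, fun a => σ a + 1 + 1, (hσ.add (.const 1)).add (.const 1),
    fun a => ?_⟩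
  obtain ⟨s, hs, hr⟩ := hM a
  exact ⟨s + 1 + 1, by dsimp only; omega, .comp hr (.hd _)⟩

theorem snd {f : S → T × U} (hf : PolyTime f) : PolyTime fun a => (f a).2 := by
  obtain ⟨M, σ, hσ, hM⟩ := iff_runs.1 hf
  refine iff_runs.2 ⟨Code.comp Code.tl M, fun a => σ a + 1 + 1, (hσ.add (.const 1)).add (.const 1),
    fun a => ?_⟩
  obtain ⟨s, hs, hr⟩ := hM a
  exact ⟨s + 1 + 1, by dsimp only; omega, .comp hr (.tl _)⟩

theorem cond {c : S → Bool} {f g : S → T} (hc : PolyTime c) (hf : PolyTime f) (hg : PolyTime g) :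
    PolyTime fun a => if c a then f a else g a := by
  obtain ⟨K, ρ, hρ, hK⟩ := iff_runs.1 hc
  obtain ⟨M, σ, hσ, hM⟩ := iff_runs.1 hf
  obtain ⟨N, τ, hτ, hN⟩ := iff_runs.1 hg
  refine iff_runs.2 ⟨Code.ite K M N, fun a => ρ a + (σ a + τ a) + 1,
    (hρ.add (hσ.add hτ)).add (.const 1), fun a => ?_⟩
  obtain ⟨u, hu, hr⟩ := hK a
  obtain ⟨s, hs, hr'⟩ := hM a
  obtain ⟨t, ht, hr''⟩ := hN a
  cases h : c a
  · rw [h] at hr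
    exact ⟨u + t + 1, by dsimp only; omega, .ite_false hr (by simpa using hr'')⟩
  · rw [h] at hr
    exact ⟨u + s + 1, by dsimp only; omega, .ite_true hr (by simp [enc_true]) (by simpa using hr')⟩

theorem cons {f : S → T} {g : S → List T} (hf : PolyTime f) (hg : PolyTime g) :
    PolyTime fun a => f a :: g a :=
  (hf.pair hg).congr_enc fun _ => rfl

theorem isEmpty {l : S → List T} (hl : PolyTime l) : PolyTime fun a => (l a).isEmpty := by
  obtain ⟨M, σ, hσ, hM⟩ := iff_runs.1 hl
  refine iff_runs.2 ⟨Code.ite M Code.nil (constCode (Encoded.enc true)), fun a => σ a + 3 + 1,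
    (hσ.add (.const 3)).add (.const 1), fun a => ?_⟩
  obtain ⟨t, ht, hr⟩ := hM a
  cases h : l a with
  | nil =>
    rw [h] at hr
    exact ⟨t + 3 + 1, by dsimp only; omega, .ite_false hr (runs_constCode _ _)⟩
  | cons b l' =>
    rw [h] at hr
    exact ⟨t + 1 + 1, by dsimp only; omega, .ite_true hr (by simp [enc_list_cons]) (.nil _)⟩

/-- A nonempty list and the pair of its head and tail are the same cell, so the computed list can be
handed to `g` unchanged. It is computed twice because the test of `ite` discards its value. -/
theorem listCases [Tame U] {l : S → List U} {f : S → T} {g : S × U × List U → T}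
    (hl : PolyTime l) (hf : PolyTime f) (hg : PolyTime g) :
    PolyTime fun a => match l a with
      | [] => f a
      | u :: l' => g (a, u, l') := by
  have hb := hl.output_bounded
  obtain ⟨K, ρ, hρ, hK⟩ := iff_runs.1 hl
  obtain ⟨M, σ, hσ, hM⟩ := iff_runs.1 hf
  obtain ⟨N, q, hN⟩ := hg
  refine iff_runs.2 ⟨Code.ite K (Code.comp N (Code.pair Code.id K)) M,
    fun a => ρ a + (σ a + ((1 + ρ a + 1) + q.eval (encSize a + encSize (l a) + 1) + 1)) + 1,
    (hρ.add (hσ.add ((((PolyBounded.const 1).add hρ).add (.const 1)).add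
      (((PolyBounded.size.add hb).add (.const 1)).eval q) |>.add (.const 1)))).add (.const 1),
    fun a => ?_⟩
  obtain ⟨u, hu, hr⟩ := hK a
  cases h : l a with
  | nil =>
    obtain ⟨s, hs, hr'⟩ := hM a
    rw [h] at hr
    exact ⟨u + s + 1, by dsimp only; omega, .ite_false hr hr'⟩
  | cons b l' =>
    obtain ⟨s, hs, hr'⟩ := hN (a, b, l')
    rw [h] at hr
    change s ≤ q.eval (encSize a + encSize (b :: l') + 1) at hs
    exact ⟨u + ((1 + u + 1) + s + 1) + 1, by dsimp only; rw [h]; omega,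
      .ite_true hr (by simp [enc_list_cons]) (.comp (.pair (.id _) hr) hr')⟩

theorem sumCases [Tame U] [Tame V] {l : S → U ⊕ V} {f : S × U → T} {g : S × V → T}
    (hl : PolyTime l) (hf : PolyTime f) (hg : PolyTime g) :
    PolyTime fun a => match l a with
      | Sum.inl u => f (a, u)
      | Sum.inr v => g (a, v) := by
  have hb := hl.output_bounded
  obtain ⟨K, ρ, hρ, hK⟩ := iff_runs.1 hl
  obtain ⟨M, q, hM⟩ := hf
  obtain ⟨N, q', hN⟩ := hg
  -- The tag of `inl` is `nil`, so the left case is the else branch.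
  refine iff_runs.2 ⟨Code.ite (Code.comp Code.hd K)
      (Code.comp N (Code.pair Code.id (Code.comp Code.tl K)))
      (Code.comp M (Code.pair Code.id (Code.comp Code.tl K))),
    fun a => (ρ a + 2) + ((ρ a + 6) + (q + q').eval (encSize a + encSize (l a) + 1)) + 1,
    ((hρ.add (.const 2)).add ((hρ.add (.const 6)).add
      (((PolyBounded.size.add hb).add (.const 1)).eval (q + q')))).add (.const 1),
    fun a => ?_⟩
  obtain ⟨u, hu, hr⟩ := hK a
  cases h : l a with
  | inl b =>
    obtain ⟨s, hs, hr'⟩ := hM (a, b)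
    rw [h] at hr
    have hs' := hs.trans (eval_mono q
      (show _ ≤ encSize a + encSize (Sum.inl b : U ⊕ V) + 1 by
        rw [encSize_inl]; change encSize a + encSize b + 1 ≤ _; omega))
    exact ⟨(u + 1 + 1) + ((1 + (u + 1 + 1) + 1) + s + 1) + 1,
      by simp only [Polynomial.eval_add, h]; omega,
      .ite_false (.comp hr (.hd _)) (.comp (.pair (.id _) (.comp hr (.tl _))) hr')⟩
  | inr b =>
    obtain ⟨s, hs, hr'⟩ := hN (a, b)
    rw [h] at hr
    have hs' := hs.trans (eval_mono q'
      (show _ ≤ encSize a + encSize (Sum.inr b : U ⊕ V) + 1 by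
        rw [encSize_inr]; change encSize a + encSize b + 1 ≤ _; omega))
    exact ⟨(u + 1 + 1) + ((1 + (u + 1 + 1) + 1) + s + 1) + 1,
      by simp only [Polynomial.eval_add, h]; omega,
      .ite_true (.comp hr (.hd _)) (by simp [enc_inr, Cell.hd])
        (.comp (.pair (.id _) (.comp hr (.tl _))) hr')⟩

/-- The body of the loop that folds `N` over a list. The state of the loop consists of the rest of
the list, the parameters, and the accumulator. -/
def foldBody (N : Code) : Code :=
  Code.pair (Code.comp Code.tl Code.hd) (Code.pair (Code.comp Code.hd Code.tl)
    (Code.comp N (Code.pair (Code.comp Code.hd Code.tl)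
      (Code.pair (Code.comp Code.tl Code.tl) (Code.comp Code.hd Code.hd)))))

/-- The loop test reads the first component, which is `nil` exactly when the list is used up. The
time bound on `N` is required only for accumulators that occur at prefixes of `l`; the constant 30
generously covers the overhead of one round. -/
theorem runs_fold {N : Code} {step : S × T × U → T} (a : S) (τ : ℕ) (l : List U) (b : T)
    (h : ∀ l' u, l' ++ [u] <+: l → ∃ t ≤ τ,
      Runs N (Encoded.enc (a, l'.foldl (fun b u => step (a, b, u)) b, u))
        (Encoded.enc (step (a, l'.foldl (fun b u => step (a, b, u)) b, u))) t) :
    ∃ t ≤ l.length * (τ + 30) + 2, Runs (Code.while Code.hd (foldBody N)) (Encoded.enc (l, a, b))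
      (Encoded.enc (([] : List U), a, l.foldl (fun b u => step (a, b, u)) b)) t := by
  induction l generalizing b with
  | nil => exact ⟨2, by omega, .while_done (.hd _)⟩
  | cons u l ih =>
    obtain ⟨s, hs, hr⟩ := h [] u (by simp)
    obtain ⟨t, ht, hr'⟩ := ih (step (a, b, u)) fun l' u' hl => h (u :: l') u' (by simpa using hl)
    have hbody : Runs (foldBody N) (Encoded.enc (u :: l, a, b))
        (Encoded.enc (l, a, step (a, b, u))) _ :=
      .pair (.comp (.hd _) (.tl _)) (.pair (.comp (.tl _) (.hd _))
        (.comp (.pair (.comp (.tl _) (.hd _)) (.pair (.comp (.tl _) (.tl _))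
          (.comp (.hd _) (.hd _)))) hr))
    refine ⟨_, ?_, .while_step (.hd _) (by simp [enc_prod, enc_list_cons, Cell.hd]) hbody hr'⟩
    rw [List.length_cons, add_one_mul]
    omega

theorem encSize_le_of_mem {u : U} {l : List U} (h : u ∈ l) : encSize u ≤ encSize l := by
  induction l with
  | nil => simp at h
  | cons v l ih =>
    rw [encSize_cons]
    rcases List.mem_cons.1 h with rfl | h
    · omega
    · have := ih h; omega

/-- A fold whose accumulators are polynomially bounded. -/
theorem foldl [Tame U] {l : S → List U} {init : S → T} {step : S × T × U → T}
    (hl : PolyTime l) (hinit : PolyTime init) (hstep : PolyTime step) {B : S → ℕ}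
    (hB : PolyBounded B) (hs : ∀ a, ∀ l', l' <+: l a →
      encSize (l'.foldl (fun b u => step (a, b, u)) (init a)) ≤ B a) :
    PolyTime fun a => (l a).foldl (fun b u => step (a, b, u)) (init a) := by
  have hb := hl.output_bounded
  obtain ⟨K, ρ, hρ, hK⟩ := iff_runs.1 hl
  obtain ⟨M, σ, hσ, hM⟩ := iff_runs.1 hinit
  obtain ⟨N, q, hN⟩ := hstep
  let τ : S → ℕ := fun a => q.eval (encSize a + (B a + encSize (l a) + 1) + 1)
  have hτ : PolyBounded τ :=
    ((PolyBounded.size.add ((hB.add hb).add (.const 1))).add (.const 1)).eval q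
  refine iff_runs.2 ⟨Code.comp (Code.comp Code.tl Code.tl)
    (Code.comp (Code.while Code.hd (foldBody N)) (Code.pair K (Code.pair Code.id M))),
    fun a => (ρ a + σ a + 20) + (encSize (l a) * (τ a + 30) + 2),
    ((hρ.add hσ).add (.const 20)).add ((hb.mul (hτ.add (.const 30))).add (.const 2)), fun a => ?_⟩
  obtain ⟨u, hu, hr⟩ := hK a
  obtain ⟨s, hs', hr'⟩ := hM a
  obtain ⟨t, ht, hr''⟩ := runs_fold (N := N) (step := step) a (τ a) (l a) (init a) (by
    intro l' u hl'
    obtain ⟨t, ht, hr⟩ := hN (a, l'.foldl (fun b u => step (a, b, u)) (init a), u)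
    refine ⟨t, ht.trans (eval_mono q ?_), hr⟩
    change encSize a +
      (encSize (l'.foldl (fun b u => step (a, b, u)) (init a)) + encSize u + 1) + 1 ≤ _
    have h₁ := hs a l' ((List.prefix_append l' [u]).trans hl')
    have h₂ : encSize u ≤ encSize (l a) := encSize_le_of_mem (hl'.subset (by simp))
    omega)
  have h₃ := Nat.mul_le_mul_right (τ a + 30) (length_lt_encSize (l a)).le
  exact ⟨_, by dsimp only; omega,
    .comp (.comp (.pair hr (.pair (.id _) hr')) hr'') (.comp (.tl _) (.tl _))⟩

/-- A fold in which each step increases the size of the accumulator by a polynomially bounded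
amount. -/
theorem foldl_of_growth [Tame T] [Tame U] {l : S → List U} {init : S → T} {step : S × T × U → T}
    (hl : PolyTime l) (hinit : PolyTime init) (hstep : PolyTime step) {B : S → ℕ}
    (hB : PolyBounded B)
    (hs : ∀ a b, ∀ u ∈ l a, encSize (step (a, b, u)) ≤ encSize b + B a) :
    PolyTime fun a => (l a).foldl (fun b u => step (a, b, u)) (init a) := by
  refine foldl hl hinit hstep
    (hinit.output_bounded.add (hl.output_bounded.mul hB)) fun a l' hl' => ?_
  have key : ∀ (m : List U) (b : T), (∀ u ∈ m, u ∈ l a) →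
      encSize (m.foldl (fun b u => step (a, b, u)) b) ≤ encSize b + m.length * B a := by
    intro m
    induction m with
    | nil => simp
    | cons u m ih =>
      intro b hm
      have h₁ := ih (step (a, b, u)) fun v hv => hm v (by simp [hv])
      have h₂ := hs a b u (hm u (by simp))
      rw [List.foldl_cons, List.length_cons, add_one_mul]
      omega
  refine (key l' (init a) fun u hu => hl'.subset hu).trans ?_
  have := Nat.mul_le_mul_right (B a) (hl'.length_le.trans (length_lt_encSize (l a)).le)
  omega

end PolyTime

end PrivateLearning

namespace PrivateLearning

namespace PolyTime

theorem foldl_cons_reverse {T : Type} (l l' : List T) :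
    l.foldl (fun b u => u :: b) l' = l.reverse ++ l' := by
  induction l generalizing l' with
  | nil => rfl
  | cons a l ih => simp [ih]

theorem foldl_cons_map {T U : Type} (g : T → U) (l : List T) (l' : List U) :
    l.foldl (fun b u => g u :: b) l' = (l.map g).reverse ++ l' := by
  induction l generalizing l' with
  | nil => rfl
  | cons a l ih => simp [ih]

theorem foldl_cons_filter {T : Type} (g : T → Bool) (l l' : List T) :
    l.foldl (fun b u => if g u then u :: b else b) l' = (l.filter g).reverse ++ l' := by
  induction l generalizing l' with
  | nil => rfl
  | cons a l ih => by_cases h : g a <;> simp [ih, h]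

variable {S T U V : Type} [Encoded S] [Encoded T] [Encoded U] [Encoded V]

/-! ### Lists -/

theorem tail [Tame T] {l : S → List T} (hl : PolyTime l) : PolyTime fun a => (l a).tail :=
  (listCases hl (const []) id.snd.snd).congr fun a => by cases l a <;> rfl

theorem headD [Tame T] {l : S → List T} (hl : PolyTime l) (b : T) :
    PolyTime fun a => (l a).headD b :=
  (listCases hl (const b) id.snd.fst).congr fun a => by cases l a <;> rfl

theorem revAppend [Tame T] {l l' : S → List T} (hl : PolyTime l) (hl' : PolyTime l') :
    PolyTime fun a => (l a).reverse ++ l' a := by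
  refine (foldl_of_growth (T := List T) (step := fun x => x.2.2 :: x.2.1) hl hl'
    (id.snd.snd.cons id.snd.fst) (B := fun a => encSize (l a) + 1)
    (hl.output_bounded.add (.const 1)) fun a b u hu => ?_).congr
    fun a => (foldl_cons_reverse _ _).symm
  have := encSize_le_of_mem hu
  simp only [encSize_cons]
  omega

theorem reverse [Tame T] {l : S → List T} (hl : PolyTime l) : PolyTime fun a => (l a).reverse :=
  (hl.revAppend (const [])).congr fun _ => by simp

theorem append [Tame T] {l l' : S → List T} (hl : PolyTime l) (hl' : PolyTime l') :
    PolyTime fun a => l a ++ l' a :=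
  (hl.reverse.revAppend hl').congr fun _ => by simp

theorem encSize_pair_le_of_mem {l : S → List T} {a : S} {u : T} (hu : u ∈ l a) :
    encSize (a, u) ≤ encSize (a, l a) := by
  have := encSize_le_of_mem hu
  simp only [encSize_prod]
  omega

theorem map [Tame T] [Tame U] {l : S → List T} {g : S × T → U} (hl : PolyTime l)
    (hg : PolyTime g) : PolyTime fun a => (l a).map fun u => g (a, u) := by
  obtain ⟨q, hq⟩ := hg.output_bounded
  have h : PolyTime fun a => (l a).foldl (fun b u => g (a, u) :: b) [] := by
    refine foldl_of_growth (T := List U) (step := fun x => g (x.1, x.2.2) :: x.2.1) hl (const [])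
      ?_ (B := fun a => q.eval (encSize a + encSize (l a) + 1) + 1)
      ((((PolyBounded.size.add hl.output_bounded).add (.const 1)).eval q).add (.const 1))
      fun a b u hu => ?_
    -- Using `comp` here would require `Tame S`. The argument of `g` is only a rearrangement of
    -- parts of the state, so its size is bounded directly.
    · have : PolyTime fun x : S × List U × T => g (x.1, x.2.2) := by
        obtain ⟨M, p, hM⟩ := hg
        refine iff_runs.2 ⟨Code.comp M (Code.pair Code.hd (Code.comp Code.tl Code.tl)),
          fun x => p.eval (encSize x) + 6, (PolyBounded.size.eval p).add (.const 6), fun x => ?_⟩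
        obtain ⟨t, ht, hr⟩ := hM (x.1, x.2.2)
        have := ht.trans (eval_mono p (show _ ≤ encSize x by
          change encSize (x.1, x.2.2) ≤ _
          simp only [encSize_prod]; omega))
        exact ⟨_, by dsimp only; omega, .comp (.pair (.hd _) (.comp (.tl _) (.tl _))) hr⟩
      exact this.cons id.snd.fst
    · have h₁ := (hq (a, u)).trans (eval_mono q (encSize_pair_le_of_mem hu))
      simp only [encSize_cons, encSize_prod] at *
      omega
  exact h.reverse.congr fun a => by rw [foldl_cons_map]; simp

theorem filter [Tame S] [Tame T] {l : S → List T} {g : S × T → Bool} (hl : PolyTime l)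
    (hg : PolyTime g) : PolyTime fun a => (l a).filter fun u => g (a, u) := by
  have h : PolyTime fun a => (l a).foldl (fun b u => if g (a, u) then u :: b else b) [] := by
    refine foldl_of_growth (T := List T)
      (step := fun x => if g (x.1, x.2.2) then x.2.2 :: x.2.1 else x.2.1) hl (const [])
      (cond (hg.comp (id.fst.pair id.snd.snd)) (id.snd.snd.cons id.snd.fst) id.snd.fst)
      (B := fun a => encSize (l a) + 1) (hl.output_bounded.add (.const 1)) fun a b u hu => ?_
    have := encSize_le_of_mem hu
    dsimp only
    split
    · simp only [encSize_cons]; omega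
    · omega
  exact h.reverse.congr fun a => by rw [foldl_cons_filter]; simp

/-! ### Natural numbers -/

theorem units {n : S → ℕ} (hn : PolyTime n) : PolyTime fun a => List.replicate (n a) () :=
  hn.congr_enc fun _ => (enc_nat _).symm

theorem length [Tame T] {l : S → List T} (hl : PolyTime l) : PolyTime fun a => (l a).length := by
  refine (map (U := Unit) hl (const ())).congr_enc fun a => ?_
  rw [enc_nat, List.map_const']

theorem succ {n : S → ℕ} (hn : PolyTime n) : PolyTime fun a => n a + 1 :=
  ((const ()).cons hn.units).congr_enc fun _ => enc_nat _

theorem add {m n : S → ℕ} (hm : PolyTime m) (hn : PolyTime n) : PolyTime fun a => m a + n a :=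
  (hm.units.append hn.units).congr_enc fun _ => by rw [enc_nat, List.replicate_append_replicate]

/-- Iteration of a function that increases the size of its argument by a polynomially bounded
amount. -/
theorem iterate_of_growth [Tame S] [Tame T] {n : S → ℕ} {init : S → T} {step : S × T → T}
    (hn : PolyTime n) (hinit : PolyTime init) (hstep : PolyTime step) {B : S → ℕ}
    (hB : PolyBounded B) (hs : ∀ a b, encSize (step (a, b)) ≤ encSize b + B a) :
    PolyTime fun a => (fun b => step (a, b))^[n a] (init a) := by
  refine (foldl_of_growth (step := fun x => step (x.1, x.2.1)) hn.units hinit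
    (hstep.comp (id.fst.pair id.snd.fst)) hB fun a b _ _ => hs a b).congr fun a => ?_
  induction n a generalizing init with
  | zero => rfl
  | succ k ih =>
    rw [List.replicate_succ, List.foldl_cons, Function.iterate_succ_apply]
    -- The outer induction only splits off one step. The inner one works with an arbitrary starting
    -- value.
    generalize step (a, init a) = b
    clear ih
    induction k generalizing b with
    | zero => rfl
    | succ k ih => rw [List.replicate_succ, List.foldl_cons, Function.iterate_succ_apply, ih]

theorem mul [Tame S] {m n : S → ℕ} (hm : PolyTime m) (hn : PolyTime n) :
    PolyTime fun a => m a * n a := by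
  refine (iterate_of_growth (T := ℕ) (step := fun x => x.2 + n x.1) hm (const 0)
    (id.snd.add (hn.comp id.fst)) (B := fun a => encSize (n a)) hn.output_bounded
    fun a b => by simp only [encSize_nat]; omega).congr fun a => ?_
  simp only [add_right_iterate]
  simp

theorem drop [Tame S] [Tame T] {n : S → ℕ} {l : S → List T} (hn : PolyTime n) (hl : PolyTime l) :
    PolyTime fun a => (l a).drop (n a) := by
  refine (iterate_of_growth (T := List T) (step := fun x => x.2.tail) hn hl
    id.snd.tail (.const 0) fun a b => encSize_le_of_sublist (List.tail_sublist b)).congr fun a => ?_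
  generalize l a = l
  induction n a generalizing l with
  | zero => rfl
  | succ k ih => rw [Function.iterate_succ_apply, ← ih, List.drop_tail]

theorem sub [Tame S] {m n : S → ℕ} (hm : PolyTime m) (hn : PolyTime n) :
    PolyTime fun a => m a - n a :=
  (drop hn hm.units).congr_enc fun a => by rw [enc_nat, List.drop_replicate]

theorem take [Tame S] [Tame T] {n : S → ℕ} {l : S → List T} (hn : PolyTime n) (hl : PolyTime l) :
    PolyTime fun a => (l a).take (n a) :=
  (drop (sub hl.length hn) hl.reverse).reverse.congr fun a => by
    rw [List.drop_reverse, List.reverse_reverse, List.take_eq_take_iff]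
    omega

theorem le [Tame S] {m n : S → ℕ} (hm : PolyTime m) (hn : PolyTime n) :
    PolyTime fun a => decide (m a ≤ n a) :=
  (hm.sub hn).units.isEmpty.congr fun a => by
    rw [Bool.eq_iff_iff]
    simp [Nat.sub_eq_zero_iff_le]

theorem replicate [Tame T] {n : S → ℕ} (hn : PolyTime n) (b : T) :
    PolyTime fun a => List.replicate (n a) b :=
  (map hn.units (const b)).congr fun a => by simp

/-! ### Bits -/

theorem bool₂ (f : Bool → Bool → T) {b c : S → Bool} (hb : PolyTime b) (hc : PolyTime c) :
    PolyTime fun a => f (b a) (c a) :=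
  (hb.cond (hc.cond (const (f true true)) (const (f true false)))
    (hc.cond (const (f false true)) (const (f false false)))).congr fun a => by
      cases b a <;> cases c a <;> rfl

theorem bound (p : MvPolynomial (Fin 4) ℕ) {k : S → Params} [Tame S] (hk : PolyTime k) :
    PolyTime fun a => bound p (k a) := by
  induction p using MvPolynomial.induction_on with
  | C n => exact (const n).congr fun _ => by simp [PrivateLearning.bound]
  | add p q hp hq => exact (hp.add hq).congr fun _ => by simp [PrivateLearning.bound]
  | mul_X p i hp =>
    have : PolyTime fun a => (![(k a).1, (k a).2.1, (k a).2.2.1, (k a).2.2.2] : Fin 4 → ℕ) i := by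
      fin_cases i
      · exact hk.fst
      · exact hk.snd.fst
      · exact hk.snd.snd.fst
      · exact hk.snd.snd.snd
    exact (hp.mul this).congr fun _ => by simp [PrivateLearning.bound]

end PolyTime

end PrivateLearning

namespace PrivateLearning

open scoped ENNReal

/-! ### Independent draws -/

theorem pmf_bind_congr {D O : Type} (μ : PMF D) {f g : D → PMF O}
    (h : ∀ a ∈ μ.support, f a = g a) : μ.bind f = μ.bind g := by
  ext o
  rw [PMF.bind_apply, PMF.bind_apply]
  refine tsum_congr fun a => ?_
  by_cases ha : μ a = 0
  · rw [ha, zero_mul, zero_mul]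
  · rw [h a ha]

/-- The list of `n` independent draws from `μ`. -/
noncomputable def draws {D : Type} (μ : PMF D) : ℕ → PMF (List D)
  | 0 => PMF.pure []
  | n + 1 => μ.bind fun x => (draws μ n).map fun l => x :: l

theorem map_iid {D : Type} (μ : PMF D) (n : ℕ) : (iid μ n).map List.ofFn = draws μ n := by
  induction n with
  | zero => simp [iid, draws, PMF.pure_map]
  | succ n ih =>
    rw [iid, draws, PMF.map_bind]
    congr 1
    funext x
    rw [← ih, PMF.map_comp, PMF.map_comp]
    congr 1
    funext v
    simp [List.ofFn_succ]

theorem draws_length {D : Type} {μ : PMF D} {n : ℕ} {l : List D} (h : l ∈ (draws μ n).support) :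
    l.length = n := by
  induction n generalizing l with
  | zero => simpa [draws] using h
  | succ n ih =>
    simp only [draws, PMF.mem_support_bind_iff, PMF.mem_support_map_iff] at h
    obtain ⟨x, -, l', hl', rfl⟩ := h
    simp [ih hl']

theorem draws_add {D : Type} (μ : PMF D) (m n : ℕ) :
    draws μ (m + n) = (draws μ m).bind fun l => (draws μ n).map fun l' => l ++ l' := by
  induction m with
  | zero =>
    rw [Nat.zero_add, draws, PMF.pure_bind]
    simp only [List.nil_append]
    exact (PMF.map_id _).symm
  | succ m ih =>
    rw [Nat.add_right_comm, draws, draws, PMF.bind_bind]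
    congr 1
    funext x
    rw [ih, PMF.map_bind, PMF.bind_map]
    congr 1
    funext l
    simp only [Function.comp, PMF.map_comp]
    rfl

/-- The two parts of a long sample are independent. This is what lets a deterministic program
consume a coin string with `take` and `drop`. -/
theorem draws_add_bind {D O : Type} (μ : PMF D) (m n : ℕ) (f : List D → List D → PMF O) :
    ((draws μ (m + n)).bind fun l => f (l.take m) (l.drop m)) =
      (draws μ m).bind fun l => (draws μ n).bind fun l' => f l l' := by
  rw [draws_add, PMF.bind_bind]
  refine pmf_bind_congr _ fun l hl => ?_
  rw [PMF.bind_map]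
  congr 1
  funext l'
  simp [← draws_length hl]

theorem draws_add_map {D O : Type} (μ : PMF D) (m n : ℕ) (f : List D → List D → O) :
    ((draws μ (m + n)).map fun l => f (l.take m) (l.drop m)) =
      (draws μ m).bind fun l => (draws μ n).map fun l' => f l l' :=
  draws_add_bind μ m n fun l l' => PMF.pure (f l l')

theorem iid_apply {D : Type} (μ : PMF D) (n : ℕ) (v : Fin n → D) : iid μ n v = ∏ i, μ (v i) := by
  classical
  induction n with
  | zero =>
    rw [iid, PMF.pure_apply]
    simp [Subsingleton.elim v Fin.elim0]
  | succ n ih =>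
    rw [iid, PMF.bind_apply, tsum_eq_single (v 0), PMF.map_apply, tsum_eq_single (Fin.tail v),
      Fin.prod_univ_succ, ih]
    · simp [Fin.tail]
    · intro w hw
      rw [if_neg]
      intro h
      exact hw (by rw [h, Fin.tail_cons])
    · intro x hx
      rw [PMF.map_apply, ENNReal.tsum_eq_zero.2, mul_zero]
      intro w
      rw [if_neg]
      rintro rfl
      exact hx (by simp)

theorem coins_eq_draws (r : ℕ) : coins r = draws (PMF.uniformOfFintype Bool) r := by
  rw [coins, ← map_iid]
  congr 1
  ext v
  rw [iid_apply]
  simp [ENNReal.inv_pow]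

/-! ### Differential privacy of local algorithms -/

theorem differentiallyPrivate_of_apply_le {D O : Type} {n : ℕ} {ε : ℝ}
    {A : (Fin n → D) → PMF O}
    (h : ∀ z z' i, (∀ j, j ≠ i → z j = z' j) → ∀ o,
      A z o ≤ ENNReal.ofReal (Real.exp ε) * A z' o) : DifferentiallyPrivate ε A := by
  rintro z z' ⟨i, -, hi⟩ S
  rw [PMF.toOuterMeasure_apply, PMF.toOuterMeasure_apply, ← ENNReal.tsum_mul_left]
  refine ENNReal.tsum_le_tsum fun o => ?_
  by_cases ho : o ∈ S
  · simp only [Set.indicator_of_mem ho]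
    exact h z z' i (fun j hj => not_not.1 fun hne => hj (hi j hne)) o
  · simp [Set.indicator_of_notMem ho]

theorem DifferentiallyPrivate.map {D O O' : Type} {n : ℕ} {ε : ℝ} {A : (Fin n → D) → PMF O}
    (hA : DifferentiallyPrivate ε A) (f : O → O') :
    DifferentiallyPrivate ε fun z => (A z).map f := by
  intro z z' hz S
  rw [PMF.toOuterMeasure_map_apply, PMF.toOuterMeasure_map_apply]
  exact hA z z' hz _

/-- Composition of privacy guarantees: factors multiply. Where `p'` vanishes so does `p`, hence
nothing is asked of the kernels there. -/
theorem pmf_bind_apply_le {D O : Type} {p p' : PMF D} {f f' : D → PMF O} {o : O} {c c' : ℝ≥0∞}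
    (hp : ∀ a, p a ≤ c * p' a) (hf : ∀ a, p' a ≠ 0 → f a o ≤ c' * f' a o) :
    p.bind f o ≤ c * c' * p'.bind f' o := by
  rw [PMF.bind_apply, PMF.bind_apply, ← ENNReal.tsum_mul_left]
  refine ENNReal.tsum_le_tsum fun a => ?_
  by_cases ha : p' a = 0
  · have := hp a
    rw [ha, mul_zero] at this
    simp [nonpos_iff_eq_zero.1 this]
  · calc p a * f a o ≤ (c * p' a) * (c' * f' a o) := mul_le_mul' (hp a) (hf a ha)
      _ = c * c' * (p' a * f' a o) := by ring

/-- The remaining budget of entry `i` is the exponent. A query to `i` pays `ε` out of it, and a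
query to another entry has the same answer law on both databases and costs nothing. -/
theorem LocalProtocol.run_apply_le {D O : Type} {n : ℕ} {z z' : Fin n → D} {i : Fin n}
    (hz : ∀ j, j ≠ i → z j = z' j) (o : O) (P : LocalProtocol D n O) (b : Fin n → ℝ)
    (hb : 0 ≤ b i) (hP : P.WithinBudget b) :
    P.run z o ≤ ENNReal.ofReal (Real.exp (b i)) * P.run z' o := by
  induction P generalizing b with
  | output o' =>
    refine le_mul_of_one_le_left' ?_
    rw [ENNReal.one_le_ofReal]
    exact Real.one_le_exp hb
  | toss ν next ih =>
    rw [LocalProtocol.run, LocalProtocol.run, ← one_mul (ENNReal.ofReal _)]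
    exact pmf_bind_apply_le (fun a => by simp) fun a ha => ih a b hb (hP a ha)
  | query j R next ih =>
    obtain ⟨ε, hε, hεb, hR, hnext⟩ := hP
    rw [LocalProtocol.run, LocalProtocol.run]
    by_cases hj : j = i
    · subst hj
      have h₁ : ENNReal.ofReal (Real.exp (b j)) =
          ENNReal.ofReal (Real.exp ε) * ENNReal.ofReal (Real.exp (b j - ε)) := by
        rw [← ENNReal.ofReal_mul (Real.exp_nonneg _), ← Real.exp_add]
        congr 2
        ring
      rw [h₁]
      refine pmf_bind_apply_le (fun w => hR _ _ w) fun w hw => ?_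
      simpa using ih w (Function.update b j (b j - ε)) (by simpa using hεb) (hnext w ⟨_, hw⟩)
    · rw [hz j hj, ← one_mul (ENNReal.ofReal _)]
      refine pmf_bind_apply_le (fun a => by simp) fun w hw => ?_
      have h₂ : Function.update b j (b j - ε) i = b i := Function.update_of_ne (Ne.symm hj) _ _
      have := ih w (Function.update b j (b j - ε)) (by rwa [h₂]) (hnext w ⟨_, hw⟩)
      rwa [h₂] at this

/-- An `ε`-local algorithm is `ε`-differentially private. -/
theorem LocalProtocol.IsLocal.differentiallyPrivate {D O : Type} {n : ℕ} {ε : ℝ} (hε : 0 ≤ ε)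
    {P : LocalProtocol D n O} (hP : P.IsLocal ε) :
    DifferentiallyPrivate ε fun z => P.run z :=
  differentiallyPrivate_of_apply_le fun _ _ _ hz o => P.run_apply_le hz o _ hε hP

theorem LocallyLearnable.privatelyPACLearnable {C : ConceptClass} (h : LocallyLearnable C) :
    PrivatelyPACLearnable C := by
  obtain ⟨p, q, A, hA⟩ := h
  refine ⟨p, fun d ε α β z => (A d ε α β).run z, fun d ε hε α hα β hβ => ?_⟩
  obtain ⟨h₁, h₂⟩ := hA d ε hε α hα β hβ
  exact ⟨h₁.differentiallyPrivate hε.le, fun c hc => (h₂ c hc).2⟩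

theorem EfficientlyPrivatelyPACLearnable.privatelyPACLearnable {C : ConceptClass}
    (h : EfficientlyPrivatelyPACLearnable C) : PrivatelyPACLearnable C := by
  obtain ⟨p, r, F, E, -, -, hA⟩ := h
  refine ⟨p, fun d ε α β z => (randomizedAlg F (params d ε α β)
    (bound r (params d ε α β)) z).map (hypothesis C d E), fun d ε hε α hα β hβ => ?_⟩
  obtain ⟨h₁, h₂⟩ := hA d ε hε α hα β hβ
  exact ⟨h₁.map _, h₂⟩

/-! ### Simulation of efficient local algorithms -/

section Simulation

variable (L : Params × List Bool × List (List Bool) → (ℕ × List Bool) ⊕ List Bool)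
  (Q : Params × List Bool × (List Bool × Bool) × List Bool → List Bool)

/-- One query of a local algorithm, simulated on the database `db`. The state consists of the
answers so far and the unused coin tosses; it does not change if the algorithm makes no query. -/
def simulationStep (k : Params) (s l : ℕ) (ω : List Bool) (db : List (List Bool × Bool))
    (st : List (List Bool) × List Bool) : List (List Bool) × List Bool :=
  match L (k, ω, st.1) with
  | Sum.inl (i, desc) =>
    match db.drop i with
    | [] => st
    | u :: _ => (st.1 ++ [(Q (k, desc, u, st.2.take s)).take l], st.2.drop s)
  | Sum.inr _ => st

/-- The output of a local algorithm after the given answers, if no more queries are allowed. -/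
def simulationOutput (k : Params) (ω : List Bool) (answers : List (List Bool)) : List Bool :=
  match L (k, ω, answers) with
  | Sum.inl _ => []
  | Sum.inr h => h

/-- Each simulated query takes the next `s` coins from one string tossed beforehand. If the
algorithm stops early, the state is a fixed point of the simulation step, so idle rounds and unused
coins do not matter. -/
theorem localAlgFrom_run {C : ConceptClass} {d n : ℕ} (k : Params) (s l : ℕ) (ω : List Bool)
    (z : Fin n → C.Example d) (T : ℕ) (answers : List (List Bool)) :
    (localAlgFrom L Q k s l ω T answers).run z =
      (coins (T * s)).map fun η => simulationOutput L k ω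
        ((simulationStep L Q k s l ω (List.ofFn fun i => exampleString (z i)))^[T]
          (answers, η)).1 := by
  induction T generalizing answers with
  | zero =>
    simp only [localAlgFrom, Function.iterate_zero_apply, simulationOutput]
    cases h : L (k, ω, answers) <;> exact (PMF.map_const _ _).symm
  | succ T ih =>
    have stuck : ∀ η, simulationStep L Q k s l ω (List.ofFn fun i => exampleString (z i))
        (answers, η) = (answers, η) →
        ((simulationStep L Q k s l ω (List.ofFn fun i => exampleString (z i)))^[T + 1]
          (answers, η)).1 = answers := fun η hη => by
      rw [Function.iterate_fixed hη]
    rw [localAlgFrom]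
    cases h : L (k, ω, answers) with
    | inr o =>
      simp only [LocalProtocol.run]
      rw [← PMF.map_const (coins ((T + 1) * s)) o]
      congr 1
      funext η
      rw [stuck η (by simp [simulationStep, h])]
      simp [simulationOutput, h]
    | inl q =>
      obtain ⟨i, desc⟩ := q
      dsimp only
      split_ifs with hi
      · rw [LocalProtocol.run, coins_eq_draws, coins_eq_draws,
          show (T + 1) * s = s + T * s by ring, PMF.bind_map]
        have hstep : ∀ η, (simulationStep L Q k s l ω
            (List.ofFn fun i => exampleString (z i)))^[T + 1] (answers, η) =
            (simulationStep L Q k s l ω (List.ofFn fun i => exampleString (z i)))^[T]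
              (answers ++ [(Q (k, desc, exampleString (z ⟨i, hi⟩), η.take s)).take l],
                η.drop s) := by
          intro η
          rw [Function.iterate_succ_apply]
          congr 1
          simp only [simulationStep, h]
          rw [List.drop_eq_getElem_cons (by simpa using hi)]
          simp
        simp only [hstep]
        rw [draws_add_map _ s (T * s) fun η₁ η₂ => simulationOutput L k ω
          ((simulationStep L Q k s l ω (List.ofFn fun i => exampleString (z i)))^[T]
            (answers ++ [(Q (k, desc, exampleString (z ⟨i, hi⟩), η₁)).take l], η₂)).1]
        congr 1
        funext η
        rw [Function.comp, ih, coins_eq_draws]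
      · simp only [LocalProtocol.run]
        rw [← PMF.map_const (coins ((T + 1) * s)) []]
        congr 1
        funext η
        have hη : simulationStep L Q k s l ω (List.ofFn fun i => exampleString (z i))
            (answers, η) = (answers, η) := by
          simp only [simulationStep, h]
          rw [List.drop_eq_nil_of_le (by simpa using hi)]
        rw [stuck η hη]
        simp [simulationOutput, h]

/-- The simulation of a local algorithm as a function of the parameters, the database, and all the
coin tosses. -/
noncomputable def simulation (r s l T : MvPolynomial (Fin 4) ℕ)
    (x : Params × List (List Bool × Bool) × List Bool) : List Bool :=
  simulationOutput L x.1 (x.2.2.take (bound r x.1))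
    ((simulationStep L Q x.1 (bound s x.1) (bound l x.1) (x.2.2.take (bound r x.1)) x.2.1)^[
      bound T x.1] ([], x.2.2.drop (bound r x.1))).1

theorem randomizedAlg_simulation {C : ConceptClass} {d n : ℕ} (r s l T : MvPolynomial (Fin 4) ℕ)
    (k : Params) (z : Fin n → C.Example d) :
    randomizedAlg (simulation L Q r s l T) k (bound (r + T * s) k) z =
      (localAlg L Q k (bound r k) (bound s k) (bound l k) (bound T k)).run z := by
  have hb : bound (r + T * s) k = bound r k + bound T k * bound s k := by simp [bound]
  rw [randomizedAlg, localAlg, LocalProtocol.run, hb, coins_eq_draws, coins_eq_draws]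
  simp only [localAlgFrom_run, simulation, coins_eq_draws]
  exact draws_add_map _ _ _ fun ω η => simulationOutput L k ω
    ((simulationStep L Q k (bound s k) (bound l k) ω (List.ofFn fun i => exampleString (z i)))^[
      bound T k] ([], η)).1

theorem PolyTime.simulation {L Q} (hL : PolyTime L) (hQ : PolyTime Q)
    (r s l T : MvPolynomial (Fin 4) ℕ) : PolyTime (simulation L Q r s l T) := by
  have hω : PolyTime fun x : Params × List (List Bool × Bool) × List Bool =>
      x.2.2.take (PrivateLearning.bound r x.1) := take (bound r id.fst) id.snd.snd
  have hstep : PolyTime fun y : (Params × List (List Bool × Bool) × List Bool) ×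
      List (List Bool) × List Bool =>
        simulationStep L Q y.1.1 (PrivateLearning.bound s y.1.1) (PrivateLearning.bound l y.1.1)
          (y.1.2.2.take (PrivateLearning.bound r y.1.1)) y.1.2.1 y.2 := by
    unfold simulationStep
    have h₁ : PolyTime fun y : (Params × List (List Bool × Bool) × List Bool) ×
      List (List Bool) × List Bool =>
        L (y.1.1, y.1.2.2.take (PrivateLearning.bound r y.1.1), y.2.1) :=
      hL.comp (id.fst.fst.pair ((hω.comp id.fst).pair id.snd.fst))
    refine (sumCases h₁ (f := fun w => match w.1.1.2.1.drop w.2.1 with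
      | [] => w.1.2
      | u :: _ => (w.1.2.1 ++ [(Q (w.1.1.1, w.2.2, u,
        w.1.2.2.take (PrivateLearning.bound s w.1.1.1))).take (PrivateLearning.bound l w.1.1.1)],
          w.1.2.2.drop (PrivateLearning.bound s w.1.1.1))) (g := fun w => w.1.2) ?_
      id.fst.snd).congr fun y => by
        rcases L (y.1.1, y.1.2.2.take (PrivateLearning.bound r y.1.1), y.2.1) with ⟨i, desc⟩ | o
        · rfl
        · rfl
    refine (listCases (drop id.snd.fst id.fst.fst.snd.fst) id.fst.snd
      (g := fun v : (((Params × List (List Bool × Bool) × List Bool) ×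
        List (List Bool) × List Bool) × ℕ × List Bool) × (List Bool × Bool) ×
          List (List Bool × Bool) => (v.1.1.2.1 ++ [(Q (v.1.1.1.1, v.1.2.2, v.2.1,
        v.1.1.2.2.take (PrivateLearning.bound s v.1.1.1.1))).take
          (PrivateLearning.bound l v.1.1.1.1)],
          v.1.1.2.2.drop (PrivateLearning.bound s v.1.1.1.1))) ?_).congr fun w => by
            rcases w.1.1.2.1.drop w.2.1 with _ | ⟨u, l'⟩ <;> rfl
    have hk : PolyTime fun v : (((Params × List (List Bool × Bool) × List Bool) ×
      List (List Bool) × List Bool) × ℕ × List Bool) × (List Bool × Bool) ×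
        List (List Bool × Bool) => v.1.1.1.1 := id.fst.fst.fst.fst
    exact (id.fst.fst.snd.fst.append ((take (bound l hk) (hQ.comp (hk.pair (id.fst.snd.snd.pair
      (id.snd.fst.pair (take (bound s hk) id.fst.fst.snd.snd)))))).cons (const []))).pair
      (drop (bound s hk) id.fst.fst.snd.snd)
  -- Answers are cut to `l` bits, so a round enlarges the state by an amount that does not depend on
  -- the earlier answers: at most four nodes per bit, and two for the list.
  have hiter := iterate_of_growth (bound T id.fst) ((const []).pair (drop (bound r id.fst)
    id.snd.snd)) hstep (B := fun x => 4 * PrivateLearning.bound l x.1 + 2)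
    (((PolyBounded.const 4).mul ((bound l id.fst).output_bounded.mono fun x => by
      rw [encSize_nat]; omega)).add (.const 2)) (by
      intro x st
      dsimp only
      unfold simulationStep
      split
      · split
        · omega
        · rename_i u _ _
          simp only [encSize_prod]
          have h₁ := encSize_append st.1 [(Q (x.1, ‹List Bool›, u,
            st.2.take (PrivateLearning.bound s x.1))).take (PrivateLearning.bound l x.1)]
          have h₂ := encSize_bits_le ((Q (x.1, ‹List Bool›, u,
            st.2.take (PrivateLearning.bound s x.1))).take (PrivateLearning.bound l x.1))
          have h₃ := encSize_le_of_sublist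
            (List.drop_sublist (PrivateLearning.bound s x.1) st.2)
          rw [List.length_take] at h₂
          simp only [encSize_cons, encSize_nil] at *
          omega
      · omega)
  have hout : PolyTime fun y : (Params × List Bool × List (List Bool)) =>
      simulationOutput L y.1 y.2.1 y.2.2 :=
    (sumCases hL (f := fun _ => []) (g := fun w => w.2) (const []) id.snd).congr
      fun ⟨k, ω, w⟩ => by
        unfold simulationOutput
        cases L (k, ω, w) <;> rfl
  exact hout.comp (id.fst.pair (hω.pair hiter.fst))

end Simulation

theorem EfficientlyLocallyLearnable.efficientlyPrivatelyPACLearnable {C : ConceptClass}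
    (h : EfficientlyLocallyLearnable C) : EfficientlyPrivatelyPACLearnable C := by
  obtain ⟨p, r, s, l, T, L, Q, E, hL, hQ, hE, hA⟩ := h
  refine ⟨p, r + T * s, simulation L Q r s l T, E, hL.simulation hQ r s l T, hE,
    fun d ε hε α hα β hβ => ?_⟩
  obtain ⟨h₁, h₂⟩ := hA d ε hε α hα β hβ
  dsimp only at h₁ h₂ ⊢
  have h₃ := h₁.differentiallyPrivate hε.le
  simp only [← randomizedAlg_simulation] at h₂ h₃
  exact ⟨h₃, h₂⟩

end PrivateLearning

namespace PrivateLearning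

open scoped ENNReal

/-! ### Expectations -/

/-- The expectation of a nonnegative function. -/
noncomputable def expect {D : Type} (μ : PMF D) (g : D → ℝ≥0∞) : ℝ≥0∞ := ∑' u, μ u * g u

section Expect

variable {D O : Type}

theorem expect_pure (a : D) (g : D → ℝ≥0∞) : expect (PMF.pure a) g = g a := by
  classical
  rw [expect, tsum_eq_single a]
  · simp
  · intro b hb
    simp [PMF.pure_apply, hb]

theorem expect_bind (μ : PMF D) (f : D → PMF O) (g : O → ℝ≥0∞) :
    expect (μ.bind f) g = expect μ fun a => expect (f a) g := by
  simp only [expect, PMF.bind_apply, ← ENNReal.tsum_mul_right, ← ENNReal.tsum_mul_left]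
  rw [ENNReal.tsum_comm]
  simp only [mul_assoc]

theorem expect_map (μ : PMF D) (f : D → O) (g : O → ℝ≥0∞) :
    expect (μ.map f) g = expect μ fun a => g (f a) := by
  rw [PMF.map, expect_bind]
  simp only [Function.comp, expect_pure]

theorem expect_congr {μ : PMF D} {f g : D → ℝ≥0∞} (h : ∀ a ∈ μ.support, f a = g a) :
    expect μ f = expect μ g := by
  refine tsum_congr fun a => ?_
  by_cases ha : μ a = 0
  · rw [ha, zero_mul, zero_mul]
  · rw [h a ha]

theorem expect_mono {μ : PMF D} {f g : D → ℝ≥0∞} (h : ∀ a ∈ μ.support, f a ≤ g a) :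
    expect μ f ≤ expect μ g := by
  refine ENNReal.tsum_le_tsum fun a => ?_
  by_cases ha : μ a = 0
  · rw [ha, zero_mul, zero_mul]
  · exact mul_le_mul_right (h a ha) _

theorem expect_const (μ : PMF D) (c : ℝ≥0∞) : expect μ (fun _ => c) = c := by
  rw [expect, ENNReal.tsum_mul_right, PMF.tsum_coe, one_mul]

theorem expect_add (μ : PMF D) (f g : D → ℝ≥0∞) :
    expect μ (fun a => f a + g a) = expect μ f + expect μ g := by
  simp only [expect, mul_add, ENNReal.tsum_add]

theorem expect_mul_left (μ : PMF D) (c : ℝ≥0∞) (g : D → ℝ≥0∞) :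
    expect μ (fun a => c * g a) = c * expect μ g := by
  simp only [expect, ← ENNReal.tsum_mul_left]
  exact tsum_congr fun a => by ring

theorem expect_mul_right (μ : PMF D) (c : ℝ≥0∞) (g : D → ℝ≥0∞) :
    expect μ (fun a => g a * c) = expect μ g * c := by
  simp only [mul_comm _ c, expect_mul_left]

theorem expect_tsum {W : Type} (μ : PMF D) (g : W → D → ℝ≥0∞) :
    expect μ (fun a => ∑' w, g w a) = ∑' w, expect μ (g w) := by
  simp only [expect, ← ENNReal.tsum_mul_left]
  exact ENNReal.tsum_comm

theorem expect_sum {W : Type} (s : Finset W) (μ : PMF D) (g : W → D → ℝ≥0∞) :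
    expect μ (fun a => ∑ w ∈ s, g w a) = ∑ w ∈ s, expect μ (g w) := by
  simp only [expect, Finset.mul_sum]
  exact Summable.tsum_finsetSum fun _ _ => ENNReal.summable

theorem toOuterMeasure_eq_expect (μ : PMF D) (S : Set D) :
    μ.toOuterMeasure S = expect μ (S.indicator 1) := by
  rw [PMF.toOuterMeasure_apply, expect]
  refine tsum_congr fun a => ?_
  by_cases ha : a ∈ S <;> simp [ha]

theorem toOuterMeasure_add_compl (μ : PMF D) (S : Set D) :
    μ.toOuterMeasure S + μ.toOuterMeasure Sᶜ = 1 := by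
  rw [toOuterMeasure_eq_expect, toOuterMeasure_eq_expect, ← expect_add]
  refine Eq.trans (expect_congr (g := fun _ => 1) fun a _ => ?_) (expect_const μ 1)
  by_cases ha : a ∈ S <;> simp [ha]

theorem toOuterMeasure_le_one (μ : PMF D) (S : Set D) : μ.toOuterMeasure S ≤ 1 :=
  (toOuterMeasure_add_compl μ S).le.trans' le_self_add

theorem expect_iid_prod (μ : PMF D) (n : ℕ) (g : Fin n → D → ℝ≥0∞) :
    expect (iid μ n) (fun z => ∏ i, g i (z i)) = ∏ i, expect μ (g i) := by
  induction n with
  | zero => simp [expect_const]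
  | succ n ih =>
    rw [iid, expect_bind, Fin.prod_univ_succ, ← ih, ← expect_mul_right]
    simp only [expect_map, Fin.prod_univ_succ, Fin.cons_zero, Fin.cons_succ, expect_mul_left]

end Expect

/-- The complementary form of `PACSucceeds`. -/
theorem pacSucceeds_iff {X : Type} {n : ℕ} {A : (Fin n → X × Bool) → PMF (X → Bool)}
    {c : X → Bool} {μ : PMF X} {α β : ℝ} : PACSucceeds A c μ α β ↔
      expect (iid (μ.map fun x => (x, c x)) n)
        (fun z => (A z).toOuterMeasure {h | err μ c h ≤ ENNReal.ofReal α}ᶜ) ≤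
        ENNReal.ofReal β := by
  have h : ((iid (μ.map fun x => (x, c x)) n).bind A).toOuterMeasure
      {h | err μ c h ≤ ENNReal.ofReal α}ᶜ = expect (iid (μ.map fun x => (x, c x)) n)
        (fun z => (A z).toOuterMeasure {h | err μ c h ≤ ENNReal.ofReal α}ᶜ) := by
    rw [toOuterMeasure_eq_expect, expect_bind]
    simp only [toOuterMeasure_eq_expect]
  rw [← h, PACSucceeds]
  have h₁ := toOuterMeasure_add_compl ((iid (μ.map fun x => (x, c x)) n).bind A)
    {h | err μ c h ≤ ENNReal.ofReal α}
  have h₂ := toOuterMeasure_le_one ((iid (μ.map fun x => (x, c x)) n).bind A)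
    {h | err μ c h ≤ ENNReal.ofReal α}
  rw [tsub_le_iff_right, ← h₁]
  exact ENNReal.add_le_add_iff_left (h₂.trans_lt ENNReal.one_lt_top).ne

/-! ### A lower bound for local algorithms -/

/-- A union bound for products. Subtraction is truncated, so only factors with `a i < b i` are
charged. -/
theorem prod_le_prod_add_sum {ι : Type} [DecidableEq ι] (s : Finset ι) (a b : ι → ℝ≥0∞) :
    ∏ i ∈ s, b i ≤ ∏ i ∈ s, a i + ∑ i ∈ s, (b i - a i) * ∏ j ∈ s.erase i, b j := by
  induction s using Finset.induction_on with
  | empty => simp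
  | insert k s hk ih =>
    rw [Finset.prod_insert hk, Finset.prod_insert hk, Finset.sum_insert hk, Finset.erase_insert hk]
    have h₁ : ∑ i ∈ s, (b i - a i) * ∏ j ∈ (insert k s).erase i, b j =
        b k * ∑ i ∈ s, (b i - a i) * ∏ j ∈ s.erase i, b j := by
      rw [Finset.mul_sum]
      refine Finset.sum_congr rfl fun i hi => ?_
      have hki : k ≠ i := fun h => hk (h ▸ hi)
      rw [Finset.erase_insert_of_ne hki,
        Finset.prod_insert fun h => hk (Finset.mem_of_mem_erase h)]
      ring
    rw [h₁]
    generalize ∑ i ∈ s, (b i - a i) * ∏ j ∈ s.erase i, b j = E at *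
    generalize ∏ i ∈ s, b i = B at *
    generalize ∏ i ∈ s, a i = A at *
    rcases le_total (a k) (b k) with h | h
    · calc b k * B = (a k + (b k - a k)) * B := by rw [add_tsub_cancel_of_le h]
        _ = a k * B + (b k - a k) * B := by ring
        _ ≤ a k * (A + E) + (b k - a k) * B := by gcongr
        _ = a k * A + ((b k - a k) * B + a k * E) := by ring
        _ ≤ _ := by gcongr
    · calc b k * B ≤ b k * (A + E) := by gcongr
        _ = b k * A + (0 + b k * E) := by ring
        _ ≤ _ := by gcongr; exact zero_le

/-- In each coordinate the losses, summed over all of `ι`, are a multiple `κ` of `b i`. The total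
loss is thus at most `n * κ` products, however large `s` is. -/
theorem sum_prod_lower_bound {ι : Type} [Fintype ι] {n : ℕ} (a : ι → Fin n → ℝ≥0∞)
    (b : Fin n → ℝ≥0∞) {κ : ℝ≥0∞} (h : ∀ i, ∑ r, (b i - a r i) ≤ κ * b i) (s : Finset ι) :
    s.card * ∏ i, b i ≤ ∑ r ∈ s, ∏ i, a r i + n * κ * ∏ i, b i := by
  classical
  calc (s.card : ℝ≥0∞) * ∏ i, b i = ∑ r ∈ s, ∏ i, b i := by simp
    _ ≤ ∑ r ∈ s, (∏ i, a r i + ∑ i, (b i - a r i) * ∏ j ∈ Finset.univ.erase i, b j) :=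
        Finset.sum_le_sum fun r _ => prod_le_prod_add_sum _ _ _
    _ = ∑ r ∈ s, ∏ i, a r i + ∑ i, (∑ r ∈ s, (b i - a r i)) * ∏ j ∈ Finset.univ.erase i, b j := by
        rw [Finset.sum_add_distrib, Finset.sum_comm]
        simp only [Finset.sum_mul]
    _ ≤ ∑ r ∈ s, ∏ i, a r i + ∑ i, (κ * b i) * ∏ j ∈ Finset.univ.erase i, b j := by
        gcongr with i
        exact (Finset.sum_le_sum_of_subset (Finset.subset_univ s)).trans (h i)
    _ = _ := by
        simp only [mul_assoc, Finset.mul_prod_erase _ _ (Finset.mem_univ _)]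
        simp

/-- If the distributions `μ r` can hardly be distinguished from `μ₀` by `ε`-local randomizers, then
an `ε`-local algorithm fails for most `r`. The weights `g` are the likelihoods of the answers that
were given earlier. -/
theorem LocalProtocol.lower_bound_weighted {ι D O : Type} [Fintype ι] {n : ℕ} {μ : ι → PMF D}
    {μ₀ : PMF D} {ε : ℝ} {κ : ℝ≥0∞}
    (hκ : ∀ g : D → ℝ≥0∞, (∀ u u', g u ≤ ENNReal.ofReal (Real.exp ε) * g u') →
      ∑ r, (expect μ₀ g - expect (μ r) g) ≤ κ * expect μ₀ g)
    {bad : ι → Set O} {N : ℕ} (hN : ∀ o, N ≤ {r | o ∈ bad r}.ncard)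
    (P : LocalProtocol D n O) (b : Fin n → ℝ) (hP : P.WithinBudget b) (hb : ∀ i, 0 ≤ b i)
    (g : Fin n → D → ℝ≥0∞)
    (hg : ∀ i u u', g i u ≤ ENNReal.ofReal (Real.exp (ε - b i)) * g i u') :
    N * ∏ i, expect μ₀ (g i) ≤
      ∑ r, expect (iid (μ r) n) (fun z => (∏ i, g i (z i)) * (P.run z).toOuterMeasure (bad r)) +
        n * κ * ∏ i, expect μ₀ (g i) := by
  classical
  induction P generalizing b g with
  | output o =>
    -- The execution is complete. Since the unspent budget is nonnegative, each accumulated weight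
    -- varies by at most `exp ε`, and `hκ` applies.
    have h₁ : ∀ i, ∑ r, (expect μ₀ (g i) - expect (μ r) (g i)) ≤ κ * expect μ₀ (g i) := by
      refine fun i => hκ _ fun u u' => (hg i u u').trans ?_
      gcongr
      linarith [hb i]
    have h₂ := sum_prod_lower_bound (fun r i => expect (μ r) (g i)) _ h₁
      (Finset.univ.filter fun r => o ∈ bad r)
    have h₃ : N ≤ (Finset.univ.filter fun r => o ∈ bad r).card := by
      have := hN o
      rwa [Set.ncard_eq_toFinset_card', Set.toFinset_ofPred] at this
    refine le_trans ?_ (h₂.trans (le_of_eq ?_))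
    · gcongr
    · rw [Finset.sum_filter]
      congr 1
      refine Finset.sum_congr rfl fun r _ => ?_
      simp only [LocalProtocol.run, PMF.toOuterMeasure_pure_apply]
      rw [expect_mul_right, expect_iid_prod]
      split_ifs <;> simp
  | toss ν next ih =>
    have h₁ : ∀ r, expect (iid (μ r) n) (fun z => (∏ i, g i (z i)) *
        ((toss ν next).run z).toOuterMeasure (bad r)) =
        ∑' a, ν a * expect (iid (μ r) n) (fun z => (∏ i, g i (z i)) *
          ((next a).run z).toOuterMeasure (bad r)) := by
      intro r
      simp only [LocalProtocol.run, PMF.toOuterMeasure_bind_apply, ← ENNReal.tsum_mul_left,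
        expect_tsum]
      refine tsum_congr fun a => ?_
      rw [← expect_mul_left]
      congr 1
      funext z
      ring
    simp only [h₁]
    rw [← Summable.tsum_finsetSum fun _ _ => ENNReal.summable]
    simp only [← Finset.mul_sum]
    have h₂ : ∀ x : ℝ≥0∞, x = ∑' a, ν a * x := fun x => by
      rw [ENNReal.tsum_mul_right, PMF.tsum_coe, one_mul]
    rw [h₂ ((N : ℝ≥0∞) * _), h₂ (n * κ * _), ← ENNReal.tsum_add]
    refine ENNReal.tsum_le_tsum fun a => ?_
    rw [← mul_add]
    by_cases ha : ν a = 0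
    · simp [ha]
    · gcongr
      exact ih a b (hP a ha) hb g hg
  | query i R next ih =>
    obtain ⟨ε₁, hε₁, hε₁b, hR, hnext⟩ := hP
    -- The likelihood of the answer `w` is absorbed into the weight of the queried entry. This keeps
    -- the product form despite adaptivity.
    let g' := fun w j u => g j u * if j = i then R u w else 1
    have hprod : ∀ w (z : Fin n → D), ∏ j, g' w j (z j) = (∏ j, g j (z j)) * R (z i) w := by
      intro w z
      simp only [g']
      rw [Finset.prod_mul_distrib, Finset.prod_ite_eq' Finset.univ i fun j => R (z j) w]
      simp
    have h₁ : ∀ r, expect (iid (μ r) n) (fun z => (∏ i, g i (z i)) *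
        ((query i R next).run z).toOuterMeasure (bad r)) =
        ∑' w, expect (iid (μ r) n) (fun z => (∏ j, g' w j (z j)) *
          ((next w).run z).toOuterMeasure (bad r)) := by
      intro r
      simp only [LocalProtocol.run, PMF.toOuterMeasure_bind_apply, ← ENNReal.tsum_mul_left,
        expect_tsum]
      refine tsum_congr fun w => ?_
      congr 1
      funext z
      rw [hprod]
      ring
    have hne : ∀ w, ∀ j ∈ Finset.univ.erase i, expect μ₀ (g' w j) = expect μ₀ (g j) := by
      intro w j hj
      simp [g', Finset.ne_of_mem_erase hj]
    have hi : ∀ w, expect μ₀ (g' w i) = expect μ₀ fun u => g i u * R u w := by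
      intro w
      simp [g']
    -- The answer probabilities sum to one, so the reference weight splits exactly over the answers.
    have h₂ : ∏ j, expect μ₀ (g j) = ∑' w, ∏ j, expect μ₀ (g' w j) := by
      have : ∀ w, ∏ j, expect μ₀ (g' w j) =
          (expect μ₀ fun u => g i u * R u w) * ∏ j ∈ Finset.univ.erase i, expect μ₀ (g j) := by
        intro w
        rw [← Finset.mul_prod_erase _ _ (Finset.mem_univ i), Finset.prod_congr rfl (hne w), hi]
      simp only [this]
      rw [ENNReal.tsum_mul_right, ← expect_tsum, ← Finset.mul_prod_erase _ _ (Finset.mem_univ i)]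
      simp only [ENNReal.tsum_mul_left, PMF.tsum_coe, mul_one]
    simp only [h₁]
    rw [← Summable.tsum_finsetSum fun _ _ => ENNReal.summable, h₂, ← ENNReal.tsum_mul_left,
      ← ENNReal.tsum_mul_left, ← ENNReal.tsum_add]
    refine ENNReal.tsum_le_tsum fun w => ?_
    -- The budget condition says nothing about impossible answers, but these have reference weight
    -- zero.
    by_cases hw : ∃ u, w ∈ (R u).support
    · refine ih w _ (hnext w hw) (fun j => ?_) (g' w) fun j u u' => ?_
      · by_cases hj : j = i
        · subst hj; simpa using hε₁b
        · simpa [hj] using hb j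
      · by_cases hj : j = i
        · subst hj
          simp only [g', if_true, Function.update_self]
          calc g j u * R u w ≤ (ENNReal.ofReal (Real.exp (ε - b j)) * g j u') *
                (ENNReal.ofReal (Real.exp ε₁) * R u' w) := mul_le_mul' (hg j u u') (hR u u' w)
            _ = ENNReal.ofReal (Real.exp (ε - b j)) * ENNReal.ofReal (Real.exp ε₁) *
                (g j u' * R u' w) := by ring
            _ = _ := by
                rw [← ENNReal.ofReal_mul (Real.exp_nonneg _), ← Real.exp_add,
                  show ε - b j + ε₁ = ε - (b j - ε₁) by ring]
        · simpa [g', hj] using hg j u u'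
    · have h₃ : ∏ j, expect μ₀ (g' w j) = 0 := by
        refine Finset.prod_eq_zero (Finset.mem_univ i) ?_
        rw [hi]
        push Not at hw
        simp only [PMF.mem_support_iff, ne_eq, not_not] at hw
        simp [hw, expect]
      simp [h₃]

theorem LocalProtocol.lower_bound {ι D O : Type} [Fintype ι] {n : ℕ} {μ : ι → PMF D}
    {μ₀ : PMF D} {ε : ℝ} (hε : 0 ≤ ε) {κ : ℝ≥0∞}
    (hκ : ∀ g : D → ℝ≥0∞, (∀ u u', g u ≤ ENNReal.ofReal (Real.exp ε) * g u') →
      ∑ r, (expect μ₀ g - expect (μ r) g) ≤ κ * expect μ₀ g)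
    {bad : ι → Set O} {N : ℕ} (hN : ∀ o, N ≤ {r | o ∈ bad r}.ncard)
    (P : LocalProtocol D n O) (hP : P.IsLocal ε) :
    N ≤ ∑ r, expect (iid (μ r) n) (fun z => (P.run z).toOuterMeasure (bad r)) + n * κ := by
  have := P.lower_bound_weighted hκ hN _ hP (fun _ => hε) (fun _ _ => 1) (by simp)
  simpa [expect_const] using this

end PrivateLearning

namespace PrivateLearning

open scoped ENNReal

/-! ### Inner products modulo 2 -/

@[simp] theorem parityBit_nil_left (x : List Bool) : parityBit [] x = false := rfl

@[simp] theorem parityBit_nil_right (r : List Bool) : parityBit r [] = false := by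
  cases r <;> rfl

@[simp] theorem parityBit_cons (a b : Bool) (r x : List Bool) :
    parityBit (a :: r) (b :: x) = xor (a && b) (parityBit r x) := rfl

theorem parityBit_comm (r x : List Bool) : parityBit r x = parityBit x r := by
  induction r generalizing x with
  | nil => simp
  | cons a r ih => cases x <;> simp [ih, Bool.and_comm]

/-- The sum of two bit vectors. -/
def bitAdd (a b : List Bool) : List Bool := List.zipWith xor a b

@[simp] theorem bitAdd_cons (a b : Bool) (r x : List Bool) :
    bitAdd (a :: r) (b :: x) = xor a b :: bitAdd r x := rfl

theorem length_bitAdd (a b : List Bool) : (bitAdd a b).length = min a.length b.length := by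
  simp [bitAdd]

theorem parityBit_bitAdd (x : List Bool) {a b : List Bool} (h : a.length = b.length) :
    parityBit x (bitAdd a b) = xor (parityBit x a) (parityBit x b) := by
  induction a generalizing b x with
  | nil => simp [bitAdd, List.length_eq_zero_iff.1 h.symm]
  | cons u a ih =>
    cases b with
    | nil => simp at h
    | cons v b =>
      cases x with
      | nil => simp
      | cons w x =>
        rw [bitAdd_cons, parityBit_cons, parityBit_cons, parityBit_cons, ih x (by simpa using h)]
        cases w <;> cases u <;> cases v <;> simp

theorem bitAdd_bitAdd_cancel {a b : List Bool} (h : a.length = b.length) :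
    bitAdd a (bitAdd a b) = b := by
  induction a generalizing b with
  | nil => simp [bitAdd, List.length_eq_zero_iff.1 h.symm]
  | cons u a ih =>
    cases b with
    | nil => simp at h
    | cons v b =>
      rw [bitAdd_cons, bitAdd_cons, ih (by simpa using h)]
      simp

theorem parityBit_replicate_false (n : ℕ) (x : List Bool) :
    parityBit (List.replicate n false) x = false := by
  induction n generalizing x with
  | zero => simp
  | succ n ih => cases x <;> simp [List.replicate_succ, ih]

theorem exists_parityBit_ne {x y : List Bool} (h : x.length = y.length) (hne : x ≠ y) :
    ∃ r : List Bool, r.length = x.length ∧ parityBit r x ≠ parityBit r y := by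
  induction x generalizing y with
  | nil => exact absurd (List.length_eq_zero_iff.1 h.symm).symm hne
  | cons u x ih =>
    cases y with
    | nil => simp at h
    | cons v y =>
      by_cases huv : u = v
      · subst huv
        obtain ⟨r, hr, hr'⟩ := ih (by simpa using h) fun h' => hne (by rw [h'])
        exact ⟨false :: r, by simp [hr], by simpa using hr'⟩
      · exact ⟨true :: List.replicate x.length false, by simp,
          by simpa [parityBit_replicate_false] using huv⟩

instance instFintypeDomain (d : ℕ) : Fintype (PARITY.domain d) :=
  inferInstanceAs (Fintype (List.Vector Bool d))

theorem card_domain (d : ℕ) : Fintype.card (PARITY.domain d) = 2 ^ d :=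
  (card_vector d).trans (by simp)

instance instNonemptyDomain (d : ℕ) : Nonempty (PARITY.domain d) :=
  ⟨⟨List.replicate d false, List.length_replicate⟩⟩

theorem length_of_domain {d : ℕ} (x : PARITY.domain d) : x.1.length = d := x.2

/-- The concept `c_r` of `PARITY`. -/
def parityFun {d : ℕ} (r : List Bool) (x : PARITY.domain d) : Bool := parityBit r x.1

theorem mem_concepts_iff {d : ℕ} {c : PARITY.domain d → Bool} :
    c ∈ PARITY.concepts d ↔ ∃ r : PARITY.domain d, c = parityFun r.1 := by
  constructor
  · rintro ⟨s, hs⟩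
    simp only [PARITY] at hs
    split_ifs at hs with h
    exact ⟨⟨s, h⟩, (Option.some.inj hs).symm⟩
  · rintro ⟨r, rfl⟩
    exact ⟨r.1, if_pos r.2⟩

/-! ### Characters -/

/-- The character `(-1)^{r ⊙ x}`. -/
noncomputable def chi (r x : List Bool) : ℝ := if parityBit r x then -1 else 1

theorem chi_comm (r x : List Bool) : chi r x = chi x r := by rw [chi, chi, parityBit_comm]

theorem chi_mul_self (r x : List Bool) : chi r x * chi r x = 1 := by
  unfold chi; split_ifs <;> norm_num

theorem chi_bitAdd (x : List Bool) {a b : List Bool} (h : a.length = b.length) :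
    chi x (bitAdd a b) = chi x a * chi x b := by
  unfold chi
  rw [parityBit_bitAdd x h]
  cases parityBit x a <;> cases parityBit x b <;> norm_num

/-- Translation by `a`. -/
def translate {d : ℕ} (a : PARITY.domain d) : PARITY.domain d ≃ PARITY.domain d :=
  Function.Involutive.toPerm (fun x => ⟨bitAdd a.1 x.1, by
    have h := length_bitAdd a.1 x.1
    rw [length_of_domain, length_of_domain, min_self] at h
    exact h⟩) fun x => Subtype.ext <| bitAdd_bitAdd_cancel <| by
      rw [length_of_domain, length_of_domain]

theorem translate_val {d : ℕ} (a x : PARITY.domain d) : (translate a x).1 = bitAdd a.1 x.1 := rfl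

/-- Translating `r` by a vector whose parity separates `x` and `y` changes the sign of every
summand, so the sum is its own negative. -/
theorem sum_chi_mul_chi {d : ℕ} {x y : PARITY.domain d} (h : x ≠ y) :
    ∑ r : PARITY.domain d, chi r.1 x.1 * chi r.1 y.1 = 0 := by
  obtain ⟨s, hs, hs'⟩ := exists_parityBit_ne (x := x.1) (y := y.1)
    ((length_of_domain x).trans (length_of_domain y).symm) fun h' => h (Subtype.ext h')
  have hs'' : chi s x.1 * chi s y.1 = -1 := by
    unfold chi
    revert hs'
    cases parityBit s x.1 <;> cases parityBit s y.1 <;> simp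
  let t : PARITY.domain d := ⟨s, hs.trans (length_of_domain x)⟩
  have h₁ := Equiv.sum_comp (translate t) fun r => chi r.1 x.1 * chi r.1 y.1
  have h₂ : ∀ r : PARITY.domain d, chi (translate t r).1 x.1 * chi (translate t r).1 y.1 =
      -(chi r.1 x.1 * chi r.1 y.1) := by
    intro r
    have hl : t.1.length = r.1.length := by rw [length_of_domain, length_of_domain]
    rw [translate_val, chi_comm _ x.1, chi_comm _ y.1, chi_bitAdd _ hl, chi_bitAdd _ hl,
      chi_comm x.1, chi_comm y.1, chi_comm x.1, chi_comm y.1]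
    change chi s _ * _ * (chi s _ * _) = _
    linear_combination (chi r.1 x.1 * chi r.1 y.1) * hs''
  simp only [h₂, Finset.sum_neg_distrib] at h₁
  linarith

/-- Parseval's identity: expand the square and use orthogonality of the characters. -/
theorem sum_sq_chi {d : ℕ} (Δ : PARITY.domain d → ℝ) :
    ∑ r : PARITY.domain d, (∑ x : PARITY.domain d, chi r.1 x.1 * Δ x) ^ 2 =
      2 ^ d * ∑ x, Δ x ^ 2 := by
  classical
  have h₁ : ∀ r : PARITY.domain d, (∑ x : PARITY.domain d, chi r.1 x.1 * Δ x) ^ 2 =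
      ∑ x : PARITY.domain d, ∑ y : PARITY.domain d,
        (chi r.1 x.1 * chi r.1 y.1) * (Δ x * Δ y) := by
    intro r
    rw [sq, Finset.sum_mul_sum]
    exact Finset.sum_congr rfl fun x _ => Finset.sum_congr rfl fun y _ => by ring
  simp only [h₁]
  rw [Finset.sum_comm, Finset.mul_sum]
  refine Finset.sum_congr rfl fun x _ => ?_
  rw [Finset.sum_comm, Finset.sum_eq_single x]
  · simp only [chi_mul_self, one_mul, Finset.sum_const, Finset.card_univ, card_domain, sq]
    simp
  · intro y _ hy
    rw [← Finset.sum_mul, sum_chi_mul_chi hy.symm, zero_mul]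
  · simp

/-- Cauchy-Schwarz and Parseval. The dimension is taken even so that the square root of `2^d` is
`2^j`. -/
theorem sum_abs_chi_le {j : ℕ} (Δ : PARITY.domain (2 * j) → ℝ) {M : ℝ} (hM : ∀ x, |Δ x| ≤ M) :
    ∑ r : PARITY.domain (2 * j), |∑ x : PARITY.domain (2 * j), chi r.1 x.1 * Δ x| ≤
      2 ^ (2 * j) * (2 ^ j * M) := by
  have hM0 : 0 ≤ M := (abs_nonneg _).trans (hM (Classical.arbitrary _))
  refine le_of_sq_le_sq ?_ (by positivity)
  refine (sq_sum_le_card_mul_sum_sq (s := Finset.univ)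
    (f := fun r : PARITY.domain (2 * j) => |∑ x : PARITY.domain (2 * j), chi r.1 x.1 * Δ x|)).trans ?_
  simp only [sq_abs]
  rw [sum_sq_chi, Finset.card_univ, card_domain]
  have : ∑ x : PARITY.domain (2 * j), Δ x ^ 2 ≤ 2 ^ (2 * j) * M ^ 2 := by
    refine (Finset.sum_le_card_nsmul _ _ (M ^ 2) fun x _ => ?_).trans (le_of_eq ?_)
    · rw [← sq_abs]
      exact pow_le_pow_left₀ (abs_nonneg _) (hM x) 2
    · rw [Finset.card_univ, card_domain]; simp
  push_cast
  calc (2 : ℝ) ^ (2 * j) * (2 ^ (2 * j) * ∑ x : PARITY.domain (2 * j), Δ x ^ 2)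
      ≤ 2 ^ (2 * j) * (2 ^ (2 * j) * (2 ^ (2 * j) * M ^ 2)) := by gcongr
    _ = _ := by ring

/-! ### Parities are hard for local algorithms -/

theorem expect_fintype {D : Type} [Fintype D] (μ : PMF D) (g : D → ℝ≥0∞) :
    expect μ g = ∑ u, μ u * g u := tsum_fintype _

theorem expect_uniform {D : Type} [Fintype D] [Nonempty D] (f : D → ℝ) (hf : ∀ u, 0 ≤ f u) :
    expect (PMF.uniformOfFintype D) (fun u => ENNReal.ofReal (f u)) =
      ENNReal.ofReal ((∑ u, f u) / Fintype.card D) := by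
  rw [expect_fintype, ENNReal.ofReal_div_of_pos (by exact_mod_cast Fintype.card_pos),
    ENNReal.ofReal_sum_of_nonneg fun u _ => hf u]
  simp only [PMF.uniformOfFintype_apply, ← Finset.mul_sum]
  rw [ENNReal.ofReal_natCast, mul_comm, ENNReal.div_eq_inv_mul, mul_comm]

/-- The distribution of labeled examples for the target `c_r` and the uniform distribution. -/
noncomputable def parityExamples (d : ℕ) (r : PARITY.domain d) : PMF (PARITY.Example d) :=
  (PMF.uniformOfFintype (PARITY.domain d)).map fun x => (x, parityFun r.1 x)

/-- Let `Δ x` be half the difference of `g` at the two labels of `x`. The mean of `g` under the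
target `c_r` is its mean `M` under random labels minus the normalized Fourier coefficient of `Δ` at
`r`. The ratio condition makes `g` at most `3 * M` everywhere, hence `|Δ| ≤ 2 * M`, and the bound on
sums of Fourier coefficients applies. -/
theorem sum_expect_sub_le (j : ℕ) (g : PARITY.Example (2 * j) → ℝ≥0∞)
    (hg : ∀ u u', g u ≤ ENNReal.ofReal (Real.exp 1) * g u') :
    ∑ r, (expect (PMF.uniformOfFintype (PARITY.Example (2 * j))) g -
      expect (parityExamples (2 * j) r) g) ≤
        2 ^ (j + 1) * expect (PMF.uniformOfFintype (PARITY.Example (2 * j))) g := by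
  -- An infinite value makes the right-hand side infinite; otherwise the computation can be done in
  -- the reals.
  by_cases hfin : ∀ u, g u ≠ ⊤
  swap
  · push Not at hfin
    obtain ⟨u, hu⟩ := hfin
    have : expect (PMF.uniformOfFintype (PARITY.Example (2 * j))) g = ⊤ := by
      rw [expect, ENNReal.tsum_eq_top_of_eq_top ⟨u, ?_⟩]
      rw [hu, PMF.uniformOfFintype_apply]
      exact ENNReal.mul_top (ENNReal.inv_ne_zero.2 (ENNReal.natCast_ne_top _))
    rw [this, ENNReal.mul_top (by positivity)]
    exact le_top
  obtain ⟨f, hf, rfl⟩ : ∃ f : PARITY.Example (2 * j) → ℝ, (∀ u, 0 ≤ f u) ∧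
      g = fun u => ENNReal.ofReal (f u) :=
    ⟨fun u => (g u).toReal, fun u => ENNReal.toReal_nonneg,
      funext fun u => (ENNReal.ofReal_toReal (hfin u)).symm⟩
  have hf3 : ∀ u u', f u ≤ 3 * f u' := by
    intro u u'
    have := hg u u'
    rw [← ENNReal.ofReal_mul (Real.exp_nonneg _), ENNReal.ofReal_le_ofReal_iff
      (mul_nonneg (Real.exp_nonneg _) (hf u'))] at this
    exact this.trans (mul_le_mul_of_nonneg_right Real.exp_one_lt_three.le (hf u'))
  set N : ℝ := 2 ^ (2 * j) with hN
  have hNpos : 0 < N := by positivity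
  set M : ℝ := (∑ u, f u) / (2 * N) with hM
  have hcard : (Fintype.card (PARITY.Example (2 * j)) : ℝ) = 2 * N := by
    rw [Fintype.card_prod, card_domain]
    simp [hN, mul_comm]
  have hfM : ∀ u, f u ≤ 3 * M := by
    intro u
    rw [hM, mul_div_assoc', le_div_iff₀ (by positivity), Finset.mul_sum, ← hcard, mul_comm,
      ← nsmul_eq_mul, ← Finset.card_univ]
    exact Finset.card_nsmul_le_sum _ _ _ fun u' _ => hf3 u u'
  have hM0 : 0 ≤ M := div_nonneg (Finset.sum_nonneg fun u _ => hf u) (by positivity)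
  let Δ : PARITY.domain (2 * j) → ℝ := fun x => (f (x, true) - f (x, false)) / 2
  have hΔ : ∀ x, |Δ x| ≤ 2 * M := by
    intro x
    have h₁ := hf (x, true)
    have h₂ := hf (x, false)
    have h₃ := hfM (x, true)
    have h₄ := hfM (x, false)
    simp only [Δ]
    rw [abs_le]
    constructor <;> linarith
  have h₀ : expect (PMF.uniformOfFintype (PARITY.Example (2 * j)))
      (fun u => ENNReal.ofReal (f u)) = ENNReal.ofReal M := by
    rw [expect_uniform f hf, hcard]
  have hr : ∀ r : PARITY.domain (2 * j), expect (parityExamples (2 * j) r)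
      (fun u => ENNReal.ofReal (f u)) =
        ENNReal.ofReal (M - (∑ x : PARITY.domain (2 * j), chi r.1 x.1 * Δ x) / N) := by
    intro r
    rw [parityExamples, expect_map, expect_uniform _ fun x => hf _, card_domain]
    congr 1
    have : ∑ u, f u = ∑ x, (f (x, true) + f (x, false)) := by
      rw [Fintype.sum_prod_type]
      simp
    rw [hM, this]
    push_cast
    rw [← hN]
    field_simp
    rw [Finset.sum_mul, Finset.mul_sum, ← Finset.sum_sub_distrib]
    refine Finset.sum_congr rfl fun x _ => ?_
    simp only [chi, Δ, parityFun]
    cases parityBit r.1 x.1 <;> simp <;> ring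
  rw [h₀]
  simp only [hr]
  have hsub : ∀ r : PARITY.domain (2 * j), ENNReal.ofReal M -
      ENNReal.ofReal (M - (∑ x : PARITY.domain (2 * j), chi r.1 x.1 * Δ x) / N) ≤
        ENNReal.ofReal (|∑ x : PARITY.domain (2 * j), chi r.1 x.1 * Δ x| / N) := by
    intro r
    rw [tsub_le_iff_right]
    refine (ENNReal.ofReal_le_ofReal ?_).trans ENNReal.ofReal_add_le
    have := div_le_div_of_nonneg_right
      (le_abs_self (∑ x : PARITY.domain (2 * j), chi r.1 x.1 * Δ x)) hNpos.le
    linarith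
  calc _ ≤ ∑ r : PARITY.domain (2 * j),
        ENNReal.ofReal (|∑ x : PARITY.domain (2 * j), chi r.1 x.1 * Δ x| / N) :=
        Finset.sum_le_sum fun r _ => hsub r
    _ = ENNReal.ofReal ((∑ r : PARITY.domain (2 * j),
        |∑ x : PARITY.domain (2 * j), chi r.1 x.1 * Δ x|) / N) := by
        rw [Finset.sum_div, ENNReal.ofReal_sum_of_nonneg]
        intro r _
        positivity
    _ ≤ ENNReal.ofReal (2 ^ (j + 1) * M) := by
        refine ENNReal.ofReal_le_ofReal ?_
        rw [div_le_iff₀ hNpos]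
        refine (sum_abs_chi_le Δ hΔ).trans (le_of_eq ?_)
        rw [← hN]
        ring
    _ = _ := by
        rw [ENNReal.ofReal_mul (by positivity), ENNReal.ofReal_pow (by norm_num)]
        simp

/-- This is orthogonality of the two characters: the product of their values is `1` on agreement and
`-1` on disagreement, and it sums to zero. -/
theorem parityFun_disagreement {d : ℕ} {r s : PARITY.domain d} (h : r ≠ s) :
    (PMF.uniformOfFintype (PARITY.domain d)).toOuterMeasure
      {x | parityFun r.1 x ≠ parityFun s.1 x} = 1 / 2 := by
  classical
  have h₁ := sum_chi_mul_chi h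
  have h₂ : ∀ x : PARITY.domain d, chi x.1 r.1 * chi x.1 s.1 =
      1 - 2 * if parityFun r.1 x ≠ parityFun s.1 x then 1 else 0 := by
    intro x
    rw [chi_comm, chi_comm x.1]
    simp only [chi, parityFun]
    by_cases hr : parityBit r.1 x.1 = true <;> by_cases hs : parityBit s.1 x.1 = true <;>
      norm_num [hr, hs]
  simp only [h₂] at h₁
  rw [Finset.sum_sub_distrib, ← Finset.mul_sum, Finset.sum_boole, Finset.sum_const,
    Finset.card_univ, card_domain, sub_eq_zero] at h₁
  rw [PMF.toOuterMeasure_uniformOfFintype_apply, card_domain]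
  have h₃ : (2 : ℕ) ^ d = 2 * Fintype.card {x : PARITY.domain d |
      parityFun r.1 x ≠ parityFun s.1 x} := by
    rw [Fintype.card_subtype]
    have : ((2 ^ d : ℕ) : ℝ) = ((2 * (Finset.univ.filter fun x : PARITY.domain d =>
        parityFun r.1 x ≠ parityFun s.1 x).card : ℕ) : ℝ) := by
      push_cast
      simpa using h₁
    exact_mod_cast this
  have h₄ : Fintype.card {x : PARITY.domain d | parityFun r.1 x ≠ parityFun s.1 x} ≠ 0 := by
    intro h0
    rw [h0, mul_zero] at h₃
    exact absurd h₃ (by positivity)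
  rw [h₃]
  push_cast
  rw [ENNReal.div_eq_div_iff (by norm_num) (by norm_num)
    (mul_ne_zero (by norm_num) (by exact_mod_cast h₄))
    (ENNReal.mul_ne_top (by norm_num) (ENNReal.natCast_ne_top _))]
  ring

/-- A hypothesis is accurate for at most one parity. -/
theorem card_bad_le {d : ℕ} (h : PARITY.domain d → Bool) :
    2 ^ d - 1 ≤ {r : PARITY.domain d | ¬ err (PMF.uniformOfFintype (PARITY.domain d))
      (parityFun r.1) h ≤ ENNReal.ofReal (1 / 8)}.ncard := by
  classical
  have hgood : {r : PARITY.domain d | err (PMF.uniformOfFintype (PARITY.domain d))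
      (parityFun r.1) h ≤ ENNReal.ofReal (1 / 8)}.ncard ≤ 1 := by
    rw [Set.ncard_le_one]
    intro r hr s hs
    by_contra hne
    have h₁ := parityFun_disagreement hne
    -- Where two parities disagree, `h` errs for one of them. Two errors of at most 1/8 cannot cover
    -- half of the domain.
    have h₂ : (PMF.uniformOfFintype (PARITY.domain d)).toOuterMeasure
        {x | parityFun r.1 x ≠ parityFun s.1 x} ≤ ENNReal.ofReal (1 / 8) +
          ENNReal.ofReal (1 / 8) := by
      refine le_trans ?_ (add_le_add hr hs)
      refine le_trans (MeasureTheory.measure_mono ?_) (MeasureTheory.measure_union_le _ _)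
      intro x hx
      by_contra hx'
      simp only [Set.mem_union, Set.mem_ofPred_eq, not_or, not_not] at hx'
      exact hx (hx'.1.symm.trans hx'.2)
    rw [h₁, ← ENNReal.ofReal_add (by norm_num) (by norm_num),
      show (1 / 2 : ℝ≥0∞) = ENNReal.ofReal (1 / 2) by
        rw [ENNReal.ofReal_div_of_pos (by norm_num)]; simp,
      ENNReal.ofReal_le_ofReal_iff (by norm_num)] at h₂
    norm_num at h₂
  have h₃ := Set.ncard_add_ncard_compl {r : PARITY.domain d |
    err (PMF.uniformOfFintype (PARITY.domain d)) (parityFun r.1) h ≤ ENNReal.ofReal (1 / 8)}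
  rw [Nat.card_eq_fintype_card, card_domain] at h₃
  change _ + {r : PARITY.domain d | ¬ err (PMF.uniformOfFintype (PARITY.domain d))
    (parityFun r.1) h ≤ ENNReal.ofReal (1 / 8)}.ncard = _ at h₃
  omega

/-- The lower bound reads `q^2 - 1 ≤ q^2 / 4 + 2 * n * q` with `q = 2^j`, which is impossible for `q
≥ 4 * n + 4`. Through `hyp` the output may be a hypothesis or a string that represents one, so both
notions of local learning are covered. -/
theorem parity_local_sample_bound {j n : ℕ} {O : Type}
    {P : LocalProtocol (PARITY.Example (2 * j)) n O} (hP : P.IsLocal 1)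
    (hyp : O → PARITY.domain (2 * j) → Bool)
    (h : ∀ c ∈ PARITY.concepts (2 * j), ∀ μ : PMF (PARITY.domain (2 * j)),
      PACSucceeds (fun z => (P.run z).map hyp) c μ (1 / 8) (1 / 4)) :
    2 ^ j < 4 * n + 4 := by
  have h₁ := LocalProtocol.lower_bound zero_le_one (sum_expect_sub_le j)
    (bad := fun r => {o | ¬ err (PMF.uniformOfFintype (PARITY.domain (2 * j)))
      (parityFun r.1) (hyp o) ≤ ENNReal.ofReal (1 / 8)}) (fun o => card_bad_le (hyp o)) P hP
  have h₂ : ∀ r : PARITY.domain (2 * j), expect (iid (parityExamples (2 * j) r) n)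
      (fun z => (P.run z).toOuterMeasure {o | ¬ err (PMF.uniformOfFintype (PARITY.domain (2 * j)))
        (parityFun r.1) (hyp o) ≤ ENNReal.ofReal (1 / 8)}) ≤ ENNReal.ofReal (1 / 4) := by
    intro r
    have := pacSucceeds_iff.1
      (h _ (mem_concepts_iff.2 ⟨r, rfl⟩) (PMF.uniformOfFintype (PARITY.domain (2 * j))))
    simp only [PMF.toOuterMeasure_map_apply] at this
    exact this
  have h₃ := h₁.trans (add_le_add_left (Finset.sum_le_sum fun r _ => h₂ r) _)
  rw [Finset.sum_const, Finset.card_univ, card_domain, nsmul_eq_mul,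
    ← ENNReal.ofReal_natCast (2 ^ (2 * j)), ← ENNReal.ofReal_mul (by positivity),
    show (n : ℝ≥0∞) * 2 ^ (j + 1) = ENNReal.ofReal (n * 2 ^ (j + 1)) by
      rw [ENNReal.ofReal_mul (by positivity), ENNReal.ofReal_pow (by norm_num)]; simp,
    ← ENNReal.ofReal_natCast, ← ENNReal.ofReal_add (by positivity) (by positivity),
    ENNReal.ofReal_le_ofReal_iff (by positivity), Nat.cast_sub Nat.one_le_two_pow] at h₃
  push_cast at h₃
  by_contra hcon
  push Not at hcon
  have h₄ : (4 * n + 4 : ℝ) ≤ 2 ^ j := by exact_mod_cast hcon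
  rw [show (2 : ℝ) ^ (2 * j) = 2 ^ j * 2 ^ j by rw [two_mul, pow_add], pow_succ] at h₃
  have h₅ : (0 : ℝ) ≤ n := Nat.cast_nonneg n
  generalize (2 : ℝ) ^ j = q at *
  nlinarith

theorem exists_bound_lt_two_pow (p : MvPolynomial (Fin 4) ℕ) (a b c : ℕ) :
    ∃ j, 4 * bound p (2 * j, a, b, c) + 4 ≤ 2 ^ j := by
  have h₁ : ∃ P : Polynomial ℕ, ∀ j, bound p (2 * j, a, b, c) = P.eval j := by
    refine ⟨MvPolynomial.eval₂ Polynomial.C ![2 * Polynomial.X, Polynomial.C a, Polynomial.C b,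
      Polynomial.C c] p, fun j => ?_⟩
    induction p using MvPolynomial.induction_on with
    | C n => simp [bound]
    | add p q hp hq => simp_all [bound]
    | mul_X p i hp =>
      simp only [bound, map_mul, MvPolynomial.eval_X, MvPolynomial.eval₂_mul,
        MvPolynomial.eval₂_X, Polynomial.eval_mul] at hp ⊢
      rw [hp]
      congr 1
      fin_cases i <;> simp
  obtain ⟨P, hP⟩ := h₁
  have h₂ : (fun j : ℕ => ((P.eval j : ℕ) : ℝ)) =o[Filter.atTop] fun j : ℕ => (2 : ℝ) ^ j := by
    clear hP
    induction P using Polynomial.induction_on' with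
    | add P Q hP hQ => simpa using hP.add hQ
    | monomial k m =>
      simpa using (isLittleO_pow_const_const_pow_of_one_lt k
        (one_lt_two : (1 : ℝ) < 2)).const_mul_left (m : ℝ)
  -- Half of `2^j` absorbs the polynomial term, and from `j ≥ 3` on the other half absorbs the
  -- summand 4.
  have h₃ := h₂.bound (show (0 : ℝ) < 1 / 8 by norm_num)
  obtain ⟨j, hj, hj3⟩ := (h₃.and (Filter.eventually_ge_atTop 3)).exists
  refine ⟨j, ?_⟩
  rw [hP]
  simp only [Real.norm_natCast, norm_pow, Real.norm_ofNat] at hj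
  have h₄ : 8 ≤ 2 ^ j := (by norm_num : 8 = 2 ^ 3).le.trans (Nat.pow_le_pow_right (by norm_num) hj3)
  have h₅ : (8 * (P.eval j : ℕ) : ℝ) ≤ 2 ^ j := by linarith
  have h₆ : 8 * P.eval j ≤ 2 ^ j := by exact_mod_cast h₅
  omega

theorem not_locallyLearnable_parity : ¬ LocallyLearnable PARITY := by
  rintro ⟨p, q, A, hA⟩
  obtain ⟨j, hj⟩ := exists_bound_lt_two_pow p ⌈1 / (1 : ℝ)⌉₊ ⌈1 / (1 / 8 : ℝ)⌉₊
    ⌈Real.logb 2 (1 / (1 / 4 : ℝ))⌉₊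
  obtain ⟨h₁, h₂⟩ := hA (2 * j) 1 one_pos (1 / 8) (by norm_num) (1 / 4) (by norm_num)
  refine (parity_local_sample_bound h₁ id fun c hc μ => ?_).not_ge hj
  simpa [PMF.map_id] using (h₂ c hc).2 μ

theorem not_efficientlyLocallyLearnable_parity : ¬ EfficientlyLocallyLearnable PARITY := by
  rintro ⟨p, r, s, l, T, L, Q, E, -, -, -, hA⟩
  obtain ⟨j, hj⟩ := exists_bound_lt_two_pow p ⌈1 / (1 : ℝ)⌉₊ ⌈1 / (1 / 8 : ℝ)⌉₊
    ⌈Real.logb 2 (1 / (1 / 4 : ℝ))⌉₊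
  obtain ⟨h₁, h₂⟩ := hA (2 * j) 1 one_pos (1 / 8) (by norm_num) (1 / 4) (by norm_num)
  exact (parity_local_sample_bound h₁ _ h₂).not_ge hj

end PrivateLearning

namespace PrivateLearning

/-! ### The private parity learner

The learner splits the database into chunks. On each chunk, with probability `1/2` it does nothing;
otherwise it keeps each example with a small probability, and finds a random solution of the linear
equations given by the examples that are kept. -/

/-- One step of the search for a power of two. -/
def powerStep (n : ℕ) (s : ℕ × ℕ) : ℕ × ℕ := if s.1 ≤ n then (s.1 + s.1, s.2 + 1) else s

/-- The exponent of a power of two between `n` and `2 n`. -/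
def powerExponent (n : ℕ) : ℕ := ((powerStep n)^[n] (1, 0)).2

/-- Are the first `a` coins all `false`? -/
def allFalse (a : ℕ) (ω : List Bool) : Bool := ((ω.take a).filter fun b => b).isEmpty

/-- The examples that are kept, when each example is kept with probability `2⁻ᵃ` and has `M` coins
at its disposal. -/
def keptExamples {D : Type} (a M : ℕ) : List D → List Bool → List D
  | [], _ => []
  | u :: us, ω =>
    if allFalse a ω then u :: keptExamples a M us (ω.drop M) else keptExamples a M us (ω.drop M)

/-- The `i`-th unit vector. -/
def unitVector (d i : ℕ) : List Bool := (List.replicate i false ++ true :: List.replicate d false).take d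

/-- All unit vectors. -/
def unitVectors (d : ℕ) : List (List Bool) := ((List.range d).map (unitVector d)).reverse

/-- Adding a linear equation `x ⊙ r = y` to a system. The state consists of a flag for the
solvability of the system, vectors that span the space of solutions of the homogeneous system, and a
solution. -/
def eliminate (st : Bool × List (List Bool) × List Bool) (u : List Bool × Bool) :
    Bool × List (List Bool) × List Bool :=
  match st.2.1.filter fun b => parityBit u.1 b with
  | [] => (st.1 && (parityBit u.1 st.2.2 == u.2), st.2.1, st.2.2)
  | b :: _ => (st.1, st.2.1.map fun c => if parityBit u.1 c then bitAdd c b else c,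
      if parityBit u.1 st.2.2 == u.2 then st.2.2 else bitAdd st.2.2 b)

/-- The random solution, which starts from the random vector `v`, of a system of equations. -/
def solve (d : ℕ) (v : List Bool) (us : List (List Bool × Bool)) :
    Bool × List (List Bool) × List Bool :=
  us.foldl eliminate (true, unitVectors d, v)

/-- The result for one chunk of `m` examples: a flag for success, and the solution. -/
def chunkResult (d a M m : ℕ) (db : List (List Bool × Bool)) (ω : List Bool) : Bool × List Bool :=
  -- The first coin decides about giving up (`true`, which is also the default), the next `d` coins
  -- are the starting vector, and the rest serve to select examples.
  ((!ω.headD true) && (solve d ((ω.drop 1).take d)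
    (keptExamples a M (db.take m) (ω.drop (1 + d)))).1,
    (solve d ((ω.drop 1).take d) (keptExamples a M (db.take m) (ω.drop (1 + d)))).2.2)

/-- Moving on to the next chunk, after a failure. -/
def nextChunk (d a M m c : ℕ) (st : List (List Bool × Bool) × List Bool) :
    List (List Bool × Bool) × List Bool :=
  if (chunkResult d a M m st.1 st.2).1 then st else (st.1.drop m, st.2.drop c)

/-- The result of the first chunk, among `K + 1`, that is successful. -/
def firstResult (d a M m c K : ℕ) (db : List (List Bool × Bool)) (ω : List Bool) : List Bool :=
  let st := (nextChunk d a M m c)^[K] (db, ω)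
  if (chunkResult d a M m st.1 st.2).1 then (chunkResult d a M m st.1 st.2).2 else []

/-- The number of examples in a chunk. -/
noncomputable def chunkExamples : MvPolynomial (Fin 4) ℕ :=
  (MvPolynomial.X 0 + MvPolynomial.X 3 + 2) * MvPolynomial.X 2 * (8 * MvPolynomial.X 1)

/-- The number of coins for a chunk. -/
noncomputable def chunkCoins : MvPolynomial (Fin 4) ℕ :=
  1 + MvPolynomial.X 0 + chunkExamples * (8 * MvPolynomial.X 1)

/-- The private parity learner. -/
noncomputable def parityLearner (x : Params × List (List Bool × Bool) × List Bool) : List Bool :=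
  firstResult x.1.1 (powerExponent (4 * x.1.2.1)) (8 * x.1.2.1) (bound chunkExamples x.1)
    (bound chunkCoins x.1) x.1.2.2.2 x.2.1 x.2.2

/-! ### The learner runs in polynomial time -/

namespace PolyTime

variable {S : Type} [Encoded S]

/-- The fold runs over `r` and consumes `x` in the accumulator. Reading `false` past the end of `x`
agrees with the truncation in `zipWith`. -/
theorem foldl_parityBit (r x : List Bool) (b : Bool) :
    (r.foldl (fun (s : List Bool × Bool) a => (s.1.tail, xor s.2 (a && s.1.headD false)))
      (x, b)).2 = xor b (parityBit r x) := by
  induction r generalizing x b with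
  | nil => simp
  | cons a r ih =>
    rw [List.foldl_cons, ih]
    cases x <;> simp

theorem parityBit {f g : S → List Bool} (hf : PolyTime f) (hg : PolyTime g) :
    PolyTime fun a => parityBit (f a) (g a) := by
  have h : PolyTime fun a => (f a).foldl (fun (s : List Bool × Bool) a =>
      (s.1.tail, xor s.2 (a && s.1.headD false))) (g a, false) := by
    refine foldl_of_growth (T := List Bool × Bool)
      (step := fun x => (x.2.1.1.tail, xor x.2.1.2 (x.2.2 && x.2.1.1.headD false))) hf
      (hg.pair (const false)) (id.snd.fst.fst.tail.pair (bool₂ _ id.snd.fst.snd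
        (bool₂ and id.snd.snd (headD id.snd.fst.fst false)))) (.const 3) fun a b u _ => ?_
    have h₁ := encSize_le_of_sublist (List.tail_sublist b.1)
    have h₂ := encSize_bool_le (xor b.2 (u && b.1.headD false))
    simp only [encSize_prod]
    omega
  exact h.snd.congr fun a => by rw [foldl_parityBit, Bool.false_xor]

theorem foldl_bitAdd (a b l : List Bool) :
    (a.foldl (fun (s : List Bool × List Bool) u =>
      if s.1.isEmpty then s else (s.1.tail, xor u (s.1.headD false) :: s.2)) (b, l)).2 =
      (bitAdd a b).reverse ++ l := by
  induction a generalizing b l with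
  | nil => simp [bitAdd]
  | cons u a ih =>
    rw [List.foldl_cons]
    cases b with
    | nil => simpa [bitAdd] using ih [] l
    | cons v b => simpa using ih b (xor u v :: l)

theorem bitAdd {f g : S → List Bool} (hf : PolyTime f) (hg : PolyTime g) :
    PolyTime fun a => bitAdd (f a) (g a) := by
  have h : PolyTime fun a => (f a).foldl (fun (s : List Bool × List Bool) u =>
      if s.1.isEmpty then s else (s.1.tail, xor u (s.1.headD false) :: s.2)) (g a, []) := by
    refine foldl_of_growth (T := List Bool × List Bool)
      (step := fun x => if x.2.1.1.isEmpty then x.2.1 else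
        (x.2.1.1.tail, xor x.2.2 (x.2.1.1.headD false) :: x.2.1.2)) hf
      (hg.pair (const [])) (id.snd.fst.fst.isEmpty.cond id.snd.fst (id.snd.fst.fst.tail.pair
        ((bool₂ _ id.snd.snd (headD id.snd.fst.fst false)).cons id.snd.fst.snd)))
      (.const 4) fun a b u _ => ?_
    have h₁ := encSize_le_of_sublist (List.tail_sublist b.1)
    have h₂ := encSize_bool_le (xor u (b.1.headD false))
    dsimp only
    split
    · omega
    · simp only [encSize_prod, encSize_cons]
      omega
  exact h.snd.reverse.congr fun a => by rw [foldl_bitAdd]; simp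

variable [Tame S]

theorem powerExponent {n : S → ℕ} (hn : PolyTime n) :
    PolyTime fun a => powerExponent (n a) := by
  -- Doubling happens only up to `n`, so the unary counter grows by at most `n` per step.
  refine (iterate_of_growth (T := ℕ × ℕ) (step := fun x => powerStep (n x.1) x.2) hn (const (1, 0))
    ?_ (B := fun a => encSize (n a) + 2) (hn.output_bounded.add (.const 2)) fun a b => ?_).snd
  · refine ((le id.snd.fst (hn.comp id.fst)).cond ((add id.snd.fst id.snd.fst).pair
      id.snd.snd.succ) id.snd).congr fun x => ?_
    simp [powerStep]
  · simp only [powerStep]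
    split
    · simp only [encSize_prod, encSize_nat]; omega
    · omega

theorem allFalse {a : S → ℕ} {ω : S → List Bool} (ha : PolyTime a) (hω : PolyTime ω) :
    PolyTime fun x => allFalse (a x) (ω x) :=
  (filter (take ha hω) (g := fun x => x.2) id.snd).isEmpty

theorem foldl_keptExamples (a M : ℕ) (us l : List (List Bool × Bool)) (ω : List Bool) :
    (us.foldl (fun (s : List Bool × List (List Bool × Bool)) u =>
      (s.1.drop M, if PrivateLearning.allFalse a s.1 then u :: s.2 else s.2)) (ω, l)).2 =
      (keptExamples a M us ω).reverse ++ l := by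
  induction us generalizing ω l with
  | nil => simp [keptExamples]
  | cons u us ih =>
    rw [List.foldl_cons, ih, keptExamples]
    split <;> simp

theorem keptExamples {a M : S → ℕ} {us : S → List (List Bool × Bool)} {ω : S → List Bool}
    (ha : PolyTime a) (hM : PolyTime M) (hus : PolyTime us) (hω : PolyTime ω) :
    PolyTime fun x => keptExamples (a x) (M x) (us x) (ω x) := by
  have h : PolyTime fun x => (us x).foldl (fun (s : List Bool × List (List Bool × Bool)) u =>
      (s.1.drop (M x), if PrivateLearning.allFalse (a x) s.1 then u :: s.2 else s.2)) (ω x, []) := by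
    refine foldl_of_growth (T := List Bool × List (List Bool × Bool))
      (step := fun y => (y.2.1.1.drop (M y.1),
        if PrivateLearning.allFalse (a y.1) y.2.1.1 then y.2.2 :: y.2.1.2 else y.2.1.2)) hus
      (hω.pair (const [])) ((drop (hM.comp id.fst) id.snd.fst.fst).pair
        ((allFalse (ha.comp id.fst) id.snd.fst.fst).cond (id.snd.snd.cons id.snd.fst.snd)
          id.snd.fst.snd))
      (B := fun x => encSize (us x) + 1) (hus.output_bounded.add (.const 1)) fun x b u hu => ?_
    have h₁ := encSize_le_of_sublist (List.drop_sublist (M x) b.1)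
    have h₂ := encSize_le_of_mem hu
    simp only [encSize_prod]
    split
    · simp only [encSize_cons, encSize_prod] at *
      omega
    · omega
  exact h.snd.reverse.congr fun a => by rw [foldl_keptExamples]; simp

theorem unitVector {d i : S → ℕ} (hd : PolyTime d) (hi : PolyTime i) :
    PolyTime fun x => unitVector (d x) (i x) :=
  take hd ((hi.replicate false).append ((const true).cons (hd.replicate false)))

theorem iterate_unitVectors (d n : ℕ) :
    (fun s : ℕ × List (List Bool) => (s.1 + 1, PrivateLearning.unitVector d s.1 :: s.2))^[n]
      (0, []) = (n, ((List.range n).map (PrivateLearning.unitVector d)).reverse) := by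
  induction n with
  | zero => rfl
  | succ n ih =>
    rw [Function.iterate_succ_apply', ih, List.range_succ]
    simp

theorem unitVectors {d : S → ℕ} (hd : PolyTime d) : PolyTime fun x => unitVectors (d x) := by
  refine (iterate_of_growth (T := ℕ × List (List Bool))
    (step := fun x => (x.2.1 + 1, PrivateLearning.unitVector (d x.1) x.2.1 :: x.2.2)) hd
    (const (0, [])) (id.snd.fst.succ.pair ((unitVector (hd.comp id.fst) id.snd.fst).cons
      id.snd.snd)) (B := fun a => 2 * encSize (d a) + 4)
      (((PolyBounded.const 2).mul hd.output_bounded).add (.const 4)) fun a b => ?_).snd.congr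
      fun a => (congrArg Prod.snd (iterate_unitVectors (d a) (d a))).symm
  have h := encSize_bits_le (PrivateLearning.unitVector (d a) b.1)
  have h' : (PrivateLearning.unitVector (d a) b.1).length ≤ d a := by
    simp [PrivateLearning.unitVector]
  simp only [encSize_prod, encSize_cons, encSize_nat]
  omega

theorem eliminate : PolyTime fun x : (Bool × List (List Bool) × List Bool) × (List Bool × Bool) =>
    eliminate x.1 x.2 := by
  unfold PrivateLearning.eliminate
  refine (listCases (U := List Bool)
    (l := fun x => x.1.2.1.filter fun b => PrivateLearning.parityBit x.2.1 b)
    (f := fun x => (x.1.1 && (PrivateLearning.parityBit x.2.1 x.1.2.2 == x.2.2), x.1.2.1, x.1.2.2))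
    (g := fun y => (y.1.1.1, y.1.1.2.1.map fun c =>
      if PrivateLearning.parityBit y.1.2.1 c then PrivateLearning.bitAdd c y.2.1 else c,
      if PrivateLearning.parityBit y.1.2.1 y.1.1.2.2 == y.1.2.2 then y.1.1.2.2 else
        PrivateLearning.bitAdd y.1.1.2.2 y.2.1)) ?_ ?_ ?_).congr fun x => by
          cases x.1.2.1.filter fun b => PrivateLearning.parityBit x.2.1 b <;> rfl
  · exact filter id.fst.snd.fst (g := fun y : ((Bool × List (List Bool) × List Bool) × (List Bool × Bool)) × List Bool =>
        PrivateLearning.parityBit y.1.2.1 y.2)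
      (parityBit id.fst.snd.fst id.snd)
  · exact (bool₂ and id.fst.fst (bool₂ (· == ·) (parityBit id.snd.fst id.fst.snd.snd)
      id.snd.snd)).pair (id.fst.snd.fst.pair id.fst.snd.snd)
  · refine id.fst.fst.fst.pair ((map id.fst.fst.snd.fst
      (g := fun z => if PrivateLearning.parityBit z.1.1.2.1 z.2 then
        PrivateLearning.bitAdd z.2 z.1.2.1 else z.2)
      ((parityBit id.fst.fst.snd.fst id.snd).cond (bitAdd id.snd id.fst.snd.fst) id.snd)).pair
      ((bool₂ (· == ·) (parityBit id.fst.snd.fst id.fst.fst.snd.snd) id.fst.snd.snd).cond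
        id.fst.fst.snd.snd (bitAdd id.fst.fst.snd.snd id.snd.fst)))

theorem encSize_list_le {T : Type} [Encoded T] {l : List T} {K : ℕ} (h : ∀ a ∈ l, encSize a ≤ K) :
    encSize l ≤ l.length * (K + 1) + 1 := by
  induction l with
  | nil => simp
  | cons a l ih =>
    have h₁ := ih fun b hb => h b (by simp [hb])
    have h₂ := h a (by simp)
    rw [encSize_cons, List.length_cons, Nat.add_one_mul]
    omega

end PolyTime

/-- All the vectors in a state of the elimination have length at most `d`. -/
def ShortState (d : ℕ) (st : Bool × List (List Bool) × List Bool) : Prop :=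
  st.2.1.length = d ∧ (∀ b ∈ st.2.1, b.length ≤ d) ∧ st.2.2.length ≤ d

/-- The pivot is not deleted from the list of directions but added to itself, so the number of
directions is constant, and `bitAdd` never lengthens a vector. Nothing is assumed about `u`, because
the running time must be bounded on ill-formed inputs too. -/
theorem ShortState.eliminate {d : ℕ} {st : Bool × List (List Bool) × List Bool}
    (h : ShortState d st) (u : List Bool × Bool) : ShortState d (eliminate st u) := by
  obtain ⟨h₁, h₂, h₃⟩ := h
  unfold PrivateLearning.eliminate
  split
  · exact ⟨h₁, h₂, h₃⟩
  · refine ⟨by simpa using h₁, ?_, ?_⟩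
    · intro b hb
      obtain ⟨c, hc, rfl⟩ := List.mem_map.1 hb
      have := h₂ c hc
      split
      · rw [length_bitAdd]; omega
      · exact this
    · dsimp only
      split
      · exact h₃
      · rw [length_bitAdd]; omega

theorem ShortState.foldl {d : ℕ} {st : Bool × List (List Bool) × List Bool}
    (h : ShortState d st) (us : List (List Bool × Bool)) :
    ShortState d (us.foldl PrivateLearning.eliminate st) := by
  induction us generalizing st with
  | nil => exact h
  | cons u us ih => exact ih (h.eliminate u)

theorem ShortState.encSize_le {d : ℕ} {st : Bool × List (List Bool) × List Bool}
    (h : ShortState d st) : encSize st ≤ d * (4 * d + 2) + 4 * d + 7 := by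
  obtain ⟨h₁, h₂, h₃⟩ := h
  have h₄ := PolyTime.encSize_list_le (l := st.2.1) (K := 4 * d + 1) fun b hb =>
    (encSize_bits_le b).trans (by have := h₂ b hb; omega)
  have h₅ := encSize_bits_le st.2.2
  have h₆ := encSize_bool_le st.1
  rw [h₁] at h₄
  change _ ≤ d * (4 * d + 2) + 1 at h₄
  simp only [encSize_prod]
  omega

theorem shortState_init {d : ℕ} {v : List Bool} (hv : v.length ≤ d) :
    ShortState d (true, unitVectors d, v) := by
  refine ⟨by simp [unitVectors], fun b hb => ?_, hv⟩
  simp only [unitVectors, List.mem_reverse, List.mem_map] at hb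
  obtain ⟨i, -, rfl⟩ := hb
  simp [unitVector]

namespace PolyTime

variable {S : Type} [Encoded S] [Tame S]

theorem solve {d : S → ℕ} {v : S → List Bool} {us : S → List (List Bool × Bool)}
    (hd : PolyTime d) (hv : PolyTime v) (hus : PolyTime us) (hvd : ∀ x, (v x).length ≤ d x) :
    PolyTime fun x => solve (d x) (v x) (us x) := by
  have hdb : PolyBounded d := hd.output_bounded.mono fun x => by rw [encSize_nat]; omega
  exact PolyTime.foldl hus ((const true).pair ((unitVectors hd).pair hv))
    (step := fun x => PrivateLearning.eliminate x.2.1 x.2.2)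
    (eliminate.comp (id.snd.fst.pair id.snd.snd))
    (B := fun x => d x * (4 * d x + 2) + 4 * d x + 7)
    (((hdb.mul (((PolyBounded.const 4).mul hdb).add (.const 2))).add
      ((PolyBounded.const 4).mul hdb)).add (.const 7))
    fun x l' _ => ((shortState_init (hvd x)).foldl l').encSize_le

theorem chunkResult {d a M m : S → ℕ} {db : S → List (List Bool × Bool)} {ω : S → List Bool}
    (hd : PolyTime d) (ha : PolyTime a) (hM : PolyTime M) (hm : PolyTime m) (hdb : PolyTime db)
    (hω : PolyTime ω) :
    PolyTime fun x => chunkResult (d x) (a x) (M x) (m x) (db x) (ω x) := by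
  have h := solve hd (take hd (drop (const 1) hω))
    (keptExamples ha hM (take hm hdb) (drop (add (const 1) hd) hω)) fun x => by simp
  exact (bool₂ (fun b c => !b && c) (headD hω true) h.fst).pair h.snd.snd

theorem parityLearner : PolyTime parityLearner := by
  have ha : PolyTime fun x : Params × List (List Bool × Bool) × List Bool =>
      PrivateLearning.powerExponent (4 * x.1.2.1) := powerExponent ((const 4).mul id.fst.snd.fst)
  have hM : PolyTime fun x : Params × List (List Bool × Bool) × List Bool => 8 * x.1.2.1 :=
    (const 8).mul id.fst.snd.fst
  have hres : PolyTime fun y : (Params × List (List Bool × Bool) × List Bool) ×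
      (List (List Bool × Bool) × List Bool) =>
      PrivateLearning.chunkResult y.1.1.1 (PrivateLearning.powerExponent (4 * y.1.1.2.1))
        (8 * y.1.1.2.1) (PrivateLearning.bound chunkExamples y.1.1) y.2.1 y.2.2 :=
    chunkResult id.fst.fst.fst (ha.comp id.fst) (hM.comp id.fst) (bound _ id.fst.fst)
      id.snd.fst id.snd.snd
  have hiter := iterate_of_growth (S := Params × List (List Bool × Bool) × List Bool)
    (T := List (List Bool × Bool) × List Bool) (n := fun x => x.1.2.2.2)
    (step := fun y => nextChunk y.1.1.1 (PrivateLearning.powerExponent (4 * y.1.1.2.1))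
      (8 * y.1.1.2.1) (PrivateLearning.bound chunkExamples y.1.1)
      (PrivateLearning.bound chunkCoins y.1.1) y.2) id.fst.snd.snd.snd id.snd
    (hres.fst.cond id.snd ((drop (bound _ id.fst.fst) id.snd.fst).pair
      (drop (bound _ id.fst.fst) id.snd.snd))) (.const 0) fun x st => by
        simp only [nextChunk]
        split
        · omega
        · have h₁ := encSize_le_of_sublist
            (List.drop_sublist (PrivateLearning.bound chunkExamples x.1) st.1)
          have h₂ := encSize_le_of_sublist
            (List.drop_sublist (PrivateLearning.bound chunkCoins x.1) st.2)
          simp only [encSize_prod] at *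
          omega
  have hfin := hres.comp (id.pair hiter)
  exact hfin.fst.cond hfin.snd (const [])

theorem parityEvaluation : PolyTime fun x : List Bool × List Bool =>
    PrivateLearning.parityBit x.1 x.2 :=
  parityBit id.fst id.snd

end PolyTime

end PrivateLearning

namespace PrivateLearning

open scoped ENNReal

/-! ### The learner finds a uniformly random solution -/

/-- The solutions of the equations given by the labeled examples `us`. -/
def solutions {d : ℕ} (us : List (PARITY.Example d)) : Set (PARITY.domain d) :=
  {r | ∀ u ∈ us, parityBit u.1.1 r.1 = u.2}

theorem mem_solutions_append {d : ℕ} {us vs : List (PARITY.Example d)} {r : PARITY.domain d} :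
    r ∈ solutions (us ++ vs) ↔ r ∈ solutions us ∧ r ∈ solutions vs := by
  simp only [solutions, Set.mem_ofPred_eq, List.mem_append]
  exact ⟨fun h => ⟨fun u hu => h u (.inl hu), fun u hu => h u (.inr hu)⟩,
    fun h u hu => hu.elim (h.1 u) (h.2 u)⟩

theorem mem_solutions_singleton {d : ℕ} {u : PARITY.Example d} {r : PARITY.domain d} :
    r ∈ solutions [u] ↔ parityBit u.1.1 r.1 = u.2 := by
  simp [solutions]

/-- The state of the elimination after the labeled examples `us`. -/
def solveState {d : ℕ} (v : PARITY.domain d) (us : List (PARITY.Example d)) :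
    Bool × List (List Bool) × List Bool :=
  solve d v.1 (us.map exampleString)

theorem solveState_concat {d : ℕ} (v : PARITY.domain d) (us : List (PARITY.Example d))
    (u : PARITY.Example d) :
    solveState v (us ++ [u]) = eliminate (solveState v us) (u.1.1, u.2) := by
  simp [solveState, solve, exampleString]

/-- The properties of the state of the elimination. -/
structure SolveInvariant {d : ℕ} (us : List (PARITY.Example d)) (B : List (List Bool)) : Prop where
  directions : ∀ v, (solveState v us).2.1 = B
  length_direction : ∀ b ∈ B, b.length = d
  length_solution : ∀ v : PARITY.domain d, (solveState v us).2.2.length = d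
  homogeneous : ∀ b ∈ B, ∀ u ∈ us, parityBit u.1.1 b = false
  -- The dual form of the claim that `B` spans all differences of solutions: a functional that
  -- vanishes on `B` does not separate solutions.
  constant : ∀ x : PARITY.domain d, (∀ b ∈ B, parityBit x.1 b = false) →
    ∀ r ∈ solutions us, ∀ r' ∈ solutions us, parityBit x.1 r.1 = parityBit x.1 r'.1
  mem_solutions : ∀ v, (solveState v us).1 = true → ∀ r : PARITY.domain d,
    r.1 = (solveState v us).2.2 → r ∈ solutions us
  flag : (solutions us).Nonempty → ∀ v, (solveState v us).1 = true
  -- This is what makes the computed solution uniformly distributed when `v` is.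
  fiber : ∃ c, ∀ r ∈ solutions us, {v : PARITY.domain d | (solveState v us).2.2 = r.1}.ncard = c

theorem bitAdd_comm (a b : List Bool) : bitAdd a b = bitAdd b a :=
  List.zipWith_comm_of_comm fun _ _ => Bool.xor_comm _ _

theorem parityBit_replicate_append (x : List Bool) (i : ℕ) (y : List Bool) :
    parityBit x (List.replicate i false ++ y) = parityBit (x.drop i) y := by
  induction i generalizing x with
  | zero => simp
  | succ i ih => cases x <;> simp [List.replicate_succ, ih]

theorem parityBit_take (x y : List Bool) : parityBit x (y.take x.length) = parityBit x y := by
  induction x generalizing y with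
  | nil => simp
  | cons a x ih => cases y <;> simp [ih]

theorem parityBit_unitVector (x : List Bool) (i : ℕ) (h : i < x.length) :
    parityBit x (unitVector x.length i) = x[i] := by
  rw [unitVector, parityBit_take, parityBit_replicate_append, List.drop_eq_getElem_cons h,
    parityBit_cons, parityBit_comm, parityBit_replicate_false]
  simp

theorem length_unitVector {d i : ℕ} : (unitVector d i).length = d := by
  simp only [unitVector, List.length_take, List.length_append, List.length_cons,
    List.length_replicate]
  omega

theorem mem_unitVectors {d : ℕ} {b : List Bool} :
    b ∈ unitVectors d ↔ ∃ i < d, unitVector d i = b := by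
  simp [unitVectors]

theorem solveInvariant_nil (d : ℕ) : SolveInvariant (d := d) [] (unitVectors d) where
  directions _ := rfl
  length_direction b hb := by
    obtain ⟨i, -, rfl⟩ := mem_unitVectors.1 hb
    exact length_unitVector
  length_solution v := length_of_domain v
  homogeneous _ _ _ hu := by simp at hu
  constant x hx r _ r' _ := by
    have : x.1 = List.replicate d false := by
      refine List.eq_replicate_iff.2 ⟨length_of_domain x, fun b hb => ?_⟩
      obtain ⟨i, hi, rfl⟩ := List.getElem_of_mem hb
      have h₁ := parityBit_unitVector x.1 i hi
      rw [length_of_domain] at hi h₁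
      rw [← h₁]
      exact hx _ (mem_unitVectors.2 ⟨i, hi, rfl⟩)
    rw [this, parityBit_replicate_false, parityBit_replicate_false]
  mem_solutions _ _ _ _ := by simp [solutions]
  flag _ _ := rfl
  fiber := by
    refine ⟨1, fun r _ => ?_⟩
    rw [Set.ncard_eq_one]
    exact ⟨r, Set.ext fun v => ⟨fun h => Subtype.ext h, fun h => congrArg Subtype.val h⟩⟩

/-- The left-hand side of the new equation is constant on the old solutions, so all of them satisfy
it or none does; testing the current solution decides which. -/
theorem SolveInvariant.concat_of_forall {d : ℕ} {us : List (PARITY.Example d)}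
    {B : List (List Bool)} (h : SolveInvariant us B) (u : PARITY.Example d)
    (hB : ∀ b ∈ B, parityBit u.1.1 b = false) : SolveInvariant (us ++ [u]) B := by
  have hfilter : B.filter (fun b => parityBit u.1.1 b) = [] := by
    simpa [List.filter_eq_nil_iff] using hB
  have hst : ∀ v, solveState v (us ++ [u]) = ((solveState v us).1 &&
      (parityBit u.1.1 (solveState v us).2.2 == u.2), B, (solveState v us).2.2) := by
    intro v
    rw [solveState_concat, eliminate, h.directions, hfilter]
  have hsub : ∀ r, r ∈ solutions (us ++ [u]) → r ∈ solutions us :=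
    fun r hr => (mem_solutions_append.1 hr).1
  refine ⟨fun v => by rw [hst], h.length_direction, fun v => by rw [hst]; exact h.length_solution v,
    fun b hb w hw => ?_, fun x hx r hr r' hr' => h.constant x hx r (hsub r hr) r' (hsub r' hr'),
    fun v hv r hr => ?_, fun ⟨r, hr⟩ v => ?_, ?_⟩
  · rcases List.mem_append.1 hw with hw | hw
    · exact h.homogeneous b hb w hw
    · rw [List.mem_singleton.1 hw]; exact hB b hb
  · rw [hst] at hv hr
    simp only [Bool.and_eq_true, beq_iff_eq] at hv
    refine mem_solutions_append.2 ⟨h.mem_solutions v hv.1 r hr, mem_solutions_singleton.2 ?_⟩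
    rw [hr]
    exact hv.2
  · have h₁ := h.flag ⟨r, hsub r hr⟩ v
    have h₂ := h.mem_solutions v h₁ ⟨_, h.length_solution v⟩ rfl
    have h₃ := h.constant u.1 hB _ h₂ r (hsub r hr)
    rw [mem_solutions_singleton.1 (mem_solutions_append.1 hr).2] at h₃
    rw [hst]
    simp [h₁, h₃]
  · obtain ⟨c, hc⟩ := h.fiber
    refine ⟨c, fun r hr => ?_⟩
    simp only [hst]
    exact hc r (hsub r hr)

/-- Adding the pivot `b` exchanges old solutions that satisfy the new equation with those that
violate it. The violators are moved onto their partners, so the fiber over `r` becomes the disjoint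
union of the old fibers over `r` and `r + b`, and the common size of the fibers doubles. -/
theorem SolveInvariant.concat_of_mem {d : ℕ} {us : List (PARITY.Example d)}
    {B : List (List Bool)} (h : SolveInvariant us B) (u : PARITY.Example d) {b : List Bool}
    {l : List (List Bool)} (hB : B.filter (fun b => parityBit u.1.1 b) = b :: l) :
    SolveInvariant (us ++ [u])
      (B.map fun c => if parityBit u.1.1 c then bitAdd c b else c) := by
  have hb : b ∈ B ∧ parityBit u.1.1 b = true := by
    have : b ∈ B.filter (fun b => parityBit u.1.1 b) := by rw [hB]; simp
    simpa using this
  have hbl := h.length_direction b hb.1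
  have hst : ∀ v, solveState v (us ++ [u]) = ((solveState v us).1,
      B.map fun c => if parityBit u.1.1 c then bitAdd c b else c,
      if parityBit u.1.1 (solveState v us).2.2 == u.2 then (solveState v us).2.2 else
        bitAdd (solveState v us).2.2 b) := by
    intro v
    rw [solveState_concat, eliminate, h.directions, hB]
  have hsub : ∀ r, r ∈ solutions (us ++ [u]) → r ∈ solutions us :=
    fun r hr => (mem_solutions_append.1 hr).1
  have hlin : ∀ x r : List Bool, r.length = d →
      parityBit x (bitAdd r b) = xor (parityBit x r) (parityBit x b) :=
    fun x r hr => parityBit_bitAdd x (hr.trans hbl.symm)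
  have hadd : ∀ r : PARITY.domain d, (bitAdd r.1 b).length = d := by
    intro r
    rw [length_bitAdd, length_of_domain, hbl, min_self]
  have hmem : ∀ r ∈ solutions us, (⟨bitAdd r.1 b, hadd r⟩ : PARITY.domain d) ∈ solutions us := by
    intro r hr w hw
    rw [hlin _ _ (length_of_domain r), h.homogeneous b hb.1 w hw, hr w hw, Bool.xor_false]
  refine ⟨fun v => by rw [hst], ?_, fun v => ?_, ?_, ?_, ?_, fun ⟨r, hr⟩ v => ?_, ?_⟩
  · intro c' hc'
    obtain ⟨c, hc, rfl⟩ := List.mem_map.1 hc'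
    have := h.length_direction c hc
    split
    · rw [length_bitAdd]; omega
    · exact this
  · have := h.length_solution v
    rw [hst]
    dsimp only
    split
    · exact this
    · rw [length_bitAdd]; omega
  · intro c' hc' w hw
    obtain ⟨c, hc, rfl⟩ := List.mem_map.1 hc'
    rcases List.mem_append.1 hw with hw | hw
    · split
      · rw [hlin _ _ (h.length_direction c hc), h.homogeneous c hc w hw,
          h.homogeneous b hb.1 w hw, Bool.xor_false]
      · exact h.homogeneous c hc w hw
    · rw [List.mem_singleton.1 hw]
      split
      · rename_i hcu
        rw [hlin _ _ (h.length_direction c hc), hcu, hb.2, Bool.xor_self]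
      · rename_i hcu
        simpa using hcu
  · intro x hx r hr r' hr'
    have hx' : ∀ c ∈ B, parityBit x.1 (if parityBit u.1.1 c then bitAdd c b else c) = false :=
      fun c hc => hx _ (List.mem_map.2 ⟨c, hc, rfl⟩)
    -- If `x` is odd on the pivot, then `u + x` vanishes on all old directions. Since new solutions
    -- agree on `u`, constancy of `u + x` gives constancy of `x`.
    cases hxb : parityBit x.1 b
    · refine h.constant x (fun c hc => ?_) r (hsub r hr) r' (hsub r' hr')
      have := hx' c hc
      split at this
      · rwa [hlin _ _ (h.length_direction c hc), hxb, Bool.xor_false] at this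
      · exact this
    · have hlen : u.1.1.length = x.1.length := by rw [length_of_domain, length_of_domain]
      have hy : ∀ s : List Bool, parityBit (translate u.1 x).1 s =
          xor (parityBit u.1.1 s) (parityBit x.1 s) := by
        intro s
        rw [translate_val, parityBit_comm, parityBit_bitAdd s hlen, parityBit_comm s,
          parityBit_comm s]
      have h₁ := h.constant (translate u.1 x) (fun c hc => ?_) r (hsub r hr) r' (hsub r' hr')
      · rw [hy, hy, mem_solutions_singleton.1 (mem_solutions_append.1 hr).2,
          mem_solutions_singleton.1 (mem_solutions_append.1 hr').2] at h₁
        exact Bool.xor_right_inj.1 h₁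
      · have := hx' c hc
        rw [hy]
        split at this
        · rename_i hcu
          rw [hlin _ _ (h.length_direction c hc), hxb] at this
          rw [hcu]
          revert this
          cases parityBit x.1 c <;> simp
        · rename_i hcu
          rw [this]
          simpa using hcu
  · intro v hv r hr
    rw [hst] at hv hr
    have h₁ := h.mem_solutions v hv ⟨_, h.length_solution v⟩ rfl
    dsimp only at hr
    rw [mem_solutions_append, mem_solutions_singleton]
    split at hr
    · rename_i hu
      obtain rfl : r = ⟨_, h.length_solution v⟩ := Subtype.ext hr
      exact ⟨h₁, by simpa using hu⟩
    · rename_i hu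
      obtain rfl : r = ⟨_, hadd ⟨_, h.length_solution v⟩⟩ := Subtype.ext hr
      refine ⟨hmem _ h₁, ?_⟩
      dsimp only
      rw [hlin _ _ (h.length_solution v), hb.2]
      revert hu
      cases parityBit u.1.1 (solveState v us).2.2 <;> cases u.2 <;> simp
  · rw [hst]
    exact h.flag ⟨r, hsub r hr⟩ v
  · obtain ⟨c, hc⟩ := h.fiber
    refine ⟨c + c, fun r hr => ?_⟩
    have hru := mem_solutions_singleton.1 (mem_solutions_append.1 hr).2
    have hcancel : ∀ s : List Bool, s.length = d → bitAdd (bitAdd s b) b = s := by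
      intro s hs
      rw [bitAdd_comm _ b, bitAdd_comm s b, bitAdd_bitAdd_cancel (hbl.trans hs.symm)]
    have hset : {v : PARITY.domain d | (solveState v (us ++ [u])).2.2 = r.1} =
        {v : PARITY.domain d | (solveState v us).2.2 = r.1} ∪
        {v : PARITY.domain d | (solveState v us).2.2 = bitAdd r.1 b} := by
      ext v
      simp only [Set.mem_ofPred_eq, Set.mem_union, hst]
      constructor
      · intro hv
        split at hv
        · exact .inl hv
        · right
          rw [← hv, hcancel _ (h.length_solution v)]
      · rintro (hv | hv)
        · rw [hv, if_pos (by simpa using hru)]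
        · rw [hv, if_neg, hcancel _ (length_of_domain r)]
          rw [hlin _ _ (length_of_domain r), hb.2, hru]
          cases u.2 <;> simp
    rw [hset, Set.ncard_union_eq, hc r (hsub r hr), hc _ (hmem r (hsub r hr))]
    rw [Set.disjoint_left]
    intro v (hv : _ = _) (hv' : _ = _)
    have := hlin u.1.1 r.1 (length_of_domain r)
    rw [← hv', hv, hb.2] at this
    revert this
    cases parityBit u.1.1 r.1 <;> simp

theorem exists_solveInvariant {d : ℕ} (us : List (PARITY.Example d)) :
    ∃ B, SolveInvariant us B := by
  induction us using List.reverseRecOn with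
  | nil => exact ⟨_, solveInvariant_nil d⟩
  | append_singleton us u ih =>
    obtain ⟨B, hB⟩ := ih
    cases h : B.filter (fun b => parityBit u.1.1 b) with
    | nil => exact ⟨B, hB.concat_of_forall u (by simpa [List.filter_eq_nil_iff] using h)⟩
    | cons b l => exact ⟨_, hB.concat_of_mem u h⟩

/-- The number of initial vectors that lead to the solution `r`. -/
noncomputable def solveCount {d : ℕ} (us : List (PARITY.Example d)) (s : List Bool) : ℕ :=
  {v : PARITY.domain d | (solveState v us).1 = true ∧ (solveState v us).2.2 = s}.ncard

theorem solveState_flag {d : ℕ} {us : List (PARITY.Example d)} (h : (solutions us).Nonempty)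
    (v : PARITY.domain d) : (solveState v us).1 = true :=
  let ⟨_, hB⟩ := exists_solveInvariant us
  hB.flag h v

theorem solveState_mem {d : ℕ} {us : List (PARITY.Example d)} {v : PARITY.domain d}
    (h : (solveState v us).1 = true) : ∃ r ∈ solutions us, (solveState v us).2.2 = r.1 := by
  obtain ⟨B, hB⟩ := exists_solveInvariant us
  exact ⟨⟨_, hB.length_solution v⟩, hB.mem_solutions v h _ rfl, rfl⟩

/-- The `2^d` starting vectors are spread evenly over the solutions, by constancy of the fibers. -/
theorem ncard_solutions_mul_solveCount {d : ℕ} {us : List (PARITY.Example d)}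
    {r : PARITY.domain d} (hr : r ∈ solutions us) :
    (solutions us).ncard * solveCount us r.1 = 2 ^ d := by
  classical
  obtain ⟨B, hB⟩ := exists_solveInvariant us
  obtain ⟨c, hc⟩ := hB.fiber
  have hcount : ∀ s ∈ solutions us, solveCount us s.1 = c := by
    intro s hs
    rw [← hc s hs, solveCount]
    congr 1
    ext v
    simp [hB.flag ⟨r, hr⟩ v]
  rw [hcount r hr, ← card_domain d]
  have h₁ := Finset.card_eq_sum_card_fiberwise (s := (Finset.univ : Finset (PARITY.domain d)))
    (t := (solutions us).toFinset) (f := fun v => ⟨_, hB.length_solution v⟩) (by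
      intro v _
      simpa using hB.mem_solutions v (hB.flag ⟨r, hr⟩ v) _ rfl)
  rw [Finset.sum_congr rfl (g := fun _ => c) ?_, Finset.sum_const, smul_eq_mul, Finset.card_univ,
    ← Set.ncard_eq_toFinset_card'] at h₁
  · exact h₁.symm
  · intro s hs
    rw [← hc s (by simpa using hs), Set.ncard_eq_toFinset_card']
    congr 1
    ext v
    simp [Subtype.ext_iff]

/-- Let `w` solve all equations but `u`, and let `r` solve all of them. Translation by `w + r` maps
the vectors that violate only `u` injectively into the solutions. -/
theorem ncard_solutions_le {d : ℕ} (us vs : List (PARITY.Example d)) (u : PARITY.Example d)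
    (h : (solutions (us ++ u :: vs)).Nonempty) :
    (solutions (us ++ vs)).ncard ≤ 2 * (solutions (us ++ u :: vs)).ncard := by
  classical
  have hmem : ∀ r, r ∈ solutions (us ++ u :: vs) ↔
      r ∈ solutions (us ++ vs) ∧ parityBit u.1.1 r.1 = u.2 := by
    intro r
    rw [← List.singleton_append, mem_solutions_append, mem_solutions_append, mem_solutions_append,
      mem_solutions_singleton]
    tauto
  have hsub : solutions (us ++ u :: vs) ⊆ solutions (us ++ vs) := fun r hr => ((hmem r).1 hr).1
  have hadd := Set.ncard_sdiff_add_ncard_of_subset hsub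
  suffices hle : (solutions (us ++ vs) \ solutions (us ++ u :: vs)).ncard ≤
      (solutions (us ++ u :: vs)).ncard by omega
  rcases (solutions (us ++ vs) \ solutions (us ++ u :: vs)).eq_empty_or_nonempty with he | ⟨w, hw⟩
  · simp [he]
  obtain ⟨r, hr⟩ := h
  have hlin : ∀ (x : List Bool) (t : PARITY.domain d),
      parityBit x (translate (translate w r) t).1 =
        xor (xor (parityBit x w.1) (parityBit x r.1)) (parityBit x t.1) := by
    intro x t
    rw [translate_val, parityBit_bitAdd x (by rw [length_of_domain, length_of_domain]),
      translate_val, parityBit_bitAdd x (by rw [length_of_domain, length_of_domain])]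
  refine Set.ncard_le_ncard_of_injOn (translate (translate w r)) (fun t ht => ?_)
    (translate (translate w r)).injective.injOn
  rw [hmem] at hr ⊢
  simp only [Set.mem_sdiff, hmem, not_and] at hw ht
  refine ⟨fun v hv => ?_, ?_⟩
  · rw [hlin, hw.1 v hv, hr.1 v hv, ht.1 v hv]
    simp
  · have h₁ := hw.2 hw.1
    have h₂ := ht.2 ht.1
    rw [hlin, hr.2]
    revert h₁ h₂
    cases parityBit u.1.1 w.1 <;> cases parityBit u.1.1 t.1 <;> cases u.2 <;> simp

/-- If `s` survives the new equation, the number of solutions at most halves and each gets a share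
of at most twice the old one; if not, its count is zero. The equation may stand anywhere in the
list, since the counts depend only on the solution sets. -/
theorem solveCount_insert_le {d : ℕ} (us vs : List (PARITY.Example d)) (u : PARITY.Example d)
    (s : List Bool) : solveCount (us ++ u :: vs) s ≤ 2 * solveCount (us ++ vs) s := by
  by_cases hs : ∃ r ∈ solutions (us ++ u :: vs), r.1 = s
  · obtain ⟨r, hr, rfl⟩ := hs
    have hr' : r ∈ solutions (us ++ vs) := fun w hw => hr w (by
      simp only [List.mem_append, List.mem_cons] at hw ⊢
      tauto)
    have h₁ := ncard_solutions_mul_solveCount hr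
    have h₂ := ncard_solutions_mul_solveCount hr'
    have h₃ := ncard_solutions_le us vs u ⟨r, hr⟩
    have h₄ : 0 < (solutions (us ++ u :: vs)).ncard := by
      rw [Set.ncard_pos]
      exact ⟨r, hr⟩
    refine Nat.le_of_mul_le_mul_left ?_ h₄
    rw [h₁, ← h₂]
    calc _ ≤ 2 * (solutions (us ++ u :: vs)).ncard * solveCount (us ++ vs) r.1 :=
          Nat.mul_le_mul_right _ h₃
      _ = _ := by ring
  · rw [solveCount, (Set.ncard_eq_zero (Set.toFinite _)).2]
    · exact Nat.zero_le _
    · rw [Set.eq_empty_iff_forall_notMem]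
      rintro v ⟨h₁, h₂⟩
      obtain ⟨r, hr, hr'⟩ := solveState_mem h₁
      exact hs ⟨r, hr, hr'.symm.trans h₂⟩

end PrivateLearning

namespace PrivateLearning

open scoped ENNReal

/-! ### The distribution of the examples that are kept -/

/-- Either the search has passed `n`, or all `i` steps so far were doublings. Thus `n` steps
suffice, because `n < 2^n`. -/
theorem powerStep_iterate_bounds {n : ℕ} (hn : 1 ≤ n) (i : ℕ) :
    ((powerStep n)^[i] (1, 0)).1 = 2 ^ ((powerStep n)^[i] (1, 0)).2 ∧
      ((powerStep n)^[i] (1, 0)).1 ≤ 2 * n ∧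
      (n < ((powerStep n)^[i] (1, 0)).1 ∨ i ≤ ((powerStep n)^[i] (1, 0)).2) := by
  induction i with
  | zero => exact ⟨rfl, by simp; omega, .inr (Nat.zero_le _)⟩
  | succ i ih =>
    rw [Function.iterate_succ_apply']
    generalize (powerStep n)^[i] (1, 0) = s at *
    obtain ⟨h₁, h₂, h₃⟩ := ih
    unfold powerStep
    split
    · rename_i hs
      refine ⟨?_, ?_, .inr ?_⟩
      · dsimp only
        rw [pow_succ, ← h₁]
        omega
      · dsimp only
        omega
      · dsimp only
        omega
    · exact ⟨h₁, h₂, .inl (by omega)⟩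

theorem lt_two_pow_powerExponent {n : ℕ} (hn : 1 ≤ n) : n < 2 ^ powerExponent n := by
  obtain ⟨h₁, -, h₃⟩ := powerStep_iterate_bounds hn n
  rw [powerExponent]
  rcases h₃ with h | h
  · rwa [← h₁]
  · exact h.trans_lt Nat.lt_two_pow_self

theorem two_pow_powerExponent_le {n : ℕ} (hn : 1 ≤ n) : 2 ^ powerExponent n ≤ 2 * n := by
  obtain ⟨h₁, h₂, -⟩ := powerStep_iterate_bounds hn n
  rw [powerExponent, ← h₁]
  exact h₂

/-- The distribution of a fair coin. -/
noncomputable abbrev fair : PMF Bool := PMF.uniformOfFintype Bool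

theorem expect_fair (g : Bool → ℝ≥0∞) : expect fair g = 2⁻¹ * g true + 2⁻¹ * g false := by
  rw [expect_fintype]
  simp

theorem expect_draws_add {D : Type} (μ : PMF D) (m n : ℕ) (f : List D → List D → ℝ≥0∞) :
    expect (draws μ (m + n)) (fun l => f (l.take m) (l.drop m)) =
      expect (draws μ m) fun l => expect (draws μ n) fun l' => f l l' := by
  rw [draws_add, expect_bind]
  refine expect_congr fun l hl => ?_
  rw [expect_map]
  refine expect_congr fun l' _ => ?_
  simp [← draws_length hl]

/-- The probability that an example is kept. -/
noncomputable def keepProb (a : ℕ) : ℝ≥0∞ := 2⁻¹ ^ a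

/-- The probability that an example is not kept. -/
noncomputable def dropProb (a : ℕ) : ℝ≥0∞ := 1 - 2⁻¹ ^ a

theorem keepProb_le_one (a : ℕ) : keepProb a ≤ 1 := pow_le_one₀ zero_le (by simp)

theorem keepProb_ne_top (a : ℕ) : keepProb a ≠ ⊤ :=
  ((keepProb_le_one a).trans_lt ENNReal.one_lt_top).ne

theorem keepProb_add_dropProb (a : ℕ) : keepProb a + dropProb a = 1 :=
  add_tsub_cancel_of_le (keepProb_le_one a)

theorem dropProb_succ (a : ℕ) : dropProb (a + 1) = 2⁻¹ + 2⁻¹ * dropProb a := by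
  refine (ENNReal.add_right_inj (keepProb_ne_top (a + 1))).1 ?_
  rw [keepProb_add_dropProb]
  have : keepProb (a + 1) = 2⁻¹ * keepProb a := by rw [keepProb, keepProb, pow_succ']
  rw [this, show 2⁻¹ * keepProb a + (2⁻¹ + 2⁻¹ * dropProb a) =
    2⁻¹ + 2⁻¹ * (keepProb a + dropProb a) by ring, keepProb_add_dropProb, mul_one,
    ENNReal.inv_two_add_inv_two]

theorem expect_allFalse {a M : ℕ} (h : a ≤ M) (x y : ℝ≥0∞) :
    expect (draws fair M) (fun ω => if allFalse a ω then x else y) =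
      keepProb a * x + dropProb a * y := by
  induction a generalizing M with
  | zero => simp [allFalse, expect_const, keepProb, dropProb]
  | succ a ih =>
    obtain ⟨M, rfl⟩ : ∃ M', M = M' + 1 := ⟨M - 1, by omega⟩
    have h₁ : ∀ ω, allFalse (a + 1) (true :: ω) = false := fun ω => by simp [allFalse]
    have h₂ : ∀ ω, allFalse (a + 1) (false :: ω) = allFalse a ω := fun ω => by simp [allFalse]
    rw [draws, expect_bind, expect_fair, expect_map, expect_map]
    simp only [h₁, h₂]
    rw [ih (by omega), dropProb_succ]
    simp only [Bool.false_eq_true, if_false, expect_const]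
    rw [keepProb, keepProb, pow_succ']
    ring

theorem allFalse_take {a M : ℕ} (h : a ≤ M) (ω : List Bool) :
    allFalse a (ω.take M) = allFalse a ω := by
  rw [allFalse, allFalse, List.take_take, min_eq_left h]

/-- The distribution of the list of examples that are kept. -/
noncomputable def keptLaw {D : Type} (a M : ℕ) (us : List D) : PMF (List D) :=
  (draws fair (us.length * M)).map (keptExamples a M us)

theorem expect_keptLaw_cons {D : Type} {a M : ℕ} (h : a ≤ M) (u : D) (us : List D)
    (g : List D → ℝ≥0∞) : expect (keptLaw a M (u :: us)) g =
      keepProb a * expect (keptLaw a M us) (fun l => g (u :: l)) +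
        dropProb a * expect (keptLaw a M us) g := by
  rw [keptLaw, expect_map, List.length_cons, show (us.length + 1) * M = M + us.length * M by ring,
    ← expect_allFalse h]
  have := expect_draws_add fair M (us.length * M) fun ω η =>
    g (if allFalse a ω then u :: keptExamples a M us η else keptExamples a M us η)
  simp only [allFalse_take h] at this
  refine this.trans (expect_congr fun ω _ => ?_)
  rw [keptLaw, expect_map, expect_map]
  split <;> rfl

theorem keptExamples_map {D D' : Type} (a M : ℕ) (f : D → D') (us : List D) (ω : List Bool) :
    keptExamples a M (us.map f) ω = (keptExamples a M us ω).map f := by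
  induction us generalizing ω with
  | nil => rfl
  | cons u us ih =>
    simp only [List.map_cons, keptExamples, ih]
    split <;> rfl

theorem keptExamples_take {D : Type} {a M n : ℕ} (h : a ≤ M) (us : List D) (ω : List Bool)
    (hn : us.length * M ≤ n) : keptExamples a M us (ω.take n) = keptExamples a M us ω := by
  induction us generalizing ω n with
  | nil => rfl
  | cons u us ih =>
    rw [List.length_cons, add_one_mul] at hn
    have h₁ := allFalse_take (a := a) (M := n) (h.trans (by omega)) ω
    simp only [keptExamples, h₁, List.drop_take]
    rw [ih _ (by omega)]

theorem keptExamples_sublist {D : Type} (a M : ℕ) (us : List D) (ω : List Bool) :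
    (keptExamples a M us ω).Sublist us := by
  induction us generalizing ω with
  | nil => exact .slnil
  | cons u us ih =>
    rw [keptExamples]
    split
    · exact (ih _).cons_cons u
    · exact (ih _).cons u

/-- The effect of one example on the expectation of a function of the examples that are kept. -/
theorem keptLaw_insert {D : Type} {a M : ℕ} (h : a ≤ M) (us vs : List D) (u : D)
    (g : List D → ℝ≥0∞) (hg : ∀ l l', g (l ++ u :: l') ≤ 2 * g (l ++ l')) :
    dropProb a * expect (keptLaw a M (us ++ vs)) g ≤ expect (keptLaw a M (us ++ u :: vs)) g ∧
      expect (keptLaw a M (us ++ u :: vs)) g ≤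
        (1 + keepProb a) * expect (keptLaw a M (us ++ vs)) g := by
  induction us generalizing g with
  | nil =>
    rw [List.nil_append, List.nil_append, expect_keptLaw_cons h]
    refine ⟨le_add_self, ?_⟩
    have h₁ : expect (keptLaw a M vs) (fun l => g (u :: l)) ≤ 2 * expect (keptLaw a M vs) g := by
      rw [← expect_mul_left]
      exact expect_mono fun l _ => hg [] l
    -- With `p` the probability of keeping `u`, the factor is `2 * p + (1 - p) = 1 + p`.
    calc _ ≤ keepProb a * (2 * expect (keptLaw a M vs) g) +
          dropProb a * expect (keptLaw a M vs) g := by gcongr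
      _ = ((keepProb a + dropProb a) + keepProb a) * expect (keptLaw a M vs) g := by ring
      _ = _ := by rw [keepProb_add_dropProb]
  | cons w us ih =>
    obtain ⟨h₁, h₂⟩ := ih g hg
    obtain ⟨h₃, h₄⟩ := ih (fun l => g (w :: l)) fun l l' => hg (w :: l) l'
    rw [List.cons_append, List.cons_append, expect_keptLaw_cons h, expect_keptLaw_cons h]
    constructor
    · rw [mul_add, mul_left_comm, mul_left_comm (dropProb a) (dropProb a)]
      gcongr
    · rw [mul_add, mul_left_comm, mul_left_comm (1 + keepProb a) (dropProb a)]
      gcongr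

/-! ### The distribution of the solution -/

theorem expect_draws_fair (d : ℕ) (g : List Bool → ℝ≥0∞) :
    expect (draws fair d) g = ∑ v : PARITY.domain d, (2 ^ d)⁻¹ * g v.1 := by
  rw [← coins_eq_draws, coins, expect_map, expect_fintype,
    ← Equiv.sum_comp (Equiv.vectorEquivFin Bool d)]
  refine Finset.sum_congr rfl fun v _ => ?_
  have : List.ofFn (Equiv.vectorEquivFin Bool d v) = v.1 := by
    rw [← List.Vector.toList_ofFn]
    exact congrArg Subtype.val ((Equiv.vectorEquivFin Bool d).symm_apply_apply v)
  rw [this]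
  simp

/-- The distribution of the outcome for one chunk, given the examples that are kept. -/
noncomputable def solveLaw {d : ℕ} (us : List (PARITY.Example d)) : PMF (Option (List Bool)) :=
  fair.bind fun b => (draws fair d).map fun v =>
    if (!b) && (solve d v (us.map exampleString)).1 then
      some (solve d v (us.map exampleString)).2.2 else none

theorem pmf_apply_eq_expect {D : Type} [DecidableEq D] (μ : PMF D) (a : D) :
    μ a = expect μ fun b => if b = a then 1 else 0 := by
  rw [expect, tsum_eq_single a]
  · simp
  · intro b hb
    simp [hb]

theorem expect_solveLaw {d : ℕ} (us : List (PARITY.Example d)) (g : Option (List Bool) → ℝ≥0∞) :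
    expect (solveLaw us) g = 2⁻¹ * g none + 2⁻¹ * ∑ v : PARITY.domain d, (2 ^ d)⁻¹ *
      g (if (solveState v us).1 then some (solveState v us).2.2 else none) := by
  rw [solveLaw, expect_bind, expect_fair, expect_map, expect_map]
  simp only [Bool.not_true, Bool.false_and, Bool.false_eq_true, if_false, expect_const,
    Bool.not_false, Bool.true_and]
  rw [expect_draws_fair]
  rfl

theorem solveLaw_apply_some {d : ℕ} (us : List (PARITY.Example d)) (s : List Bool) :
    solveLaw us (some s) = 2⁻¹ * ((2 ^ d)⁻¹ * solveCount us s) := by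
  classical
  rw [pmf_apply_eq_expect, expect_solveLaw, solveCount, Set.ncard_eq_toFinset_card',
    Set.toFinset_ofPred, Finset.card_filter, Nat.cast_sum, ← Finset.mul_sum]
  simp only [reduceCtorEq, if_false, mul_zero, zero_add]
  congr 2
  refine Finset.sum_congr rfl fun v _ => ?_
  cases (solveState v us).1 <;> simp

theorem half_le_solveLaw_apply_none {d : ℕ} (us : List (PARITY.Example d)) :
    2⁻¹ ≤ solveLaw us none := by
  classical
  rw [pmf_apply_eq_expect, expect_solveLaw, if_pos rfl, mul_one]
  exact le_self_add

theorem solveLaw_apply_none_of_nonempty {d : ℕ} {us : List (PARITY.Example d)}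
    (h : (solutions us).Nonempty) : solveLaw us none = 2⁻¹ := by
  classical
  rw [pmf_apply_eq_expect, expect_solveLaw, if_pos rfl, mul_one]
  simp [solveState_flag h]

/-- For a solution this is the bound on counts. A new equation may also turn success into certain
failure; that costs at most a factor of two because the first coin already causes failure with
probability 1/2, which is its purpose. -/
theorem solveLaw_insert_le {d : ℕ} (us vs : List (PARITY.Example d)) (u : PARITY.Example d)
    (o : Option (List Bool)) : solveLaw (us ++ u :: vs) o ≤ 2 * solveLaw (us ++ vs) o := by
  cases o with
  | none =>
    refine (PMF.coe_le_one _ _).trans ?_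
    calc (1 : ℝ≥0∞) = 2 * 2⁻¹ := (ENNReal.mul_inv_cancel (by norm_num) (by norm_num)).symm
      _ ≤ _ := by gcongr; exact half_le_solveLaw_apply_none _
  | some s =>
    rw [solveLaw_apply_some, solveLaw_apply_some]
    have h : (solveCount (us ++ u :: vs) s : ℝ≥0∞) ≤ 2 * solveCount (us ++ vs) s := by
      exact_mod_cast solveCount_insert_le us vs u s
    calc _ ≤ 2⁻¹ * ((2 ^ d)⁻¹ * (2 * (solveCount (us ++ vs) s : ℝ≥0∞))) := by gcongr
      _ = _ := by ring

/-! ### The distribution of the result -/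

/-- The outcome for one chunk. -/
def chunkOutcome (d a M m : ℕ) (db : List (List Bool × Bool)) (ω : List Bool) :
    Option (List Bool) :=
  if (chunkResult d a M m db ω).1 then some (chunkResult d a M m db ω).2 else none

theorem chunkResult_take {d a M m : ℕ} (h : a ≤ M) (db : List (List Bool × Bool))
    (ω : List Bool) :
    chunkResult d a M m (db.take m) (ω.take (1 + d + m * M)) = chunkResult d a M m db ω := by
  have h₁ : (ω.take (1 + d + m * M)).headD true = ω.headD true := by
    rw [show 1 + d + m * M = (d + m * M) + 1 by ring]
    cases ω <;> rfl
  have h₂ : ((ω.take (1 + d + m * M)).drop 1).take d = (ω.drop 1).take d := by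
    rw [List.drop_take, List.take_take, min_eq_left (by omega)]
  have h₃ : keptExamples a M (db.take m) ((ω.take (1 + d + m * M)).drop (1 + d)) =
      keptExamples a M (db.take m) (ω.drop (1 + d)) := by
    rw [List.drop_take, keptExamples_take h]
    have := Nat.mul_le_mul_right M (List.length_take_le m db)
    omega
  simp only [chunkResult, List.take_take, min_self, h₁, h₂, h₃]

/-- The distribution of the outcome for a chunk. -/
noncomputable def chunkLaw {d : ℕ} (a M : ℕ) (us : List (PARITY.Example d)) :
    PMF (Option (List Bool)) :=
  (keptLaw a M us).bind solveLaw

/-- The three blocks of coins are independent, so the selection of examples, which uses the last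
block, may be drawn first. -/
theorem map_chunkOutcome {d a M : ℕ} (us : List (PARITY.Example d)) :
    (draws fair (1 + d + us.length * M)).map
      (chunkOutcome d a M us.length (us.map exampleString)) = chunkLaw a M us := by
  have h₁ : chunkOutcome d a M us.length (us.map exampleString) = fun ω =>
      (fun ω₁ ω₂ η : List Bool => if (!ω₁.headD true) &&
        (solve d ω₂ ((keptExamples a M us η).map exampleString)).1 then
          some (solve d ω₂ ((keptExamples a M us η).map exampleString)).2.2 else none)
        ((ω.take (1 + d)).take 1) ((ω.take (1 + d)).drop 1) (ω.drop (1 + d)) := by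
    funext ω
    have h₂ : ((ω.take (1 + d)).take 1).headD true = ω.headD true := by
      rw [Nat.add_comm]
      cases ω <;> simp
    have h₃ : (us.map (exampleString (C := PARITY))).take us.length = us.map exampleString := by
      rw [List.take_of_length_le (by simp)]
    simp only [chunkOutcome, chunkResult, h₂, h₃, keptExamples_map, List.drop_take,
      Nat.add_sub_cancel_left]
  rw [h₁]
  rw [draws_add_map fair (1 + d) (us.length * M) fun ω η =>
      (fun ω₁ ω₂ η : List Bool => if (!ω₁.headD true) &&
        (solve d ω₂ ((keptExamples a M us η).map exampleString)).1 then
          some (solve d ω₂ ((keptExamples a M us η).map exampleString)).2.2 else none)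
        (ω.take 1) (ω.drop 1) η]
  rw [draws_add_bind fair 1 d fun ω₁ ω₂ => (draws fair (us.length * M)).map fun η =>
      if (!ω₁.headD true) &&
        (solve d ω₂ ((keptExamples a M us η).map exampleString)).1 then
          some (solve d ω₂ ((keptExamples a M us η).map exampleString)).2.2 else none]
  simp only [draws, PMF.bind_bind, PMF.pure_map, PMF.pure_bind, List.headD_cons]
  rw [chunkLaw, keptLaw, PMF.bind_map]
  simp only [Function.comp_def, solveLaw]
  rw [PMF.bind_comm (draws fair (us.length * M))]
  congr 1
  funext b
  exact PMF.bind_comm (draws fair d) (draws fair (us.length * M)) fun v η =>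
    PMF.pure (if (!b) && (solve d v ((keptExamples a M us η).map exampleString)).1 then
      some (solve d v ((keptExamples a M us η).map exampleString)).2.2 else none)

/-- The distribution of the first successful outcome among `K` chunks. -/
noncomputable def resultLaw {d : ℕ} (a M m : ℕ) :
    ℕ → List (PARITY.Example d) → PMF (List Bool)
  | 0, _ => PMF.pure []
  | K + 1, us => (chunkLaw a M (us.take m)).bind fun o =>
      o.elim (resultLaw a M m K (us.drop m)) PMF.pure

theorem firstResult_zero (d a M m c : ℕ) (db : List (List Bool × Bool)) (ω : List Bool) :
    firstResult d a M m c 0 db ω = (chunkOutcome d a M m db ω).elim [] id := by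
  simp only [firstResult, chunkOutcome, Function.iterate_zero_apply]
  by_cases h : (chunkResult d a M m db ω).1 = true <;> simp [h]

/-- A state whose chunk succeeds is a fixed point of `nextChunk`, so iterating stops at the first
success. -/
theorem firstResult_succ (d a M m c K : ℕ) (db : List (List Bool × Bool)) (ω : List Bool) :
    firstResult d a M m c (K + 1) db ω =
      (chunkOutcome d a M m db ω).elim (firstResult d a M m c K (db.drop m) (ω.drop c)) id := by
  simp only [firstResult, chunkOutcome]
  by_cases h : (chunkResult d a M m db ω).1 = true
  · have hfix : nextChunk d a M m c (db, ω) = (db, ω) := by simp [nextChunk, h]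
    rw [Function.iterate_fixed hfix]
    simp [h]
  · rw [Function.iterate_succ_apply]
    have : nextChunk d a M m c (db, ω) = (db.drop m, ω.drop c) := by simp [nextChunk, h]
    rw [this, if_neg h]
    rfl

theorem map_firstResult {d a M m : ℕ} (h : a ≤ M) (K : ℕ) (us : List (PARITY.Example d))
    (hus : us.length = (K + 1) * m) :
    (draws fair ((K + 1) * (1 + d + m * M))).map
      (firstResult d a M m (1 + d + m * M) K (us.map exampleString)) =
        resultLaw a M m (K + 1) us := by
  have hchunk : ∀ vs : List (PARITY.Example d), m ≤ vs.length →
      (draws fair (1 + d + m * M)).map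
        (chunkOutcome d a M m ((vs.map exampleString).take m)) = chunkLaw a M (vs.take m) := by
    intro vs hvs
    have hl : (vs.take m).length = m := by simpa using hvs
    have := map_chunkOutcome (a := a) (M := M) (vs.take m)
    rwa [hl, List.map_take] at this
  have htake : ∀ (db : List (List Bool × Bool)) (ω : List Bool),
      chunkOutcome d a M m db ω =
        chunkOutcome d a M m (db.take m) (ω.take (1 + d + m * M)) := by
    intro db ω
    simp only [chunkOutcome, chunkResult_take h]
  induction K generalizing us with
  | zero =>
    rw [resultLaw, ← hchunk us (by omega), PMF.bind_map]
    simp only [resultLaw, Nat.zero_add, Nat.one_mul]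
    rw [PMF.map]
    refine pmf_bind_congr _ fun ω hω => ?_
    have hω' := draws_length hω
    simp only [Function.comp_def]
    rw [firstResult_zero, htake, List.take_of_length_le (l := ω) (by omega)]
    cases chunkOutcome d a M m (List.take m (us.map exampleString)) ω <;> rfl
  | succ K ih =>
    have hm : m ≤ us.length := by rw [hus, Nat.add_one_mul]; omega
    rw [resultLaw, ← hchunk us hm, PMF.bind_map,
      show (K + 1 + 1) * (1 + d + m * M) = (1 + d + m * M) + (K + 1) * (1 + d + m * M) by ring]
    have hf : firstResult d a M m (1 + d + m * M) (K + 1) (us.map exampleString) = fun ω =>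
        (chunkOutcome d a M m ((us.map exampleString).take m) (ω.take (1 + d + m * M))).elim
          (firstResult d a M m (1 + d + m * M) K ((us.map exampleString).drop m)
            (ω.drop (1 + d + m * M))) id :=
      funext fun ω => by rw [firstResult_succ, htake]
    rw [hf]
    rw [draws_add_map fair _ _ fun ω η => (chunkOutcome d a M m
      ((us.map exampleString).take m) ω).elim
        (firstResult d a M m (1 + d + m * M) K ((us.map exampleString).drop m) η) id]
    congr 1
    funext ω
    rw [Function.comp_apply]
    cases chunkOutcome d a M m (List.take m (us.map exampleString)) ω with
    | none =>
      simp only [Option.elim_none]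
      rw [← List.map_drop, ← ih (us.drop m)]
      rw [List.length_drop, hus, Nat.add_one_mul (K + 1) m]
      omega
    | some s => exact PMF.map_const _ _

/-! ### Privacy of the learner -/

/-- Both chunks are compared with the one from which the differing example is removed: an upper
bound for `u` and a lower bound for `u'`. -/
theorem chunkLaw_apply_le {d a M : ℕ} (h : a ≤ M) {ρ : ℝ≥0∞}
    (hρ : 1 + keepProb a ≤ ρ * dropProb a) (us vs : List (PARITY.Example d))
    (u u' : PARITY.Example d) (o : Option (List Bool)) :
    chunkLaw a M (us ++ u :: vs) o ≤ ρ * chunkLaw a M (us ++ u' :: vs) o := by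
  have h₁ : ∀ l : List (PARITY.Example d), chunkLaw a M l o = expect (keptLaw a M l) fun l' => solveLaw l' o :=
    fun l => PMF.bind_apply _ _ _
  rw [h₁, h₁]
  have h₂ := (keptLaw_insert h us vs u (fun l => solveLaw l o)
    fun l l' => solveLaw_insert_le l l' u o).2
  have h₃ := (keptLaw_insert h us vs u' (fun l => solveLaw l o)
    fun l l' => solveLaw_insert_le l l' u' o).1
  calc _ ≤ (1 + keepProb a) * expect (keptLaw a M (us ++ vs)) (fun l => solveLaw l o) := h₂
    _ ≤ (ρ * dropProb a) * expect (keptLaw a M (us ++ vs)) (fun l => solveLaw l o) := by gcongr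
    _ = ρ * (dropProb a * expect (keptLaw a M (us ++ vs)) (fun l => solveLaw l o)) := by ring
    _ ≤ _ := by gcongr

/-- The differing example lies in at most one of the chunks, so the factor `ρ` is paid once and not
once per chunk. -/
theorem resultLaw_apply_le {d a M m : ℕ} (h : a ≤ M) {ρ : ℝ≥0∞} (hρ₁ : 1 ≤ ρ)
    (hρ : 1 + keepProb a ≤ ρ * dropProb a) (K : ℕ) (us vs : List (PARITY.Example d))
    (u u' : PARITY.Example d) (s : List Bool) :
    resultLaw a M m K (us ++ u :: vs) s ≤ ρ * resultLaw a M m K (us ++ u' :: vs) s := by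
  induction K generalizing us with
  | zero => exact le_mul_of_one_le_left' hρ₁
  | succ K ih =>
    rw [resultLaw, resultLaw]
    by_cases hm : us.length < m
    · have ht : ∀ w : PARITY.Example d, (us ++ w :: vs).take m =
          us ++ w :: vs.take (m - us.length - 1) := by
        intro w
        rw [List.take_append, List.take_of_length_le hm.le,
          show m - us.length = (m - us.length - 1) + 1 by omega, List.take_succ_cons]
        rfl
      have hd : ∀ w : PARITY.Example d, (us ++ w :: vs).drop m =
          vs.drop (m - us.length - 1) := by
        intro w
        rw [List.drop_append, List.drop_of_length_le hm.le, List.nil_append,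
          show m - us.length = (m - us.length - 1) + 1 by omega, List.drop_succ_cons]
        rfl
      rw [ht, ht, hd, hd, ← mul_one ρ]
      exact pmf_bind_apply_le (fun o => chunkLaw_apply_le h hρ _ _ _ _ o) fun o _ => by simp
    · push Not at hm
      rw [List.take_append_of_le_length hm, List.take_append_of_le_length hm,
        List.drop_append_of_le_length hm, List.drop_append_of_le_length hm, ← one_mul ρ]
      refine pmf_bind_apply_le (fun o => by simp) fun o _ => ?_
      cases o with
      | none => exact ih _
      | some t => exact le_mul_of_one_le_left' hρ₁

theorem exists_ofFn_eq_append {D : Type} {n : ℕ} {z z' : Fin n → D} {i : Fin n}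
    (h : ∀ j, j ≠ i → z j = z' j) : ∃ us vs u u',
      List.ofFn z = us ++ u :: vs ∧ List.ofFn z' = us ++ u' :: vs := by
  induction n with
  | zero => exact i.elim0
  | succ n ih =>
    rw [List.ofFn_succ, List.ofFn_succ]
    refine Fin.cases (motive := fun i => (∀ j, j ≠ i → z j = z' j) → _) (fun h => ?_)
      (fun i h => ?_) i h
    · refine ⟨[], List.ofFn fun i => z i.succ, z 0, z' 0, rfl, ?_⟩
      simp only [List.nil_append, List.cons.injEq, true_and]
      exact congrArg List.ofFn (funext fun j => (h j.succ (Fin.succ_ne_zero j)).symm)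
    · obtain ⟨us, vs, u, u', h₁, h₂⟩ := ih (z := fun j => z j.succ) (z' := fun j => z' j.succ)
        (i := i) fun j hj => h j.succ (by simpa using hj)
      refine ⟨z 0 :: us, vs, u, u', by rw [h₁]; rfl, ?_⟩
      rw [h₂, h 0 (Fin.succ_ne_zero i).symm]
      rfl

end PrivateLearning

namespace PrivateLearning

open scoped ENNReal

/-! ### Accuracy of the learner -/

section Accuracy

variable {d : ℕ}

open Classical in
/-- The indicator of the event that `r` solves the equations given by `us`. -/
noncomputable def solves (r : PARITY.domain d) (us : List (PARITY.Example d)) : ℝ≥0∞ :=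
  if r ∈ solutions us then 1 else 0

theorem solves_nil (r : PARITY.domain d) : solves r [] = 1 := by simp [solves, solutions]

theorem solves_cons (r : PARITY.domain d) (u : PARITY.Example d) (us : List (PARITY.Example d)) :
    solves r (u :: us) = solves r [u] * solves r us := by
  have h : r ∈ solutions (u :: us) ↔ r ∈ solutions [u] ∧ r ∈ solutions us :=
    mem_solutions_append (us := [u])
  unfold solves
  by_cases h₁ : r ∈ solutions [u] <;> by_cases h₂ : r ∈ solutions us <;> simp [h, h₁, h₂]

theorem expect_keptLaw_nil {D : Type} (a M : ℕ) (g : List D → ℝ≥0∞) :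
    expect (keptLaw a M ([] : List D)) g = g [] := by
  rw [keptLaw, expect_map]
  simp only [keptExamples]
  exact expect_const _ _

/-- Independently for each example, `r` survives if the example is dropped, or is kept and agrees
with `r`. -/
theorem expect_solves {a M : ℕ} (h : a ≤ M) (ν : PMF (PARITY.Example d)) (r : PARITY.domain d)
    (n : ℕ) : expect (draws ν n) (fun us => expect (keptLaw a M us) (solves r)) =
      (keepProb a * expect ν (fun u => solves r [u]) + dropProb a) ^ n := by
  induction n with
  | zero => rw [draws, expect_pure, expect_keptLaw_nil, solves_nil, pow_zero]
  | succ n ih =>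
    have h₁ : ∀ u us, expect (keptLaw a M (u :: us)) (solves r) =
        (keepProb a * solves r [u] + dropProb a) * expect (keptLaw a M us) (solves r) := by
      intro u us
      have h₂ : (fun l => solves r (u :: l)) = fun l => solves r [u] * solves r l :=
        funext (solves_cons r u)
      rw [expect_keptLaw_cons h, h₂, expect_mul_left]
      ring
    rw [draws, expect_bind]
    simp only [expect_map, h₁, expect_mul_left, ih]
    rw [expect_mul_right, expect_add, expect_mul_left, expect_const, pow_succ']

/-- A bad output must itself solve the kept equations. If some element of `s` solves them, the
right-hand side is at least 1; if none does, the left-hand side is zero. -/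
theorem solveLaw_bad_le (S : List (PARITY.Example d)) (bad : Set (List Bool))
    (s : Finset (PARITY.domain d)) (hs : ∀ r : PARITY.domain d, r.1 ∈ bad → r ∈ s) :
    (solveLaw S).toOuterMeasure (some '' bad) ≤ ∑ r ∈ s, solves r S := by
  by_cases h : ∃ r ∈ s, r ∈ solutions S
  · obtain ⟨r, hr, hrS⟩ := h
    refine (toOuterMeasure_le_one _ _).trans ?_
    calc (1 : ℝ≥0∞) = solves r S := by simp [solves, hrS]
      _ ≤ _ := Finset.single_le_sum (f := fun r => solves r S) (fun _ _ => zero_le) hr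
  · push Not at h
    refine le_of_eq_of_le ?_ zero_le
    rw [toOuterMeasure_eq_expect, expect_solveLaw, Finset.sum_eq_zero]
    · simp
    · intro v _
      rw [Set.indicator_of_notMem, mul_zero]
      rintro ⟨t, ht, ht'⟩
      split at ht'
      · rename_i hv
        obtain ⟨r, hr, hr'⟩ := solveState_mem hv
        refine h r (hs r ?_) hr
        rw [← hr', ← Option.some.inj ht']
        exact ht
      · simp at ht'

theorem chunkLaw_bad_le (a M : ℕ) (us : List (PARITY.Example d)) (bad : Set (List Bool))
    (s : Finset (PARITY.domain d)) (hs : ∀ r : PARITY.domain d, r.1 ∈ bad → r ∈ s) :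
    (chunkLaw a M us).toOuterMeasure (some '' bad) ≤
      ∑ r ∈ s, expect (keptLaw a M us) (solves r) := by
  rw [← expect_sum, chunkLaw, PMF.toOuterMeasure_bind_apply]
  exact expect_mono fun S _ => solveLaw_bad_le S bad s hs

theorem chunkLaw_none_le (a M : ℕ) {us : List (PARITY.Example d)} (h : (solutions us).Nonempty) :
    chunkLaw a M us none ≤ 2⁻¹ := by
  rw [chunkLaw, PMF.bind_apply]
  change expect _ _ ≤ _
  rw [← expect_const (keptLaw a M us) 2⁻¹]
  refine expect_mono fun S hS => ?_
  obtain ⟨ω, -, rfl⟩ := (PMF.mem_support_map_iff _ _ _).1 hS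
  obtain ⟨r, hr⟩ := h
  exact (solveLaw_apply_none_of_nonempty
    ⟨r, fun u hu => hr u ((keptExamples_sublist a M us ω).subset hu)⟩).le

theorem mem_support_of_mem_draws {D : Type} {μ : PMF D} {n : ℕ} {l : List D}
    (h : l ∈ (draws μ n).support) {u : D} (hu : u ∈ l) : u ∈ μ.support := by
  induction n generalizing l with
  | zero =>
    rw [draws, PMF.support_pure, Set.mem_singleton_iff] at h
    simp [h] at hu
  | succ n ih =>
    simp only [draws, PMF.mem_support_bind_iff, PMF.mem_support_map_iff] at h
    obtain ⟨x, hx, l', hl', rfl⟩ := h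
    rcases List.mem_cons.1 hu with rfl | hu
    · exact hx
    · exact ih hl' hu

theorem resultLaw_succ_bad (a M m K : ℕ) (us : List (PARITY.Example d)) (bad : Set (List Bool)) :
    (resultLaw a M m (K + 1) us).toOuterMeasure bad =
      (chunkLaw a M (us.take m)).toOuterMeasure (some '' bad) +
        chunkLaw a M (us.take m) none * (resultLaw a M m K (us.drop m)).toOuterMeasure bad := by
  classical
  rw [resultLaw, PMF.toOuterMeasure_bind_apply, toOuterMeasure_eq_expect _ (some '' bad),
    pmf_apply_eq_expect _ none, ← expect_mul_right, ← expect_add]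
  refine expect_congr fun o _ => ?_
  cases o with
  | none => simp
  | some s => by_cases hs : s ∈ bad <;> simp [PMF.toOuterMeasure_pure_apply, hs]

/-- A chunk gives a bad output with probability at most `2^d * η` and passes on to the next with
probability at most 1/2. The geometric series yields the factor 2; the last term bounds the case in
which every chunk fails. -/
theorem expect_resultLaw_bad_le {a M m : ℕ} (h : a ≤ M) {ν : PMF (PARITY.Example d)}
    {r₀ : PARITY.domain d} (hr₀ : ∀ u ∈ ν.support, parityBit u.1.1 r₀.1 = u.2)
    {bad : Set (List Bool)} {η : ℝ≥0∞}
    (hη : ∀ r : PARITY.domain d, r.1 ∈ bad →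
      (keepProb a * expect ν (fun u => solves r [u]) + dropProb a) ^ m ≤ η) (K : ℕ) :
    expect (draws ν (K * m)) (fun us => (resultLaw a M m K us).toOuterMeasure bad) ≤
      2 * (2 ^ d * η) + 2⁻¹ ^ K := by
  classical
  induction K with
  | zero =>
    refine (expect_mono fun us _ => toOuterMeasure_le_one _ _).trans ?_
    rw [expect_const, pow_zero]
    exact le_add_self
  | succ K ih =>
    have h₁ : expect (draws ν m) (fun us => (chunkLaw a M us).toOuterMeasure (some '' bad)) ≤
        2 ^ d * η := by
      let s : Finset (PARITY.domain d) := Finset.univ.filter fun r => r.1 ∈ bad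
      calc _ ≤ expect (draws ν m) (fun us => ∑ r ∈ s, expect (keptLaw a M us) (solves r)) :=
            expect_mono fun us _ => chunkLaw_bad_le a M us bad s fun r hr => by simp [s, hr]
        _ = ∑ r ∈ s, (keepProb a * expect ν (fun u => solves r [u]) + dropProb a) ^ m := by
            rw [expect_sum]
            simp only [expect_solves h]
        _ ≤ ∑ r ∈ s, η := Finset.sum_le_sum fun r hr => hη r (Finset.mem_filter.1 hr).2
        _ ≤ ∑ _r : PARITY.domain d, η := Finset.sum_le_sum_of_subset (Finset.subset_univ s)
        _ = 2 ^ d * η := by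
            rw [Finset.sum_const, Finset.card_univ, card_domain]
            simp
    rw [show (K + 1) * m = m + K * m by ring]
    simp only [resultLaw_succ_bad]
    rw [expect_draws_add ν m (K * m) fun us vs =>
      (chunkLaw a M us).toOuterMeasure (some '' bad) +
        chunkLaw a M us none * (resultLaw a M m K vs).toOuterMeasure bad]
    calc _ ≤ expect (draws ν m) (fun us => (chunkLaw a M us).toOuterMeasure (some '' bad) +
          2⁻¹ * (2 * (2 ^ d * η) + 2⁻¹ ^ K)) := by
          refine expect_mono fun us hus => ?_
          rw [expect_add, expect_const, expect_mul_left]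
          gcongr
          exact chunkLaw_none_le a M ⟨r₀, fun u hu => hr₀ u (mem_support_of_mem_draws hus hu)⟩
      _ ≤ 2 ^ d * η + 2⁻¹ * (2 * (2 ^ d * η) + 2⁻¹ ^ K) := by
          rw [expect_add, expect_const]
          gcongr
      _ = 2 ^ d * η + ((2⁻¹ * 2) * (2 ^ d * η) + 2⁻¹ ^ (K + 1)) := by rw [pow_succ']; ring
      _ = _ := by
          rw [ENNReal.inv_mul_cancel (by norm_num) (by norm_num)]
          ring

end Accuracy

/-! ### Numerical parameters of the learner -/

theorem keepProb_eq_ofReal (a : ℕ) : keepProb a = ENNReal.ofReal ((1 / 2) ^ a) := by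
  rw [keepProb, ENNReal.ofReal_pow (by norm_num), one_div, ENNReal.ofReal_inv_of_pos (by norm_num)]
  simp

theorem dropProb_eq_ofReal (a : ℕ) : dropProb a = ENNReal.ofReal (1 - (1 / 2) ^ a) := by
  have h := keepProb_eq_ofReal a
  rw [keepProb] at h
  rw [dropProb, h, ENNReal.ofReal_sub _ (by positivity), ENNReal.ofReal_one]

theorem randomizedAlg_parityLearner {d n : ℕ} (k : Params) (hk : k.1 = d)
    (hn : n = (k.2.2.2 + 1) * bound chunkExamples k)
    (ha : powerExponent (4 * k.2.1) ≤ 8 * k.2.1) (z : Fin n → PARITY.Example d) :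
    randomizedAlg parityLearner k (bound ((MvPolynomial.X 3 + 1) * chunkCoins) k) z =
      resultLaw (powerExponent (4 * k.2.1)) (8 * k.2.1) (bound chunkExamples k) (k.2.2.2 + 1)
        (List.ofFn z) := by
  subst hk
  have hc : bound chunkCoins k = 1 + k.1 + bound chunkExamples k * (8 * k.2.1) := by
    simp [bound, chunkCoins]
  have hr : bound ((MvPolynomial.X 3 + 1) * chunkCoins) k =
      (k.2.2.2 + 1) * (1 + k.1 + bound chunkExamples k * (8 * k.2.1)) := by
    rw [← hc]
    simp [bound]
  rw [← map_firstResult ha k.2.2.2 (List.ofFn z) (by rw [List.length_ofFn, hn]),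
    randomizedAlg, hr, coins_eq_draws]
  congr 1
  funext ω
  simp only [parityLearner, hc]
  congr 1
  rw [List.map_ofFn]
  rfl

/-- With `p = 2^(-a)`, the hypotheses give `p ≤ 1/4` and `4 * p ≤ ε`, so `1 + p ≤ (1 + 4 * p) * (1 -
p)` and `1 + 4 * p ≤ exp ε`. -/
theorem privacy_ratio {ε : ℝ} {e a : ℕ} (he : 1 / ε ≤ e) (hε : 0 < ε) (ha : 4 * e < 2 ^ a) :
    1 + keepProb a ≤ ENNReal.ofReal (Real.exp ε) * dropProb a := by
  set p : ℝ := (1 / 2) ^ a with hp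
  have hp0 : 0 < p := by positivity
  have h2a : p * 2 ^ a = 1 := by rw [hp, ← mul_pow]; norm_num
  have ha' : (4 * e : ℝ) < 2 ^ a := by exact_mod_cast ha
  have he1 : (1 : ℝ) ≤ e := by
    have : 0 < (e : ℝ) := lt_of_lt_of_le (by positivity) he
    exact_mod_cast this
  have hpe : p * (4 * e) ≤ 1 := by
    rw [← h2a]
    gcongr
  have hp4 : p ≤ 1 / 4 := by nlinarith
  have hpε : 4 * p ≤ ε := by
    have h₁ : 1 ≤ e * ε := by rwa [div_le_iff₀ hε] at he
    nlinarith
  rw [keepProb_eq_ofReal, dropProb_eq_ofReal, ← ENNReal.ofReal_one,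
    ← ENNReal.ofReal_add zero_le_one (by positivity), ← ENNReal.ofReal_mul (Real.exp_nonneg _)]
  refine ENNReal.ofReal_le_ofReal ?_
  have h₂ := Real.add_one_le_exp ε
  calc 1 + p ≤ (1 + 4 * p) * (1 - p) := by nlinarith
    _ ≤ Real.exp ε * (1 - p) := by
        refine mul_le_mul_of_nonneg_right ?_ (by linarith)
        linarith

/-- Each example eliminates an inaccurate parity with probability at least `p * α`, where `p =
2^(-a) ≥ 1 / (8 * e)`. The exponent is chosen so that `p * α` times it is at least `L`, and `exp
(-L) ≤ 2^(-L)`. -/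
theorem survival_le {α : ℝ} (hα : 0 < α) (hα1 : α < 1) {a e A L : ℕ} (hA : 1 / α ≤ A)
    (ha : 2 ^ a ≤ 8 * e) {x : ℝ≥0∞} (hx : x ≤ ENNReal.ofReal (1 - α)) :
    (keepProb a * x + dropProb a) ^ (L * A * (8 * e)) ≤ 2⁻¹ ^ L := by
  set p : ℝ := (1 / 2) ^ a with hp
  have hp0 : 0 < p := by positivity
  have hp1 : p ≤ 1 := pow_le_one₀ (by norm_num) (by norm_num)
  have h2a : p * 2 ^ a = 1 := by rw [hp, ← mul_pow]; norm_num
  have ha' : (2 ^ a : ℝ) ≤ 8 * e := by exact_mod_cast ha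
  have h₁ : keepProb a * x + dropProb a ≤ ENNReal.ofReal (1 - p * α) := by
    calc _ ≤ ENNReal.ofReal p * ENNReal.ofReal (1 - α) + ENNReal.ofReal (1 - p) := by
          rw [keepProb_eq_ofReal, dropProb_eq_ofReal]
          gcongr
      _ = _ := by
          rw [← ENNReal.ofReal_mul hp0.le, ← ENNReal.ofReal_add
            (mul_nonneg hp0.le (by linarith)) (by linarith)]
          congr 1
          ring
  have hpα : p * α ≤ 1 := by nlinarith
  have hkeep := keepProb_eq_ofReal L
  rw [keepProb] at hkeep
  refine (pow_le_pow_left₀ zero_le h₁ _).trans ?_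
  rw [hkeep, ← ENNReal.ofReal_pow (by linarith)]
  refine ENNReal.ofReal_le_ofReal ?_
  have h₂ : 1 ≤ A * α := by rwa [div_le_iff₀ hα] at hA
  have h₃ : 1 ≤ p * (8 * e) := by
    rw [← h2a]
    gcongr
  calc (1 - p * α) ^ (L * A * (8 * e)) ≤ Real.exp (-(p * α)) ^ (L * A * (8 * e)) := by
        refine pow_le_pow_left₀ (by linarith) ?_ _
        have := Real.add_one_le_exp (-(p * α))
        linarith
    _ = Real.exp (-(L * ((A * α) * (p * (8 * e))))) := by
        rw [← Real.exp_nat_mul]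
        push_cast
        ring_nf
    _ ≤ Real.exp (-(L * (1 * 1))) := by
        gcongr
    _ = Real.exp (-1) ^ L := by
        rw [← Real.exp_nat_mul]
        ring_nf
    _ ≤ (1 / 2) ^ L := by
        refine pow_le_pow_left₀ (Real.exp_nonneg _) ?_ _
        rw [Real.exp_neg, one_div]
        refine inv_anti₀ (by norm_num) ?_
        have := Real.add_one_le_exp 1
        linarith

theorem efficientlyPrivatelyPACLearnable_parity : EfficientlyPrivatelyPACLearnable PARITY := by
  classical
  refine ⟨(MvPolynomial.X 3 + 1) * chunkExamples, (MvPolynomial.X 3 + 1) * chunkCoins,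
    parityLearner, fun x => parityBit x.1 x.2, PolyTime.parityLearner, PolyTime.parityEvaluation,
    fun d ε hε α hα β hβ => ?_⟩
  dsimp only
  set k := params d ε α β with hk
  have hk1 : k.1 = d := rfl
  have hn : bound ((MvPolynomial.X 3 + 1) * chunkExamples) k =
      (k.2.2.2 + 1) * bound chunkExamples k := by simp [bound]
  have hm : bound chunkExamples k = (d + k.2.2.2 + 2) * k.2.2.1 * (8 * k.2.1) := by
    simp [bound, chunkExamples, hk1]
  have he : 1 / ε ≤ k.2.1 := Nat.le_ceil _
  have he1 : 1 ≤ k.2.1 := Nat.one_le_ceil_iff.2 (by positivity)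
  have hlt := lt_two_pow_powerExponent (n := 4 * k.2.1) (by omega)
  have hle := two_pow_powerExponent_le (n := 4 * k.2.1) (by omega)
  have ha : powerExponent (4 * k.2.1) ≤ 8 * k.2.1 := by
    have := Nat.lt_two_pow_self (n := powerExponent (4 * k.2.1))
    omega
  refine ⟨?_, ?_⟩
  · refine differentiallyPrivate_of_apply_le fun z z' i hz o => ?_
    obtain ⟨us, vs, u, u', h₁, h₂⟩ := exists_ofFn_eq_append hz
    have hexp : (1 : ℝ≥0∞) ≤ ENNReal.ofReal (Real.exp ε) := by
      rw [ENNReal.one_le_ofReal]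
      exact Real.one_le_exp hε.le
    rw [randomizedAlg_parityLearner k hk1 hn ha, randomizedAlg_parityLearner k hk1 hn ha, h₁, h₂]
    exact resultLaw_apply_le ha hexp (privacy_ratio he hε hlt) _ us vs u u' o
  · intro c hc μ
    obtain ⟨r₀, rfl⟩ := mem_concepts_iff.1 hc
    rw [pacSucceeds_iff]
    simp only [randomizedAlg_parityLearner k hk1 hn ha, PMF.toOuterMeasure_map_apply]
    set ν : PMF (PARITY.Example d) := μ.map fun x => (x, parityFun r₀.1 x) with hν
    set bad : Set (List Bool) := hypothesis PARITY d (fun x => parityBit x.1 x.2) ⁻¹'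
      {h | err μ (parityFun r₀.1) h ≤ ENNReal.ofReal α}ᶜ with hbad
    have h₁ := expect_map (iid ν (bound ((MvPolynomial.X 3 + 1) * chunkExamples) k)) List.ofFn
      fun us => (resultLaw (powerExponent (4 * k.2.1)) (8 * k.2.1) (bound chunkExamples k)
        (k.2.2.2 + 1) us).toOuterMeasure bad
    refine h₁.symm.le.trans ?_
    rw [map_iid, hn]
    -- Write `ℓ` for `k.2.2.2`. The summand `d` pays for the union bound over all parities, and the
    -- extra 2 makes the accuracy term `2^(-(ℓ+1))`. The `ℓ + 1` chunks make the failure term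
    -- equally small, and together they give `2^(-ℓ) ≤ β`.
    refine (expect_resultLaw_bad_le ha (r₀ := r₀) (η := 2⁻¹ ^ (d + k.2.2.2 + 2)) ?_ ?_ _).trans ?_
    · intro u hu
      obtain ⟨x, -, rfl⟩ := (PMF.mem_support_map_iff _ _ _).1 hu
      exact parityBit_comm _ _
    · intro r hr
      rw [hm]
      refine survival_le hα.1 (by linarith [hα.2]) (Nat.le_ceil _) (by omega) ?_
      have h₂ : expect ν (fun u => solves r [u]) + err μ (parityFun r₀.1) (parityFun r.1) = 1 := by
        rw [err, hν, expect_map, add_comm, ← toOuterMeasure_add_compl μ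
          {x | parityFun r.1 x ≠ parityFun r₀.1 x}]
        congr 1
        rw [toOuterMeasure_eq_expect]
        refine expect_congr fun x _ => ?_
        simp only [solves, mem_solutions_singleton]
        rw [parityBit_comm]
        by_cases hx : parityFun r.1 x = parityFun r₀.1 x
        · rw [Set.indicator_of_mem (by simpa using hx)]
          exact if_pos hx
        · rw [Set.indicator_of_notMem (by simpa using hx)]
          exact if_neg hx
      have h₃ : ENNReal.ofReal α < err μ (parityFun r₀.1) (parityFun r.1) := not_le.1 hr
      rw [ENNReal.ofReal_sub _ hα.1.le, ENNReal.ofReal_one, ← h₂]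
      exact ENNReal.le_sub_of_add_le_right ENNReal.ofReal_ne_top (by gcongr)
    · have hβ' : (1 / 2 : ℝ) ^ k.2.2.2 ≤ β := by
        have h₂ : Real.logb 2 (1 / β) ≤ k.2.2.2 := Nat.le_ceil _
        rw [Real.logb_le_iff_le_rpow (by norm_num) (by have := hβ.1; positivity),
          Real.rpow_natCast, div_le_iff₀ hβ.1] at h₂
        rw [one_div, inv_pow, inv_le_iff_one_le_mul₀ (by positivity), mul_comm]
        exact h₂
      refine le_trans (le_of_eq ?_) (ENNReal.ofReal_le_ofReal hβ')
      rw [← keepProb_eq_ofReal, keepProb]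
      have h₃ : (2 : ℝ≥0∞) ^ d * 2⁻¹ ^ d = 1 := by
        rw [← mul_pow, ENNReal.mul_inv_cancel (by norm_num) (by norm_num), one_pow]
      have h₄ : (2 : ℝ≥0∞) * 2⁻¹ = 1 := ENNReal.mul_inv_cancel (by norm_num) (by norm_num)
      calc (2 : ℝ≥0∞) * (2 ^ d * 2⁻¹ ^ (d + k.2.2.2 + 2)) + 2⁻¹ ^ (k.2.2.2 + 1)
          = (2 ^ d * 2⁻¹ ^ d) * (2 * 2⁻¹) * (2⁻¹ ^ k.2.2.2 * 2⁻¹) + 2⁻¹ ^ k.2.2.2 * 2⁻¹ := by ring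
        _ = 2⁻¹ ^ k.2.2.2 * (2⁻¹ + 2⁻¹) := by rw [h₃, h₄]; ring
        _ = 2⁻¹ ^ k.2.2.2 := by rw [ENNReal.inv_two_add_inv_two, mul_one]

end PrivateLearning

/-! ### Conclusion -/

theorem mainTheorem7 :
    ({C : PrivateLearning.ConceptClass | PrivateLearning.LocallyLearnable C} ⊂
      {C : PrivateLearning.ConceptClass | PrivateLearning.PrivatelyPACLearnable C}) ∧
    ({C : PrivateLearning.ConceptClass | PrivateLearning.EfficientlyLocallyLearnable C} ⊂
      {C : PrivateLearning.ConceptClass | PrivateLearning.EfficientlyPrivatelyPACLearnable C}) ∧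
    (PrivateLearning.PrivatelyPACLearnable PrivateLearning.PARITY ∧
      ¬ PrivateLearning.LocallyLearnable PrivateLearning.PARITY) ∧
    (PrivateLearning.EfficientlyPrivatelyPACLearnable PrivateLearning.PARITY ∧
      ¬ PrivateLearning.EfficientlyLocallyLearnable PrivateLearning.PARITY) := by
  have h₁ := PrivateLearning.efficientlyPrivatelyPACLearnable_parity
  have h₂ := h₁.privatelyPACLearnable
  have h₃ := PrivateLearning.not_locallyLearnable_parity
  have h₄ := PrivateLearning.not_efficientlyLocallyLearnable_parity
  exact ⟨⟨fun _ h => h.privatelyPACLearnable, fun h => h₃ (h h₂)⟩,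
    ⟨fun _ h => h.efficientlyPrivatelyPACLearnable, fun h => h₄ (h h₁)⟩, ⟨h₂, h₃⟩, h₁, h₄⟩
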